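/- **Setting.** Let $a,b\ge 0$, $\alpha=(a+b)/2$, $\beta=(a-b)/2$, and assume $\beta^2>\alpha$. For each (large) $n$ let $\sigma_1,\dots,\sigma_n$ be i.i.d. uniform on $\{-1,+1\}$ and, conditionally on $\sigma$, let $\mathcal G$ be the random graph on $\{1,\dots,n\}$ whose edges are independent, the edge $\{i,j\}$ being present with probability $a/n$ if $\sigma_i=\sigma_j$ and $b/n$ otherwise. Let $\ell=\ell(n)$ be integers with $\ell\sim c\log n$ for a constant $c>0$ such that $c\log\alpha<1/2$. Put $D_\ell(i)=\sum_{j:\,d_{\mathcal G}(i,j)=\ell}\sigma_j$, and let $y\in\mathbb R^n$ be the normed vector $$y_i=\operatorname{sgn}(\beta)^{\ell}\,\frac{D_\ell(i)}{\sqrt{\sum_{j=1}^n D_\ell(j)^2}}$$ (the sign is $1$ when $a>b$). Let $(V_t^+,V_t^-)_{t\ge0}$ satisfy $V_0^+=1$, $V_0^-=0$ and, conditionally on $\mathcal F_{t}=\sigma(V^\pm_k,\,k\le t)$, let $V_{t+1}^+,V_{t+1}^-$ be independent Poisson variables with means $\frac a2V_t^\pm+\frac b2V_t^\mp$. Let $\Delta_t=\beta^{-t}(V_t^+-V_t^-)$.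 **Theorem.** The sequence $\Delta_t$ converges almost surely to a square-integrable random variable $\Delta_\infty$, and the following hold. 1. In probability, $\displaystyle\lim_{n\to\infty}\frac1n\sum_{i=1}^n\beta^{-2\ell}D_\ell(i)^2=\mathbb E(\Delta_\infty^2)$. 2. For every $\tau\in\mathbb R$ that is a continuity point of the distributions of both $\Delta_\infty$ and $-\Delta_\infty$, and for both signs $\pm$, in probability, $$\lim_{n\to\infty}\frac1n\,\#\Big\{i:\ \sigma_i=\pm1,\ y_i\ge \tau/\sqrt{n\,\mathbb E(\Delta_\infty^2)}\Big\}=\tfrac12\,\mathbb P(\pm\Delta_\infty\ge\tau).$$ 3. Let $x=x^{(n)}\in\mathbb R^n$ be random vectors, defined on the same probability spaces as the graphs, with $\|x-y\|\to0$ in probability (Euclidean norm). For $t\in\mathbb R$ set $\hat\sigma_i=+1$ if $x_i\ge t/\sqrt{n\,\mathbb E(\Delta_\infty^2)}$ and $\hat\sigma_i=-1$ otherwise. If $t$ is an atom of the distribution of neither $\Delta_\infty$ nor $-\Delta_\infty$, then, in probability, $$\lim_{n\to\infty}\frac1n\sum_{i=1}^n\sigma_i\hat\sigma_i=\mathbb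 P(\Delta_\infty\ge t)-\mathbb P(-\Delta_\infty\ge t).$$ -/

import Mathlib

open MeasureTheory ProbabilityTheory Filter Topology

noncomputable section

/-! ### The stochastic block model -/

/-- Probability that the edge `{i, j}` is present, given the spins `s`. -/
def sbmEdgeProb (a b : ℝ) {n : ℕ} (s : Fin n → ℤˣ) (i j : Fin n) : ℝ :=
  if s i = s j then a / n else b / n

open Classical in
/-- Probability of the spin vector `s` together with the graph `H`: the spins are i.i.d. uniform on
`{-1, 1}` and, given the spins, the edges are independent with probabilities `sbmEdgeProb`. -/
def sbmMass (a b : ℝ) {n : ℕ} (s : Fin n → ℤˣ) (H : SimpleGraph (Fin n)) : ℝ :=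
  (1 / 2) ^ n * ∏ p : Fin n × Fin n with p.1 < p.2,
    if H.Adj p.1 p.2 then sbmEdgeProb a b s p.1 p.2 else 1 - sbmEdgeProb a b s p.1 p.2

/-- `(σ, G)` is a sample of the symmetric two-type stochastic block model on `n` nodes. -/
structure IsStochasticBlockModel (a b : ℝ) {n : ℕ} {Ω : Type*} [MeasurableSpace Ω] (P : Measure Ω)
    (σ : Ω → Fin n → ℤˣ) (G : Ω → SimpleGraph (Fin n)) : Prop where
  measurableSet : ∀ s H, MeasurableSet {ω | σ ω = s ∧ G ω = H}
  law : ∀ s H, P {ω | σ ω = s ∧ G ω = H} = ENNReal.ofReal (sbmMass a b s H)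

open Classical in
/-- `D_t(i)`: the sum of the spins of the nodes at graph distance exactly `t` from `i`
(the extended distance `edist` is infinite between distinct components). -/
def sphereSpin {n : ℕ} (s : Fin n → ℤˣ) (H : SimpleGraph (Fin n)) (t : ℕ) (i : Fin n) : ℝ :=
  ∑ j : Fin n with H.edist i j = (t : ℕ∞), ((s j : ℤ) : ℝ)

/-- The vector `(D_t(i))_i` divided by its Euclidean norm and multiplied by the sign of `β ^ t`
(so the sign is `1` when `0 < β`). -/
def normalizedSphereSpin (β : ℝ) {n : ℕ} (s : Fin n → ℤˣ) (H : SimpleGraph (Fin n)) (t : ℕ) :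
    EuclideanSpace ℝ (Fin n) :=
  WithLp.toLp 2 fun i =>
    (β / |β|) ^ t * (sphereSpin s H t i / Real.sqrt (∑ j, sphereSpin s H t j ^ 2))

/-- The spin estimates obtained by thresholding the vector `x` at level `θ`. -/
def thresholdSpin {n : ℕ} (x : EuclideanSpace ℝ (Fin n)) (θ : ℝ) (i : Fin n) : ℝ :=
  if θ ≤ x i then 1 else -1

/-- The overlap of the spins `s` with the estimates `s'`. -/
def spinOverlap {n : ℕ} (s : Fin n → ℤˣ) (s' : Fin n → ℝ) : ℝ :=
  (1 / (n : ℝ)) * ∑ i, ((s i : ℤ) : ℝ) * s' i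

/-! ### The two-type Poisson tree process -/

/-- The σ-algebra generated by the generations `0, …, t` of the process `(Vp, Vm)`. -/
abbrev treeHistory {Ω : Type*} (Vp Vm : ℕ → Ω → ℕ) (t : ℕ) : MeasurableSpace Ω :=
  ⨆ k ≤ t, (MeasurableSpace.comap (Vp k) ⊤ ⊔ MeasurableSpace.comap (Vm k) ⊤)

/-- `(Vp, Vm)` starts from `(1, 0)` and, given the past up to `t`, the next values are independent
Poisson variables of means `(a/2) Vp t + (b/2) Vm t` and `(a/2) Vm t + (b/2) Vp t`. -/
structure IsPoissonTreeProcess (a b : ℝ) {Ω : Type*} [MeasurableSpace Ω] (μ : Measure Ω)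
    (Vp Vm : ℕ → Ω → ℕ) : Prop where
  measurable_plus : ∀ t, Measurable (Vp t)
  measurable_minus : ∀ t, Measurable (Vm t)
  zero_plus : ∀ᵐ ω ∂μ, Vp 0 ω = 1
  zero_minus : ∀ᵐ ω ∂μ, Vm 0 ω = 0
  condLaw : ∀ t k m : ℕ,
    μ⟦{ω | Vp (t + 1) ω = k ∧ Vm (t + 1) ω = m} | treeHistory Vp Vm t⟧ =ᵐ[μ] fun ω =>
      (poissonMeasure (a / 2 * Vp t ω + b / 2 * Vm t ω).toNNReal).real {k} *
      (poissonMeasure (a / 2 * Vm t ω + b / 2 * Vp t ω).toNNReal).real {m}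

/-- `Δ_t = β ^ (-t) (V_t⁺ - V_t⁻)`. -/
def treeDelta (β : ℝ) {Ω : Type*} (Vp Vm : ℕ → Ω → ℕ) (t : ℕ) (ω : Ω) : ℝ :=
  (β ^ t)⁻¹ * ((Vp t ω : ℝ) - (Vm t ω : ℝ))

/-- `Δ_∞`, the pointwise limit of `Δ_t` (meaningful where the limit exists). -/
def treeDeltaLimit (β : ℝ) {Ω : Type*} (Vp Vm : ℕ → Ω → ℕ) (ω : Ω) : ℝ :=
  limUnder atTop fun t => treeDelta β Vp Vm t ω

/-! ### Convergence in probability -/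

/-- Convergence in probability to a constant of variables `X n`, each on its own space. -/
def TendstoInProb {Ω : ℕ → Type*} [∀ n, MeasurableSpace (Ω n)] (P : ∀ n, Measure (Ω n))
    (X : ∀ n, Ω n → ℝ) (c : ℝ) : Prop :=
  ∀ ε : ℝ, 0 < ε → Tendsto (fun n => P n {ω | ε ≤ |X n ω - c|}) atTop (𝓝 0)

end

set_option linter.unusedSectionVars false

noncomputable section

/-! ### Finite products of Bernoulli laws -/

/-! Condition on the spins, and call them balanced when their sum is at most `n ^ (2/3)` in absolute
value. By Chebyshev's inequality imbalance has probability at most `n ^ (-1/3)`, so it suffices to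
bound conditional expectations uniformly over balanced spins (`tendstoInProb_of_bernEx_le`). Given
the spins, the edges are independent Bernoulli variables and expectations are finite sums.
Breadth-first exploration from a vertex is then a Markov chain (`BfsState.bernEx_step`): each
unexplored vertex enters the next frontier independently, with the probability of having an edge to
the present frontier.

Let `D_t` be the spin sum over the sphere of radius `t`. One step multiplies the expected size of
the sphere by about `α`, and `D_t` by `β` up to a drift error of order (sphere size) * (ball size +
imbalance) / `n`. Third moments of ball sizes and `c log α < 1/2` keep this error harmless down to
depth `ℓ`, so `D_{t+1} - β D_t` has second moment `O(α ^ t)` (`eventually_increment_le`). Since `α <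
β ^ 2`, the variables `β ^ (-t) D_t` are Cauchy in mean square at a geometric rate that does not
depend on `n` (`eventually_normSpin_sub_sq_le`). The depth `ℓ` may therefore be replaced by a large
fixed depth `r`.

At fixed depth the sphere counts of either spin converge in law to the two-type Poisson tree: Le
Cam's inequality compares one step, and the errors add up
(`BfsState.abs_kernel_iterate_sub_treeOp_le`). Explorations from two vertices rarely meet; when they
do not, the second one runs in fresh randomness. This gives a second-moment law of large numbers
(`BfsState.bernEx_empMean_sub_sq_le`). On the tree side `Δ_t` has increments with geometrically
decaying second moments, hence converges almost surely and in mean square, and `E Δ_t ^ 2 ≥ 1` keeps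
the limit nondegenerate (`IsPoissonTreeProcess.treeDelta_limit`).

Together these give, for test functions of quadratic growth and each spin class, convergence of
empirical means of `h(β ^ (-ℓ) D_ℓ)` (`tendstoInProb_empMean`). The square function gives the second
moment. Threshold counts are squeezed between piecewise linear ramps; these are Lipschitz, so they
do not notice replacing the rescaled `x` by `β ^ (-ℓ) D_ℓ`, which is close in empirical mean square
(`mean_sq_scaled_sub_le`, `tendstoInProb_threshold`). The overlap is a linear combination of such
counts. -/

/-- The weight of the configuration `x` under the product of Bernoulli laws of parameters `p`. -/
def bernWeight {ι : Type*} [Fintype ι] (p : ι → ℝ) (x : ι → Bool) : ℝ :=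
  ∏ i, if x i then p i else 1 - p i

/-- Expectation under the product of Bernoulli laws of parameters `p`. -/
def bernEx {ι : Type*} [Fintype ι] [DecidableEq ι] (p : ι → ℝ) (f : (ι → Bool) → ℝ) : ℝ :=
  ∑ x, bernWeight p x * f x

section BernEx

variable {ι : Type*} [Fintype ι] [DecidableEq ι] {p : ι → ℝ}

lemma bernWeight_nonneg (hp : ∀ i, p i ∈ Set.Icc (0 : ℝ) 1) (x : ι → Bool) :
    0 ≤ bernWeight p x :=
  Finset.prod_nonneg fun i _ => by
    have := hp i
    split_ifs
    · exact this.1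
    · linarith [this.2]

lemma bernEx_add (f g : (ι → Bool) → ℝ) :
    bernEx p (fun x => f x + g x) = bernEx p f + bernEx p g := by
  simp [bernEx, mul_add, Finset.sum_add_distrib]

lemma bernEx_sub (f g : (ι → Bool) → ℝ) :
    bernEx p (fun x => f x - g x) = bernEx p f - bernEx p g := by
  simp [bernEx, mul_sub, Finset.sum_sub_distrib]

lemma bernEx_const_mul (c : ℝ) (f : (ι → Bool) → ℝ) :
    bernEx p (fun x => c * f x) = c * bernEx p f := by
  simp only [bernEx, Finset.mul_sum]
  exact Finset.sum_congr rfl fun x _ => by ring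

lemma bernEx_mul_const (c : ℝ) (f : (ι → Bool) → ℝ) :
    bernEx p (fun x => f x * c) = bernEx p f * c := by
  simp only [bernEx, Finset.sum_mul]
  exact Finset.sum_congr rfl fun x _ => by ring

lemma bernEx_sum {κ : Type*} (s : Finset κ) (f : κ → (ι → Bool) → ℝ) :
    bernEx p (fun x => ∑ k ∈ s, f k x) = ∑ k ∈ s, bernEx p (f k) := by
  simp only [bernEx, Finset.mul_sum]
  exact Finset.sum_comm

/-- Expectation of a product of functions of the single coordinates. -/
lemma bernEx_prod (h : ι → Bool → ℝ) :
    bernEx p (fun x => ∏ i, h i (x i)) = ∏ i, (p i * h i true + (1 - p i) * h i false) := by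
  have := Finset.prod_univ_sum (fun _ : ι => (Finset.univ : Finset Bool))
    (fun i b => (if b then p i else 1 - p i) * h i b)
  simp only [Fintype.sum_bool, Fintype.piFinset_univ] at this
  simp only [if_true, Bool.false_eq_true, if_false] at this
  rw [this]
  simp only [bernEx, bernWeight, Finset.prod_mul_distrib]

lemma bernEx_const (c : ℝ) : bernEx p (fun _ => c) = c := by
  have := bernEx_prod (p := p) (fun _ _ => 1)
  simp only [Finset.prod_const_one, mul_one, add_sub_cancel] at this
  calc bernEx p (fun _ => c) = bernEx p (fun _ => 1 * c) := by simp
    _ = c := by rw [bernEx_mul_const, this, one_mul]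

lemma bernEx_mono (hp : ∀ i, p i ∈ Set.Icc (0 : ℝ) 1) {f g : (ι → Bool) → ℝ}
    (h : ∀ x, f x ≤ g x) : bernEx p f ≤ bernEx p g :=
  Finset.sum_le_sum fun x _ => mul_le_mul_of_nonneg_left (h x) (bernWeight_nonneg hp x)

lemma bernEx_nonneg (hp : ∀ i, p i ∈ Set.Icc (0 : ℝ) 1) {f : (ι → Bool) → ℝ}
    (h : ∀ x, 0 ≤ f x) : 0 ≤ bernEx p f :=
  Finset.sum_nonneg fun x _ => mul_nonneg (bernWeight_nonneg hp x) (h x)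

lemma abs_bernEx_le (hp : ∀ i, p i ∈ Set.Icc (0 : ℝ) 1) (f : (ι → Bool) → ℝ) :
    |bernEx p f| ≤ bernEx p (fun x => |f x|) := by
  refine (Finset.abs_sum_le_sum_abs _ _).trans (le_of_eq ?_)
  refine Finset.sum_congr rfl fun x _ => ?_
  rw [abs_mul, abs_of_nonneg (bernWeight_nonneg hp x)]

/-- Functions of disjoint sets of coordinates are independent. -/
lemma bernEx_mul_of_dependsOn {J : Set ι} {f g : (ι → Bool) → ℝ} (hf : DependsOn f J)
    (hg : DependsOn g Jᶜ) : bernEx p (fun x => f x * g x) = bernEx p f * bernEx p g := by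
  classical
  let e := Equiv.piEquivPiSubtypeProd (fun i => i ∈ J) (fun _ : ι => Bool)
  let w1 : ({i // i ∈ J} → Bool) → ℝ := fun y => ∏ i, if y i then p i else 1 - p i
  let w2 : ({i // i ∉ J} → Bool) → ℝ := fun y => ∏ i, if y i then p i else 1 - p i
  have hw : ∀ y z, bernWeight p (e.symm (y, z)) = w1 y * w2 z := by
    intro y z
    rw [bernWeight, ← Fintype.prod_subtype_mul_prod_subtype (fun i => i ∈ J)]
    congr 1
    · exact Finset.prod_congr rfl fun i _ => by simp [e, Equiv.piEquivPiSubtypeProd, i.2]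
    · exact Finset.prod_congr rfl fun i _ => by simp [e, Equiv.piEquivPiSubtypeProd, i.2]
  have key : ∀ h : (ι → Bool) → ℝ, bernEx p h = ∑ y, ∑ z, w1 y * w2 z * h (e.symm (y, z)) := by
    intro h
    rw [bernEx, ← e.symm.sum_comp, Fintype.sum_prod_type]
    exact Finset.sum_congr rfl fun y _ => Finset.sum_congr rfl fun z _ => by rw [hw]
  -- Arbitrary fillings: `f` ignores the coordinates outside `J` and `g` those inside, so each may
  -- be read at a fixed value of the coordinates it ignores.
  let y0 : {i // i ∈ J} → Bool := fun _ => true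
  let z0 : {i // i ∉ J} → Bool := fun _ => true
  have hf' : ∀ y z, f (e.symm (y, z)) = f (e.symm (y, z0)) := by
    intro y z
    apply hf
    intro i hi
    simp [e, Equiv.piEquivPiSubtypeProd, hi]
  have hg' : ∀ y z, g (e.symm (y, z)) = g (e.symm (y0, z)) := by
    intro y z
    apply hg
    intro i hi
    have : i ∉ J := hi
    simp [e, Equiv.piEquivPiSubtypeProd, this]
  have h1 := key fun _ => 1
  rw [bernEx_const] at h1
  have hfe : bernEx p f = (∑ y, w1 y * f (e.symm (y, z0))) * ∑ z, w2 z := by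
    rw [key, Finset.sum_mul_sum]
    exact Finset.sum_congr rfl fun y _ => Finset.sum_congr rfl fun z _ => by rw [hf']; ring
  have hge : bernEx p g = (∑ y, w1 y) * ∑ z, w2 z * g (e.symm (y0, z)) := by
    rw [key, Finset.sum_mul_sum]
    exact Finset.sum_congr rfl fun y _ => Finset.sum_congr rfl fun z _ => by rw [hg']; ring
  have h11 : (∑ y, w1 y) * ∑ z, w2 z = 1 := by
    rw [h1, Finset.sum_mul_sum]
    exact Finset.sum_congr rfl fun y _ => Finset.sum_congr rfl fun z _ => by ring
  have hfg : bernEx p (fun x => f x * g x)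
      = (∑ y, w1 y * f (e.symm (y, z0))) * ∑ z, w2 z * g (e.symm (y0, z)) := by
    rw [key, Finset.sum_mul_sum]
    exact Finset.sum_congr rfl fun y _ => Finset.sum_congr rfl fun z _ => by rw [hf', hg']; ring
  rw [hfg, hfe, hge]
  linear_combination (-(∑ y, w1 y * f (e.symm (y, z0))) * ∑ z, w2 z * g (e.symm (y0, z))) * h11

/-- Expectation of a product over a subset of the coordinates. -/
lemma bernEx_prod_finset (A : Finset ι) (h : ι → Bool → ℝ) :
    bernEx p (fun x => ∏ i ∈ A, h i (x i))
      = ∏ i ∈ A, (p i * h i true + (1 - p i) * h i false) := by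
  have := bernEx_prod (p := p) (fun i b => if i ∈ A then h i b else 1)
  simp only [Finset.prod_ite_mem, Finset.univ_inter] at this
  rw [this, ← Finset.prod_subset (Finset.subset_univ A)]
  · exact Finset.prod_congr rfl fun i hi => by simp [hi]
  · intro i _ hi; simp [hi]

/-- Some coordinate of the block `B` is occupied. -/
def blockOr (B : Finset ι) (x : ι → Bool) : Bool := decide (∃ e ∈ B, x e = true)

lemma dependsOn_blockOr (B : Finset ι) : DependsOn (blockOr B) (B : Set ι) := by
  intro x y h
  unfold blockOr
  congr 1
  exact propext ⟨fun ⟨e, he, h1⟩ => ⟨e, he, by rw [← h e he]; exact h1⟩,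
    fun ⟨e, he, h1⟩ => ⟨e, he, by rw [h e he]; exact h1⟩⟩

/-- The `false` case keeps the shape `1 - (1 - ∏)` so that the result is literally the Bernoulli
weight of parameter `1 - ∏ (1 - p e)`; this lets `bernEx_blocks` close by `rfl`. -/
lemma bernEx_blockOr (B : Finset ι) (b : Bool) :
    bernEx p (fun x => if blockOr B x = b then (1 : ℝ) else 0)
      = if b then 1 - ∏ e ∈ B, (1 - p e) else 1 - (1 - ∏ e ∈ B, (1 - p e)) := by
  have h0 : bernEx p (fun x => if blockOr B x = false then (1 : ℝ) else 0)
      = ∏ e ∈ B, (1 - p e) := by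
    have := bernEx_prod_finset (p := p) B (fun _ b => if b then 0 else 1)
    simp only [if_true, mul_zero, Bool.false_eq_true, if_false, mul_one, zero_add] at this
    rw [← this]
    congr 1
    ext x
    by_cases hx : ∃ e ∈ B, x e = true
    · obtain ⟨e, he, hxe⟩ := hx
      rw [Finset.prod_eq_zero he (by simp [hxe])]
      rw [if_neg]
      simpa [blockOr] using ⟨e, he, hxe⟩
    · rw [Finset.prod_eq_one]
      · simp only [blockOr, decide_eq_false hx, if_true]
      · intro e he
        have : ¬ x e = true := fun h => hx ⟨e, he, h⟩
        simp [this]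
  cases b
  · simpa using h0
  · have : (fun x => if blockOr B x = true then (1 : ℝ) else 0)
        = fun x => 1 - if blockOr B x = false then (1 : ℝ) else 0 := by
      ext x; cases blockOr B x <;> simp
    rw [this, bernEx_sub, bernEx_const, h0]; simp

/-- Occupation of disjoint blocks is a product Bernoulli configuration, independent of the other
coordinates. -/
lemma bernEx_blocks {κ : Type*} [Fintype κ] [DecidableEq κ] (B : κ → Finset ι)
    (hB : Pairwise fun u v => Disjoint (B u) (B v)) (g : (κ → Bool) → (ι → Bool) → ℝ)
    (hg : ∀ y, DependsOn (g y) {e | ∀ u, e ∉ B u}) :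
    bernEx p (fun x => g (fun u => blockOr (B u) x) x)
      = bernEx (fun u => 1 - ∏ e ∈ B u, (1 - p e)) (fun y => bernEx p (g y)) := by
  -- The blocks are peeled off one at a time: each is independent of the remaining blocks and of `g
  -- y`.
  have key : ∀ (y : κ → Bool) (W : Finset κ),
      bernEx p (fun x => (∏ u ∈ W, if blockOr (B u) x = y u then (1 : ℝ) else 0) * g y x)
        = (∏ u ∈ W, if y u then 1 - ∏ e ∈ B u, (1 - p e)
            else 1 - (1 - ∏ e ∈ B u, (1 - p e))) * bernEx p (g y) := by
    intro y W
    induction W using Finset.induction_on with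
    | empty => simp
    | insert u W hu ih =>
      simp only [Finset.prod_insert hu, mul_assoc]
      rw [bernEx_mul_of_dependsOn (J := (B u : Set ι)), ih, bernEx_blockOr]
      · intro x x' h
        show (if blockOr (B u) x = y u then (1 : ℝ) else 0) = _
        rw [dependsOn_blockOr (B u) h]
      · intro x x' h
        have h1 : g y x = g y x' := hg y fun e he => h e (he u)
        have h2 : ∀ v ∈ W, blockOr (B v) x = blockOr (B v) x' := by
          intro v hv
          apply dependsOn_blockOr
          intro e he
          apply h
          have : Disjoint (B v) (B u) := hB (by rintro rfl; exact hu hv)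
          exact Finset.disjoint_left.mp this he
        show (∏ u ∈ W, if blockOr (B u) x = y u then (1 : ℝ) else 0) * g y x = _
        rw [h1]
        congr 1
        exact Finset.prod_congr rfl fun v hv => by rw [h2 v hv]
  have e1 : ∀ x, g (fun u => blockOr (B u) x) x
      = ∑ y : κ → Bool, (∏ u, if blockOr (B u) x = y u then (1 : ℝ) else 0) * g y x := by
    intro x
    rw [Finset.sum_eq_single (fun u => blockOr (B u) x)]
    · simp
    · intro y _ hy
      obtain ⟨u, hu⟩ : ∃ u, blockOr (B u) x ≠ y u := by
        by_contra h
        push Not at h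
        exact hy (funext fun u => (h u).symm)
      rw [Finset.prod_eq_zero (Finset.mem_univ u) (by simp [hu]), zero_mul]
    · simp
  simp_rw [e1]
  rw [bernEx_sum]
  simp_rw [key]
  rfl

end BernEx

/-! ### Breadth-first exploration -/

/-- A state of the exploration: the vertices all of whose edges are revealed, and the frontier. -/
structure BfsState (V : Type*) where
  removed : Finset V
  front : Finset V
  disj : Disjoint removed front

section Bfs

variable {V : Type*} [Fintype V] [DecidableEq V]

namespace BfsState

/-- The set of explored vertices. -/
def ball (S : BfsState V) : Finset V := S.removed ∪ S.front

/-- The state with the explored vertices removed and a new frontier selected by `y`. -/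
def next (S : BfsState V) (y : V → Bool) : BfsState V where
  removed := S.ball
  front := Finset.univ.filter fun u => u ∉ S.ball ∧ y u = true
  disj := by
    rw [Finset.disjoint_left]
    intro u hu h
    exact (Finset.mem_filter.mp h).2.1 hu

/-- The edges joining `u` to the frontier, if `u` is unexplored. -/
def block (S : BfsState V) (u : V) : Finset (Sym2 V) :=
  if u ∈ S.ball then ∅ else S.front.image fun v => s(u, v)

/-- One step of the exploration of the graph with edge indicators `x`. -/
def step (x : Sym2 V → Bool) (S : BfsState V) : BfsState V :=
  S.next fun u => blockOr (S.block u) x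

/-- The conditional probability that `u` is in the next frontier. -/
def hitProb (p : Sym2 V → ℝ) (S : BfsState V) (u : V) : ℝ := 1 - ∏ e ∈ S.block u, (1 - p e)

/-- The transition operator of the exploration. -/
def kernel (p : Sym2 V → ℝ) (f : BfsState V → ℝ) (S : BfsState V) : ℝ :=
  bernEx (S.hitProb p) fun y => f (S.next y)

/-- The edges which avoid the set `R`. -/
def edgesAvoiding (R : Finset V) : Set (Sym2 V) := {e | ∀ u ∈ R, u ∉ e}

lemma edgesAvoiding_anti {R R' : Finset V} (h : R ⊆ R') :
    edgesAvoiding R' ⊆ edgesAvoiding R := fun _ he u hu => he u (h hu)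

/-- An edge shared by the blocks of `u ≠ v` would have to be the pair of `u` and `v`, with `v` in
the frontier; but only unexplored vertices have a nonempty block. -/
lemma block_disjoint (S : BfsState V) : Pairwise fun u v => Disjoint (S.block u) (S.block v) := by
  intro u v huv
  unfold block
  split_ifs with h1 h2 h2
  · exact Finset.disjoint_empty_left _
  · exact Finset.disjoint_empty_left _
  · exact Finset.disjoint_empty_right _
  · rw [Finset.disjoint_left]
    intro e he he'
    obtain ⟨w, hw, rfl⟩ := Finset.mem_image.mp he
    obtain ⟨w', hw', h⟩ := Finset.mem_image.mp he'
    rw [Sym2.eq_iff] at h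
    rcases h with ⟨h, _⟩ | ⟨h, _⟩
    · exact huv h.symm
    · subst h
      exact h2 (Finset.mem_union_right _ hw)

lemma edgesAvoiding_ball_subset (S : BfsState V) :
    edgesAvoiding S.ball ⊆ {e | ∀ u, e ∉ S.block u} := by
  intro e he u heu
  unfold block at heu
  split_ifs at heu with h
  · simp at heu
  · obtain ⟨v, hv, rfl⟩ := Finset.mem_image.mp heu
    exact he v (Finset.mem_union_right _ hv) (Sym2.mem_mk_right u v)

/-- The edges inspected join an unexplored vertex to a frontier vertex, and neither endpoint is
removed; for the frontier endpoint this is the field `disj`. -/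
lemma dependsOn_step (S : BfsState V) :
    DependsOn (fun x => step x S) (edgesAvoiding S.removed) := by
  intro x y h
  show S.next _ = S.next _
  congr 1
  ext u : 1
  apply dependsOn_blockOr
  intro e he
  apply h
  simp only [Finset.mem_coe, block] at he
  split_ifs at he with hu
  · simp at he
  · obtain ⟨v, hv, rfl⟩ := Finset.mem_image.mp he
    intro w hw hwe
    rcases Sym2.mem_iff.mp hwe with rfl | rfl
    · exact hu (Finset.mem_union_left _ hw)
    · exact Finset.disjoint_left.mp S.disj hw hv

lemma dependsOn_iterate_step (t : ℕ) (S : BfsState V) :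
    DependsOn (fun x => (step x)^[t] S) (edgesAvoiding S.removed) := by
  induction t generalizing S with
  | zero => intro x y _; rfl
  | succ t ih =>
    intro x y h
    have h1 : step x S = step y S := dependsOn_step S h
    simp only [Function.iterate_succ_apply]
    rw [h1]
    apply ih
    intro e he
    exact h e (edgesAvoiding_anti Finset.subset_union_left he)

lemma removed_subset_iterate (x : Sym2 V → Bool) (t : ℕ) (S : BfsState V) :
    S.removed ⊆ ((step x)^[t] S).removed := by
  induction t generalizing S with
  | zero => exact subset_rfl
  | succ t ih =>
    rw [Function.iterate_succ_apply]
    exact Finset.subset_union_left.trans (ih (step x S))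

/-- Markov property of the exploration. -/
lemma bernEx_step (p : Sym2 V → ℝ) (S : BfsState V) (g : BfsState V → (Sym2 V → Bool) → ℝ)
    (hg : ∀ S', S'.removed = S.ball → DependsOn (g S') (edgesAvoiding S'.removed)) :
    bernEx p (fun x => g (step x S) x) = kernel p (fun S' => bernEx p (g S')) S :=
  bernEx_blocks (p := p) S.block S.block_disjoint (fun y x => g (S.next y) x) fun y =>
    (hg (S.next y) rfl).mono S.edgesAvoiding_ball_subset

/-- The functional `g` may still read the edges that avoid the removed vertices of the final state,
and these are averaged out separately. This is what allows a second exploration to be run in the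
unexplored part of the graph. -/
lemma bernEx_iterate_step (p : Sym2 V → ℝ) (t : ℕ) (S : BfsState V)
    (g : BfsState V → (Sym2 V → Bool) → ℝ)
    (hg : ∀ S', DependsOn (g S') (edgesAvoiding S'.removed)) :
    bernEx p (fun x => g ((step x)^[t] S) x) = (kernel p)^[t] (fun S' => bernEx p (g S')) S := by
  induction t generalizing S with
  | zero => rfl
  | succ t ih =>
    rw [Function.iterate_succ_apply']
    simp only [Function.iterate_succ_apply]
    rw [bernEx_step p S (fun S' x => g ((step x)^[t] S') x)]
    · congr 1; ext S'; exact ih S'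
    · intro S' _ x y h
      show g ((step x)^[t] S') x = g ((step y)^[t] S') y
      rw [show (step x)^[t] S' = (step y)^[t] S' from dependsOn_iterate_step t S' h]
      apply hg
      intro e he
      apply h
      exact edgesAvoiding_anti (removed_subset_iterate y t S') he

lemma bernEx_iterate (p : Sym2 V → ℝ) (t : ℕ) (S : BfsState V) (f : BfsState V → ℝ) :
    bernEx p (fun x => f ((step x)^[t] S)) = (kernel p)^[t] f S := by
  rw [bernEx_iterate_step p t S (fun S' _ => f S') fun S' x y _ => rfl]
  simp only [bernEx_const]

/-- The exploration after `t + 1` steps, in terms of that after `t` steps. -/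
lemma bernEx_iterate_succ (p : Sym2 V → ℝ) (t : ℕ) (S : BfsState V)
    (F : BfsState V → BfsState V → ℝ) :
    bernEx p (fun x => F ((step x)^[t] S) ((step x)^[t + 1] S))
      = bernEx p (fun x => kernel p (F ((step x)^[t] S)) ((step x)^[t] S)) := by
  simp only [Function.iterate_succ_apply']
  rw [bernEx_iterate_step p t S (fun S' x => F S' (step x S')),
    bernEx_iterate p t S (fun S' => kernel p (F S') S')]
  · refine congrArg (fun f => (kernel p)^[t] f S) (funext fun S' => ?_)
    rw [bernEx_step p S' (fun T _ => F S' T)]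
    · simp only [bernEx_const]
    · intro T _ x y _; rfl
  · intro S' x y h
    show F S' (step x S') = F S' (step y S')
    rw [show step x S' = step y S' from dependsOn_step S' h]

lemma hitProb_mem (p : Sym2 V → ℝ) (hp : ∀ e, p e ∈ Set.Icc (0 : ℝ) 1) (S : BfsState V) (u : V) :
    S.hitProb p u ∈ Set.Icc (0 : ℝ) 1 := by
  have h0 : 0 ≤ ∏ e ∈ S.block u, (1 - p e) :=
    Finset.prod_nonneg fun e _ => by linarith [(hp e).2]
  have h1 : ∏ e ∈ S.block u, (1 - p e) ≤ 1 :=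
    Finset.prod_le_one (fun e _ => by linarith [(hp e).2]) fun e _ => by linarith [(hp e).1]
  constructor <;> simp only [hitProb] <;> linarith

lemma kernel_mono {p : Sym2 V → ℝ} (hp : ∀ e, p e ∈ Set.Icc (0 : ℝ) 1) {f g : BfsState V → ℝ}
    (h : ∀ S, f S ≤ g S) (S : BfsState V) : kernel p f S ≤ kernel p g S :=
  bernEx_mono (S.hitProb_mem p hp) fun _ => h _

lemma kernel_sub {p : Sym2 V → ℝ} (f g : BfsState V → ℝ) (S : BfsState V) :
    kernel p (fun S => f S - g S) S = kernel p f S - kernel p g S := bernEx_sub _ _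

lemma abs_kernel_le {p : Sym2 V → ℝ} (hp : ∀ e, p e ∈ Set.Icc (0 : ℝ) 1) (f : BfsState V → ℝ)
    (S : BfsState V) : |kernel p f S| ≤ kernel p (fun S => |f S|) S :=
  abs_bernEx_le (S.hitProb_mem p hp) _

lemma kernel_const_mul {p : Sym2 V → ℝ} (c : ℝ) (f : BfsState V → ℝ) (S : BfsState V) :
    kernel p (fun S => c * f S) S = c * kernel p f S := bernEx_const_mul _ _

lemma kernel_iterate_mono {p : Sym2 V → ℝ} (hp : ∀ e, p e ∈ Set.Icc (0 : ℝ) 1)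
    {f g : BfsState V → ℝ} (h : ∀ S, f S ≤ g S) (t : ℕ) (S : BfsState V) :
    (kernel p)^[t] f S ≤ (kernel p)^[t] g S := by
  rw [← bernEx_iterate, ← bernEx_iterate]
  exact bernEx_mono hp fun _ => h _

/-- A function which the transition operator multiplies at most by `γ` grows at most
geometrically along the exploration. -/
lemma bernEx_iterate_le {p : Sym2 V → ℝ} (hp : ∀ e, p e ∈ Set.Icc (0 : ℝ) 1)
    {Φ : BfsState V → ℝ} {γ : ℝ} (hγ : 0 ≤ γ) (hΦ : ∀ S, kernel p Φ S ≤ γ * Φ S) (t : ℕ)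
    (S : BfsState V) : bernEx p (fun x => Φ ((step x)^[t] S)) ≤ γ ^ t * Φ S := by
  rw [bernEx_iterate]
  induction t generalizing S with
  | zero => simp
  | succ t ih =>
    rw [Function.iterate_succ_apply']
    calc kernel p ((kernel p)^[t] Φ) S ≤ kernel p (fun S => γ ^ t * Φ S) S := kernel_mono hp ih S
      _ = γ ^ t * kernel p Φ S := kernel_const_mul _ _ _
      _ ≤ γ ^ t * (γ * Φ S) := mul_le_mul_of_nonneg_left (hΦ S) (pow_nonneg hγ t)
      _ = γ ^ (t + 1) * Φ S := by ring

/-- The exploration from a single vertex, avoiding the set `R`. -/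
def root (R : Finset V) (i : V) (h : i ∉ R) : BfsState V := ⟨R, {i}, by simpa using h⟩

end BfsState

/-- The graph with edge indicators `x`. -/
def edgeGraph (x : Sym2 V → Bool) : SimpleGraph V where
  Adj u v := u ≠ v ∧ x s(u, v) = true
  symm := ⟨fun u v h => ⟨h.1.symm, by rw [Sym2.eq_swap]; exact h.2⟩⟩
  loopless := ⟨fun _ h => h.1 rfl⟩

namespace BfsState

lemma mem_front_step (x : Sym2 V → Bool) (S : BfsState V) (u : V) :
    u ∈ (step x S).front ↔ u ∉ S.ball ∧ ∃ v ∈ S.front, (edgeGraph x).Adj u v := by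
  simp only [step, next, Finset.mem_filter, Finset.mem_univ, true_and]
  refine and_congr_right fun hu => ?_
  simp only [blockOr, block, if_neg hu, decide_eq_true_eq, Finset.mem_image]
  constructor
  · rintro ⟨e, ⟨v, hv, rfl⟩, h⟩
    exact ⟨v, hv, fun h' => hu (h' ▸ Finset.mem_union_right _ hv), h⟩
  · rintro ⟨v, hv, h⟩
    exact ⟨_, ⟨v, hv, rfl⟩, h.2⟩

lemma ball_step (x : Sym2 V → Bool) (S : BfsState V) :
    (step x S).ball = S.ball ∪ (step x S).front := rfl

lemma ball_subset_iterate (x : Sym2 V → Bool) (S : BfsState V) {k t : ℕ} (h : k ≤ t) :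
    ((step x)^[k] S).ball ⊆ ((step x)^[t] S).ball := by
  induction t, h using Nat.le_induction with
  | base => exact subset_rfl
  | succ t _ ih =>
    rw [Function.iterate_succ_apply', ball_step]
    exact ih.trans Finset.subset_union_left

lemma ball_iterate (x : Sym2 V → Bool) (S : BfsState V) (t : ℕ) :
    (((step x)^[t] S).ball.card : ℝ)
      = S.removed.card + ∑ k ∈ Finset.range (t + 1), (((step x)^[k] S).front.card : ℝ) := by
  induction t with
  | zero =>
    simp [ball, Finset.card_union_of_disjoint S.disj]
  | succ t ih =>
    rw [Finset.sum_range_succ, ← add_assoc, ← ih, ← Nat.cast_add,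
      ← Finset.card_union_of_disjoint]
    · rw [Function.iterate_succ_apply', ball_step]
    · rw [Function.iterate_succ_apply']
      exact (step x ((step x)^[t] S)).disj

end BfsState

/-- Deleting the last edge of a geodesic leads to a neighbour at distance exactly `t`, since a
shorter distance would give a shortcut to `u`. This recursion for spheres is the one that
`BfsState.mem_front_step` gives for frontiers. -/
lemma SimpleGraph.edist_eq_succ_iff (H : SimpleGraph V) (i u : V) (t : ℕ) :
    H.edist i u = ((t + 1 : ℕ) : ℕ∞) ↔
      ¬ H.edist i u ≤ t ∧ ∃ v, H.edist i v = (t : ℕ∞) ∧ H.Adj u v := by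
  constructor
  · intro h
    refine ⟨by rw [h]; exact_mod_cast (by omega : ¬ (t + 1 ≤ t)), ?_⟩
    obtain ⟨w, hw⟩ := SimpleGraph.exists_walk_of_edist_eq_coe h
    have hne : ¬ w.reverse.Nil := by
      intro hn
      have := SimpleGraph.Walk.length_eq_zero_iff.mpr hn
      simp [hw] at this
    obtain ⟨v, hadj, q, hq⟩ := SimpleGraph.Walk.not_nil_iff.mp hne
    have hl : q.length = t := by
      have := congrArg SimpleGraph.Walk.length hq
      simp [hw] at this
      omega
    refine ⟨v, le_antisymm ?_ ?_, hadj⟩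
    · have := q.reverse.edist_le
      rwa [SimpleGraph.Walk.length_reverse, hl] at this
    · by_contra hlt
      push Not at hlt
      have h1 : H.edist i u ≤ H.edist i v + H.edist v u := SimpleGraph.edist_triangle
      have h2 : H.edist v u ≤ 1 := by
        have := (SimpleGraph.Walk.cons hadj.symm SimpleGraph.Walk.nil).edist_le
        simpa using this
      have h3 : H.edist i v + H.edist v u < ((t + 1 : ℕ) : ℕ∞) := by
        have hv : H.edist i v ≠ ⊤ := ne_top_of_lt hlt
        lift H.edist i v to ℕ using hv with d
        calc (d : ℕ∞) + H.edist v u ≤ d + 1 := by gcongr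
          _ < ((t + 1 : ℕ) : ℕ∞) := by
            have : d < t := by exact_mod_cast hlt
            exact_mod_cast (by omega : d + 1 < t + 1)
      rw [h] at h1
      exact absurd (h1.trans_lt h3) (lt_irrefl _)
  · rintro ⟨h1, v, hv, hadj⟩
    refine le_antisymm ?_ ?_
    · have h1 : H.edist i u ≤ H.edist i v + H.edist v u := SimpleGraph.edist_triangle
      have h2 : H.edist v u ≤ 1 := by
        have := (SimpleGraph.Walk.cons hadj.symm SimpleGraph.Walk.nil).edist_le
        simpa using this
      calc H.edist i u ≤ t + 1 := by rw [← hv]; exact h1.trans (by gcongr)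
        _ = ((t + 1 : ℕ) : ℕ∞) := by push_cast; rfl
    · push Not at h1
      exact_mod_cast Order.add_one_le_of_lt h1

namespace BfsState

/-- The exploration from `i` finds the spheres and balls of the graph distance. -/
lemma mem_iterate_root (x : Sym2 V → Bool) (i : V) (t : ℕ) :
    (∀ u, u ∈ ((step x)^[t] (root ∅ i (Finset.notMem_empty i))).front ↔
      (edgeGraph x).edist i u = (t : ℕ∞)) ∧
    ∀ u, u ∈ ((step x)^[t] (root ∅ i (Finset.notMem_empty i))).ball ↔
      (edgeGraph x).edist i u ≤ (t : ℕ∞) := by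
  induction t with
  | zero =>
    have h : ∀ u, u = i ↔ (edgeGraph x).edist i u = ((0 : ℕ) : ℕ∞) := fun u => by
      rw [Nat.cast_zero, SimpleGraph.edist_eq_zero_iff]; exact eq_comm
    refine ⟨fun u => ?_, fun u => ?_⟩
    · rw [← h]; simp [root]
    · have h' := h u
      rw [Nat.cast_zero] at h' ⊢
      rw [nonpos_iff_eq_zero, ← h']
      simp [root, ball]
  | succ t ih =>
    have hf : ∀ u, u ∈ ((step x)^[t + 1] (root ∅ i (Finset.notMem_empty i))).front ↔
        (edgeGraph x).edist i u = ((t + 1 : ℕ) : ℕ∞) := by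
      intro u
      rw [Function.iterate_succ_apply', mem_front_step, ih.2, SimpleGraph.edist_eq_succ_iff]
      simp only [ih.1]
    refine ⟨hf, fun u => ?_⟩
    rw [Function.iterate_succ_apply', ball_step, Finset.mem_union, ih.2,
      ← Function.iterate_succ_apply' (step x), hf]
    constructor
    · rintro (h | h)
      · exact h.trans (by exact_mod_cast Nat.le_succ t)
      · exact h.le
    · intro h
      rcases h.lt_or_eq with h | h
      · left
        push_cast at h
        exact ENat.lt_add_one_iff (ENat.natCast_ne_top t) |>.mp h
      · exact Or.inr h

/-- Removing a set which the exploration from `j` does not meet does not change the frontier. -/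
lemma front_iterate_root_eq (x : Sym2 V → Bool) (R : Finset V) (j : V) (hj : j ∉ R) (t : ℕ)
    (h : Disjoint R ((step x)^[t] (root ∅ j (Finset.notMem_empty j))).ball) :
    ((step x)^[t] (root R j hj)).front
      = ((step x)^[t] (root ∅ j (Finset.notMem_empty j))).front ∧
    ((step x)^[t] (root R j hj)).ball
      = R ∪ ((step x)^[t] (root ∅ j (Finset.notMem_empty j))).ball := by
  induction t with
  | zero => simp [root, ball]
  | succ t ih =>
    obtain ⟨h1, h2⟩ := ih (h.mono_right (ball_subset_iterate x _ (Nat.le_succ t)))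
    have hf : ((step x)^[t + 1] (root R j hj)).front
        = ((step x)^[t + 1] (root ∅ j (Finset.notMem_empty j))).front := by
      ext u
      rw [Function.iterate_succ_apply', Function.iterate_succ_apply', mem_front_step,
        mem_front_step, h1, h2, Finset.mem_union, not_or]
      constructor
      · rintro ⟨⟨_, hu⟩, hv⟩; exact ⟨hu, hv⟩
      · rintro ⟨hu, hv⟩
        refine ⟨⟨fun hR => ?_, hu⟩, hv⟩
        refine Finset.disjoint_left.mp h hR ?_
        rw [Function.iterate_succ_apply', ball_step, Finset.mem_union, mem_front_step]
        exact Or.inr ⟨hu, hv⟩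
    refine ⟨hf, ?_⟩
    rw [Function.iterate_succ_apply', Function.iterate_succ_apply', ball_step, ball_step, h2,
      ← Function.iterate_succ_apply' (step x), ← Function.iterate_succ_apply' (step x), hf,
      Finset.union_assoc]

end BfsState

end Bfs

/-! ### Moments of sums of independent Bernoulli variables -/

/-- The indicator of `b`. -/
def ind (b : Bool) : ℝ := if b then 1 else 0

lemma ind_mul_self (b : Bool) : ind b * ind b = ind b := by cases b <;> simp [ind]

section Moments

variable {ι : Type*} [Fintype ι] [DecidableEq ι] {p : ι → ℝ}

lemma bernEx_prod_ind (A : Finset ι) :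
    bernEx p (fun x => ∏ i ∈ A, ind (x i)) = ∏ i ∈ A, p i := by
  rw [bernEx_prod_finset A (fun _ b => ind b)]
  simp [ind]

lemma bernEx_ind (i : ι) : bernEx p (fun x => ind (x i)) = p i := by
  simpa using bernEx_prod_ind (p := p) {i}

lemma bernEx_ind_mul_ind (i j : ι) :
    bernEx p (fun x => ind (x i) * ind (x j))
      = p i * p j + if i = j then p i * (1 - p i) else 0 := by
  by_cases h : i = j
  · subst h
    simp only [ind_mul_self, bernEx_ind, if_true]; ring
  · have := bernEx_prod_ind (p := p) {i, j}
    simp only [Finset.prod_pair h] at this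
    rw [this, if_neg h, add_zero]

/-- Indicators are idempotent, so each coincidence among the indices lowers the degree. There is one
term per coincidence pattern, so that the triple sum in `bernEx_card_cube_le` collapses term by
term. -/
lemma bernEx_ind_mul_ind_mul_ind_le (hp : ∀ i, p i ∈ Set.Icc (0 : ℝ) 1) (i j k : ι) :
    bernEx p (fun x => ind (x i) * ind (x j) * ind (x k))
      ≤ p i * p j * p k + (if i = j then p i * p k else 0) + (if i = k then p i * p j else 0)
        + (if j = k then p i * p j else 0) + if i = j then (if j = k then p i else 0) else 0 := by
  have h0 := fun i => (hp i).1
  have h1 := fun i => (hp i).2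
  have hm : ∀ i j, 0 ≤ p i * p j := fun i j => mul_nonneg (h0 i) (h0 j)
  by_cases hij : i = j
  · subst hij
    simp only [ind_mul_self, if_true]
    rw [bernEx_ind_mul_ind]
    by_cases hik : i = k
    · subst hik
      simp only [if_true]
      nlinarith [hm i i, mul_nonneg (hm i i) (h0 i)]
    · simp only [if_neg hik]
      nlinarith [mul_nonneg (hm i i) (h0 k)]
  · by_cases hik : i = k
    · subst hik
      have : ∀ x : ι → Bool, ind (x i) * ind (x j) * ind (x i) = ind (x i) * ind (x j) :=
        fun x => by rw [mul_right_comm, ind_mul_self]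
      simp only [this]
      rw [bernEx_ind_mul_ind]
      simp only [if_neg hij, if_neg (Ne.symm hij), if_true]
      nlinarith [mul_nonneg (hm i j) (h0 i)]
    · by_cases hjk : j = k
      · subst hjk
        simp only [mul_assoc, ind_mul_self]
        rw [bernEx_ind_mul_ind]
        simp only [if_neg hij, if_true]
        nlinarith [mul_nonneg (h0 i) (hm j j)]
      · have := bernEx_prod_ind (p := p) {i, j, k}
        rw [Finset.prod_insert (by simp [hij, hik]), Finset.prod_pair hjk] at this
        have e : ∀ x : ι → Bool, ∏ l ∈ ({i, j, k} : Finset ι), ind (x l)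
            = ind (x i) * ind (x j) * ind (x k) := fun x => by
          rw [Finset.prod_insert (by simp [hij, hik]), Finset.prod_pair hjk, mul_assoc]
        simp only [e] at this
        rw [this]
        simp only [if_neg hij, if_neg hik, if_neg hjk]
        linarith

lemma bernEx_sum_ind (c : ι → ℝ) :
    bernEx p (fun x => ∑ i, c i * ind (x i)) = ∑ i, c i * p i := by
  rw [bernEx_sum]
  exact Finset.sum_congr rfl fun i _ => by rw [bernEx_const_mul, bernEx_ind]

lemma bernEx_sum_ind_sq (c : ι → ℝ) :
    bernEx p (fun x => (∑ i, c i * ind (x i)) ^ 2)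
      = (∑ i, c i * p i) ^ 2 + ∑ i, c i ^ 2 * (p i * (1 - p i)) := by
  have : ∀ x : ι → Bool, (∑ i, c i * ind (x i)) ^ 2
      = ∑ i, ∑ j, c i * c j * (ind (x i) * ind (x j)) := fun x => by
    rw [sq, Finset.sum_mul_sum]
    exact Finset.sum_congr rfl fun i _ => Finset.sum_congr rfl fun j _ => by ring
  simp only [this, bernEx_sum, bernEx_const_mul, bernEx_ind_mul_ind]
  simp only [mul_add, Finset.sum_add_distrib, mul_ite, mul_zero, Finset.sum_ite_eq,
    Finset.mem_univ, if_true]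
  congr 1
  · rw [sq, Finset.sum_mul_sum]
    exact Finset.sum_congr rfl fun i _ => Finset.sum_congr rfl fun j _ => by ring
  · exact Finset.sum_congr rfl fun i _ => by ring

/-- Squared bias plus variance; each coordinate contributes at most `p i` to the variance. -/
lemma bernEx_sum_ind_sub_sq_le (hp : ∀ i, p i ∈ Set.Icc (0 : ℝ) 1) (c : ι → ℝ)
    (hc : ∀ i, c i ^ 2 ≤ 1) (m : ℝ) :
    bernEx p (fun x => ((∑ i, c i * ind (x i)) - m) ^ 2)
      ≤ ((∑ i, c i * p i) - m) ^ 2 + ∑ i, p i := by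
  have : ∀ x : ι → Bool, ((∑ i, c i * ind (x i)) - m) ^ 2
      = (∑ i, c i * ind (x i)) ^ 2 - 2 * m * (∑ i, c i * ind (x i)) + m ^ 2 := fun x => by ring
  simp only [this]
  rw [bernEx_add, bernEx_sub, bernEx_const_mul, bernEx_const, bernEx_sum_ind, bernEx_sum_ind_sq]
  have : ∑ i, c i ^ 2 * (p i * (1 - p i)) ≤ ∑ i, p i := by
    refine Finset.sum_le_sum fun i _ => ?_
    have h0 := (hp i).1
    have h1 := (hp i).2
    have h2 : 0 ≤ p i * (1 - p i) := mul_nonneg h0 (by linarith)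
    nlinarith [mul_le_mul_of_nonneg_right (hc i) h2, mul_nonneg h0 h0]
  linarith

lemma bernEx_card_sq_le (hp : ∀ i, p i ∈ Set.Icc (0 : ℝ) 1) :
    bernEx p (fun x => (∑ i, ind (x i)) ^ 2) ≤ (∑ i, p i) ^ 2 + ∑ i, p i := by
  have := bernEx_sum_ind_sub_sq_le hp (fun _ => 1) (by simp) 0
  simpa using this

/-- The bound is the third moment of a Poisson variable with the same mean. -/
lemma bernEx_card_cube_le (hp : ∀ i, p i ∈ Set.Icc (0 : ℝ) 1) :
    bernEx p (fun x => (∑ i, ind (x i)) ^ 3)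
      ≤ (∑ i, p i) ^ 3 + 3 * (∑ i, p i) ^ 2 + ∑ i, p i := by
  have : ∀ x : ι → Bool, (∑ i, ind (x i)) ^ 3
      = ∑ i, ∑ j, ∑ k, ind (x i) * ind (x j) * ind (x k) := fun x => by
    simp only [← Finset.mul_sum, ← Finset.sum_mul]
    ring
  simp only [this, bernEx_sum]
  refine (Finset.sum_le_sum fun i _ => Finset.sum_le_sum fun j _ => Finset.sum_le_sum fun k _ =>
    bernEx_ind_mul_ind_mul_ind_le hp i j k).trans (le_of_eq ?_)
  simp only [Finset.sum_add_distrib, Finset.sum_ite_eq, Finset.mem_univ, if_true,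
    ← Finset.mul_sum, ← Finset.sum_mul]
  have e1 : ∑ i, ∑ j, (if i = j then p i * ∑ k, p k else 0) = (∑ i, p i) ^ 2 := by
    simp only [Finset.sum_ite_eq, Finset.mem_univ, if_true, ← Finset.sum_mul]; ring
  have e2 : ∑ i, ∑ j, ∑ k, (if i = j then p i * p k else 0) = (∑ i, p i) ^ 2 := by
    rw [← e1]
    refine Finset.sum_congr rfl fun i _ => Finset.sum_congr rfl fun j _ => ?_
    split_ifs <;> simp [Finset.mul_sum]
  have e3 : ∑ i, ∑ j, ∑ k, (if i = j then (if j = k then p i else 0) else 0) = ∑ i, p i := by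
    refine Finset.sum_congr rfl fun i _ => ?_
    rw [Finset.sum_eq_single i]
    · simp
    · intro j _ hj; simp [Ne.symm hj]
    · simp
  rw [e2, e3]
  ring

end Moments

/-- Bonferroni bounds for the probability of a union of independent events. -/
lemma one_sub_prod_one_sub_le {κ : Type*} (s : Finset κ) (p : κ → ℝ)
    (hp : ∀ i ∈ s, p i ∈ Set.Icc (0 : ℝ) 1) :
    1 - ∏ i ∈ s, (1 - p i) ≤ ∑ i ∈ s, p i ∧
      (∑ i ∈ s, p i) - (∑ i ∈ s, p i) ^ 2 ≤ 1 - ∏ i ∈ s, (1 - p i) := by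
  classical
  induction s using Finset.induction_on with
  | empty => simp
  | insert i s hi ih =>
    obtain ⟨h1, h2⟩ := ih fun j hj => hp j (Finset.mem_insert_of_mem hj)
    have hi1 := hp i (Finset.mem_insert_self _ _)
    have hq : 0 ≤ ∑ j ∈ s, p j :=
      Finset.sum_nonneg fun j hj => (hp j (Finset.mem_insert_of_mem hj)).1
    have hP1 : ∏ j ∈ s, (1 - p j) ≤ 1 := Finset.prod_le_one
      (fun j hj => by linarith [(hp j (Finset.mem_insert_of_mem hj)).2])
      fun j hj => by linarith [(hp j (Finset.mem_insert_of_mem hj)).1]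
    rw [Finset.prod_insert hi, Finset.sum_insert hi]
    set P := ∏ j ∈ s, (1 - p j)
    set q := ∑ j ∈ s, p j
    have a0 := hi1.1
    constructor
    · nlinarith
    · nlinarith [mul_le_mul_of_nonneg_left h1 a0, mul_nonneg a0 hq, mul_nonneg a0 a0]

/-! ### One step of the exploration of the block model with given spins -/

section Sbm

variable {n : ℕ}

/-- The spin of `u` as a real number. -/
def spin (s : Fin n → ℤˣ) (u : Fin n) : ℝ := ((s u : ℤ) : ℝ)

lemma spin_mul_self (s : Fin n → ℤˣ) (u : Fin n) : spin s u * spin s u = 1 := by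
  rcases Int.units_eq_one_or (s u) with h | h <;> simp [spin, h]

lemma abs_spin (s : Fin n → ℤˣ) (u : Fin n) : |spin s u| = 1 := by
  rcases Int.units_eq_one_or (s u) with h | h <;> simp [spin, h]

/-- The sum of all spins. -/
def magnetization (s : Fin n → ℤˣ) : ℝ := ∑ u, spin s u

/-- Edge probabilities of the block model with spins `s`, as a function on unordered pairs. -/
def sbmProb (a b : ℝ) (s : Fin n → ℤˣ) : Sym2 (Fin n) → ℝ :=
  Sym2.lift ⟨sbmEdgeProb a b s, fun i j => by simp only [sbmEdgeProb, eq_comm]⟩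

lemma sbmProb_mk (a b : ℝ) (s : Fin n → ℤˣ) (i j : Fin n) :
    sbmProb a b s s(i, j) = sbmEdgeProb a b s i j := rfl

/-- Being affine in the product of the two spins, edge probabilities summed over a frontier involve
only its size and its spin sum, with coefficients `α` and `β`. -/
lemma sbmEdgeProb_eq (a b : ℝ) (s : Fin n → ℤˣ) (i j : Fin n) :
    sbmEdgeProb a b s i j = ((a + b) / 2 + (a - b) / 2 * (spin s i * spin s j)) / n := by
  unfold sbmEdgeProb spin
  rcases Int.units_eq_one_or (s i) with h | h <;> rcases Int.units_eq_one_or (s j) with h' | h' <;>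
    simp [h, h'] <;> ring

lemma sbmProb_mem {a b : ℝ} (ha : 0 ≤ a) (hb : 0 ≤ b) (han : a ≤ n) (hbn : b ≤ n)
    (s : Fin n → ℤˣ) (e : Sym2 (Fin n)) : sbmProb a b s e ∈ Set.Icc (0 : ℝ) 1 := by
  induction e using Sym2.ind with
  | _ i j =>
    rw [sbmProb_mk, sbmEdgeProb]
    split_ifs
    · exact ⟨by positivity, div_le_one_of_le₀ han (Nat.cast_nonneg n)⟩
    · exact ⟨by positivity, div_le_one_of_le₀ hbn (Nat.cast_nonneg n)⟩

namespace BfsState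

/-- The sum of the spins of the frontier. -/
def frontSpin (s : Fin n → ℤˣ) (S : BfsState (Fin n)) : ℝ := ∑ u ∈ S.front, spin s u

lemma abs_frontSpin_le (s : Fin n → ℤˣ) (S : BfsState (Fin n)) :
    |S.frontSpin s| ≤ S.front.card := by
  refine (Finset.abs_sum_le_sum_abs _ _).trans ?_
  simp [abs_spin]

/-- The mean number of edges between `u` and the frontier. -/
def meanDeg (a b : ℝ) (s : Fin n → ℤˣ) (S : BfsState (Fin n)) (u : Fin n) : ℝ :=
  ((a + b) / 2 * S.front.card + (a - b) / 2 * (spin s u * S.frontSpin s)) / n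

lemma sum_sbmProb (a b : ℝ) (s : Fin n → ℤˣ) (S : BfsState (Fin n)) (u : Fin n) :
    ∑ v ∈ S.front, sbmProb a b s s(u, v) = S.meanDeg a b s u := by
  simp only [sbmProb_mk, sbmEdgeProb_eq, meanDeg, frontSpin]
  rw [← Finset.sum_div, Finset.sum_add_distrib, Finset.sum_const, nsmul_eq_mul, ← Finset.mul_sum,
    ← Finset.mul_sum]
  ring

lemma hitProb_of_mem (p : Sym2 (Fin n) → ℝ) (S : BfsState (Fin n)) {u : Fin n} (h : u ∈ S.ball) :
    S.hitProb p u = 0 := by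
  simp [hitProb, block, h]

lemma hitProb_of_notMem (p : Sym2 (Fin n) → ℝ) (S : BfsState (Fin n)) {u : Fin n}
    (h : u ∉ S.ball) : S.hitProb p u = 1 - ∏ v ∈ S.front, (1 - p s(u, v)) := by
  rw [hitProb, block, if_neg h, Finset.prod_image]
  intro v _ w _ hvw
  rcases Sym2.eq_iff.mp hvw with ⟨_, h⟩ | ⟨h, h'⟩
  · exact h
  · exact h'.trans h

variable {a b : ℝ} {s : Fin n → ℤˣ}

lemma meanDeg_nonneg (ha : 0 ≤ a) (hb : 0 ≤ b) (s : Fin n → ℤˣ) (S : BfsState (Fin n))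
    (u : Fin n) : 0 ≤ S.meanDeg a b s u := by
  rw [← sum_sbmProb]
  refine Finset.sum_nonneg fun v _ => ?_
  rw [sbmProb_mk, sbmEdgeProb]
  split_ifs <;> positivity

lemma meanDeg_le (ha : 0 ≤ a) (hb : 0 ≤ b) (s : Fin n → ℤˣ) (S : BfsState (Fin n))
    (u : Fin n) : S.meanDeg a b s u ≤ (a + b) * S.front.card / n := by
  rw [← sum_sbmProb]
  have : ∀ v ∈ S.front, sbmProb a b s s(u, v) ≤ (a + b) / n := fun v _ => by
    rw [sbmProb_mk, sbmEdgeProb]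
    split_ifs <;> gcongr <;> linarith
  refine (Finset.sum_le_sum this).trans (le_of_eq ?_)
  rw [Finset.sum_const, nsmul_eq_mul]; ring

lemma hitProb_le_meanDeg (ha : 0 ≤ a) (hb : 0 ≤ b) (han : a ≤ n) (hbn : b ≤ n)
    (s : Fin n → ℤˣ) (S : BfsState (Fin n)) (u : Fin n) :
    S.hitProb (sbmProb a b s) u ≤ S.meanDeg a b s u := by
  by_cases h : u ∈ S.ball
  · rw [hitProb_of_mem _ _ h]; exact meanDeg_nonneg ha hb s S u
  · rw [hitProb_of_notMem _ _ h, ← sum_sbmProb]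
    exact (one_sub_prod_one_sub_le _ _ fun v _ => sbmProb_mem ha hb han hbn s _).1

/-- An explored vertex is never hit again and loses its whole mean; for an unexplored one the loss
is the second-order term in Bonferroni's inequality. -/
lemma meanDeg_sub_hitProb_le (ha : 0 ≤ a) (hb : 0 ≤ b) (han : a ≤ n) (hbn : b ≤ n)
    (s : Fin n → ℤˣ) (S : BfsState (Fin n)) (u : Fin n) :
    S.meanDeg a b s u - S.hitProb (sbmProb a b s) u
      ≤ (if u ∈ S.ball then (a + b) * S.front.card / n else 0)
        + ((a + b) * S.front.card / n) ^ 2 := by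
  have h1 := meanDeg_le ha hb s S u
  have h0 := meanDeg_nonneg ha hb s S u
  by_cases h : u ∈ S.ball
  · rw [hitProb_of_mem _ _ h, if_pos h]
    nlinarith [sq_nonneg ((a + b) * S.front.card / n)]
  · rw [hitProb_of_notMem _ _ h, if_neg h]
    have := (one_sub_prod_one_sub_le S.front (fun v => sbmProb a b s s(u, v))
      fun v _ => sbmProb_mem ha hb han hbn s _).2
    rw [sum_sbmProb] at this
    have h2 : (S.meanDeg a b s u) ^ 2 ≤ ((a + b) * S.front.card / n) ^ 2 := by gcongr
    linarith

/-- Sum over the vertices of the error made when replacing hitting probabilities by means. -/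
lemma sum_meanDeg_sub_hitProb_le (ha : 0 ≤ a) (hb : 0 ≤ b) (han : a ≤ n) (hbn : b ≤ n)
    (hn : 0 < n) (s : Fin n → ℤˣ) (S : BfsState (Fin n)) :
    ∑ u, (S.meanDeg a b s u - S.hitProb (sbmProb a b s) u)
      ≤ ((a + b) + (a + b) ^ 2) * S.front.card * S.ball.card / n := by
  refine (Finset.sum_le_sum fun u _ => meanDeg_sub_hitProb_le ha hb han hbn s S u).trans ?_
  rw [Finset.sum_add_distrib, ← Finset.sum_filter, Finset.sum_const, Finset.sum_const,
    nsmul_eq_mul, nsmul_eq_mul, Finset.card_univ, Fintype.card_fin,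
    Finset.filter_mem_eq_inter, Finset.univ_inter]
  have hfb : (S.front.card : ℝ) ≤ S.ball.card := by
    exact_mod_cast Finset.card_le_card Finset.subset_union_right
  have hn' : (0 : ℝ) < n := by exact_mod_cast hn
  have e : (n : ℝ) * ((a + b) * S.front.card / n) ^ 2
      = (a + b) ^ 2 * S.front.card * S.front.card / n := by field_simp
  rw [e]
  have : (a + b) ^ 2 * S.front.card * S.front.card / n
      ≤ (a + b) ^ 2 * S.front.card * S.ball.card / n := by gcongr
  calc _ ≤ (S.ball.card : ℝ) * ((a + b) * S.front.card / n)
        + (a + b) ^ 2 * S.front.card * S.ball.card / n := by linarith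
    _ = _ := by ring

lemma sum_meanDeg (a b : ℝ) (hn : 0 < n) (s : Fin n → ℤˣ) (S : BfsState (Fin n)) :
    ∑ u, S.meanDeg a b s u
      = (a + b) / 2 * S.front.card + (a - b) / 2 * (magnetization s * S.frontSpin s) / n := by
  have hn' : (n : ℝ) ≠ 0 := by exact_mod_cast hn.ne'
  simp only [meanDeg]
  rw [← Finset.sum_div, Finset.sum_add_distrib, Finset.sum_const, nsmul_eq_mul, ← Finset.mul_sum,
    ← Finset.sum_mul, Finset.card_univ, Fintype.card_fin]
  change (_ + (a - b) / 2 * (magnetization s * _)) / _ = _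
  field_simp

/-- Weighting by spins exchanges the roles of size and spin sum, because spins square to one: `β`
becomes the leading factor and the `α` term survives only through the imbalance. -/
lemma sum_spin_mul_meanDeg (a b : ℝ) (hn : 0 < n) (s : Fin n → ℤˣ) (S : BfsState (Fin n)) :
    ∑ u, spin s u * S.meanDeg a b s u
      = (a - b) / 2 * S.frontSpin s + (a + b) / 2 * S.front.card * magnetization s / n := by
  have hn' : (n : ℝ) ≠ 0 := by exact_mod_cast hn.ne'
  have : ∀ u, spin s u * S.meanDeg a b s u
      = (a - b) / 2 * S.frontSpin s / n + spin s u * ((a + b) / 2 * S.front.card / n) := fun u => by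
    rw [meanDeg]
    linear_combination ((a - b) / 2 * S.frontSpin s / n) * spin_mul_self s u
  simp only [this]
  rw [Finset.sum_add_distrib, Finset.sum_const, nsmul_eq_mul, ← Finset.sum_mul, Finset.card_univ,
    Fintype.card_fin]
  change _ + magnetization s * _ = _
  field_simp

/-- The growth rate of the exploration when the spins are not balanced. -/
def growth (a b : ℝ) (s : Fin n → ℤˣ) : ℝ := (a + b) / 2 * (1 + |magnetization s| / n)

lemma abs_half_sub_le (ha : 0 ≤ a) (hb : 0 ≤ b) : |(a - b) / 2| ≤ (a + b) / 2 :=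
  abs_le.mpr ⟨by linarith, by linarith⟩

lemma sum_hitProb_le (ha : 0 ≤ a) (hb : 0 ≤ b) (han : a ≤ n) (hbn : b ≤ n) (hn : 0 < n)
    (s : Fin n → ℤˣ) (S : BfsState (Fin n)) :
    ∑ u, S.hitProb (sbmProb a b s) u ≤ growth a b s * S.front.card := by
  refine (Finset.sum_le_sum fun u _ => hitProb_le_meanDeg ha hb han hbn s S u).trans ?_
  rw [sum_meanDeg a b hn]
  have h : (a - b) / 2 * (magnetization s * S.frontSpin s)
      ≤ (a + b) / 2 * (|magnetization s| * S.front.card) := by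
    refine (le_abs_self _).trans ?_
    rw [abs_mul, abs_mul]
    gcongr
    · exact abs_half_sub_le ha hb
    · exact S.abs_frontSpin_le s
  calc _ ≤ (a + b) / 2 * S.front.card + (a + b) / 2 * (|magnetization s| * S.front.card) / n := by
        gcongr
    _ = _ := by rw [growth]; ring

lemma card_front_next_le (S : BfsState (Fin n)) (y : Fin n → Bool) :
    ((S.next y).front.card : ℝ) ≤ ∑ u, ind (y u) := by
  rw [next, Finset.card_filter]
  push_cast
  refine Finset.sum_le_sum fun u _ => ?_
  by_cases h : y u = true <;> by_cases h' : u ∈ S.ball <;> simp [ind, h, h']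

lemma frontSpin_next (s : Fin n → ℤˣ) (S : BfsState (Fin n)) (y : Fin n → Bool) :
    (S.next y).frontSpin s = ∑ u, (if u ∈ S.ball then 0 else spin s u) * ind (y u) := by
  rw [frontSpin, next, Finset.sum_filter]
  refine Finset.sum_congr rfl fun u _ => ?_
  by_cases h : y u = true <;> by_cases h' : u ∈ S.ball <;> simp [ind, h, h']

lemma kernel_card_le (ha : 0 ≤ a) (hb : 0 ≤ b) (han : a ≤ n) (hbn : b ≤ n) (hn : 0 < n)
    (s : Fin n → ℤˣ) (S : BfsState (Fin n)) :
    kernel (sbmProb a b s) (fun S => (S.front.card : ℝ)) S ≤ growth a b s * S.front.card := by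
  refine le_trans ?_ (sum_hitProb_le ha hb han hbn hn s S)
  have hp := S.hitProb_mem _ (sbmProb_mem ha hb han hbn s)
  refine (bernEx_mono hp fun y => card_front_next_le S y).trans (le_of_eq ?_)
  simpa using bernEx_sum_ind (p := S.hitProb (sbmProb a b s)) fun _ => 1

lemma kernel_card_sq_le (ha : 0 ≤ a) (hb : 0 ≤ b) (han : a ≤ n) (hbn : b ≤ n) (hn : 0 < n)
    (s : Fin n → ℤˣ) (S : BfsState (Fin n)) :
    kernel (sbmProb a b s) (fun S => (S.front.card : ℝ) ^ 2) S
      ≤ (growth a b s * S.front.card) ^ 2 + growth a b s * S.front.card := by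
  have h := sum_hitProb_le ha hb han hbn hn s S
  have hp := S.hitProb_mem _ (sbmProb_mem ha hb han hbn s)
  have h0 : 0 ≤ ∑ u, S.hitProb (sbmProb a b s) u := Finset.sum_nonneg fun u _ => (hp u).1
  refine (bernEx_mono hp fun y => pow_le_pow_left₀ (Nat.cast_nonneg _)
    (card_front_next_le S y) 2).trans ?_
  refine (bernEx_card_sq_le hp).trans ?_
  gcongr

lemma kernel_card_cube_le (ha : 0 ≤ a) (hb : 0 ≤ b) (han : a ≤ n) (hbn : b ≤ n) (hn : 0 < n)
    (s : Fin n → ℤˣ) (S : BfsState (Fin n)) :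
    kernel (sbmProb a b s) (fun S => (S.front.card : ℝ) ^ 3) S
      ≤ (growth a b s * S.front.card) ^ 3 + 3 * (growth a b s * S.front.card) ^ 2
        + growth a b s * S.front.card := by
  have h := sum_hitProb_le ha hb han hbn hn s S
  have hp := S.hitProb_mem _ (sbmProb_mem ha hb han hbn s)
  have h0 : 0 ≤ ∑ u, S.hitProb (sbmProb a b s) u := Finset.sum_nonneg fun u _ => (hp u).1
  refine (bernEx_mono hp fun y => pow_le_pow_left₀ (Nat.cast_nonneg _)
    (card_front_next_le S y) 3).trans ?_
  refine (bernEx_card_cube_le hp).trans ?_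
  gcongr

/-- The error in the drift of the sum of spins. -/
lemma abs_drift_le (ha : 0 ≤ a) (hb : 0 ≤ b) (han : a ≤ n) (hbn : b ≤ n) (hn : 0 < n)
    (s : Fin n → ℤˣ) (S : BfsState (Fin n)) :
    |(∑ u, (if u ∈ S.ball then 0 else spin s u) * S.hitProb (sbmProb a b s) u)
        - (a - b) / 2 * S.frontSpin s|
      ≤ ((a + b) + (a + b) ^ 2) * S.front.card * (S.ball.card + |magnetization s|) / n := by
  have hn' : (0 : ℝ) < n := by exact_mod_cast hn
  have e1 : ∀ u, (if u ∈ S.ball then 0 else spin s u) * S.hitProb (sbmProb a b s) u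
      = spin s u * S.meanDeg a b s u
        - spin s u * (S.meanDeg a b s u - S.hitProb (sbmProb a b s) u) := fun u => by
    by_cases h : u ∈ S.ball
    · rw [hitProb_of_mem _ _ h]; ring
    · rw [if_neg h]; ring
  simp only [e1]
  rw [Finset.sum_sub_distrib, sum_spin_mul_meanDeg a b hn]
  have h1 : |∑ u, spin s u * (S.meanDeg a b s u - S.hitProb (sbmProb a b s) u)|
      ≤ ((a + b) + (a + b) ^ 2) * S.front.card * S.ball.card / n := by
    refine (Finset.abs_sum_le_sum_abs _ _).trans
      (le_trans (le_of_eq ?_) (sum_meanDeg_sub_hitProb_le ha hb han hbn hn s S))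
    refine Finset.sum_congr rfl fun u _ => ?_
    rw [abs_mul, abs_spin, one_mul, abs_of_nonneg]
    linarith [hitProb_le_meanDeg ha hb han hbn s S u]
  have h2 : |(a + b) / 2 * S.front.card * magnetization s / n|
      ≤ ((a + b) + (a + b) ^ 2) * S.front.card * |magnetization s| / n := by
    rw [abs_div, abs_mul, abs_of_nonneg (by positivity : 0 ≤ (a + b) / 2 * (S.front.card : ℝ)),
      abs_of_pos hn']
    gcongr
    nlinarith [sq_nonneg (a + b)]
  have e2 : ∀ x y z : ℝ, |x + y - z - x| ≤ |y| + |z| := fun x y z => by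
    rw [show x + y - z - x = y - z by ring]; exact abs_sub y z
  refine (e2 _ _ _).trans ((add_le_add h2 h1).trans (le_of_eq ?_))
  ring

/-- The conditional second moment of the martingale increments of the sum of spins. -/
lemma kernel_frontSpin_sub_sq_le (ha : 0 ≤ a) (hb : 0 ≤ b) (han : a ≤ n) (hbn : b ≤ n) (hn : 0 < n)
    (s : Fin n → ℤˣ) (S : BfsState (Fin n)) :
    kernel (sbmProb a b s)
        (fun S' => (S'.frontSpin s - (a - b) / 2 * S.frontSpin s) ^ 2) S
      ≤ (((a + b) + (a + b) ^ 2) * S.front.card * (S.ball.card + |magnetization s|) / n) ^ 2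
        + growth a b s * S.front.card := by
  have hp := S.hitProb_mem _ (sbmProb_mem ha hb han hbn s)
  simp only [kernel, frontSpin_next]
  refine (bernEx_sum_ind_sub_sq_le hp _ (fun u => ?_) _).trans ?_
  · split_ifs
    · simp
    · rw [sq, spin_mul_self]
  · refine add_le_add ?_ (sum_hitProb_le ha hb han hbn hn s S)
    exact sq_le_sq' (by linarith [(abs_le.mp (abs_drift_le ha hb han hbn hn s S)).1])
      (abs_le.mp (abs_drift_le ha hb han hbn hn s S)).2

end BfsState

end Sbm

/-! ### Moments along the exploration -/

section SbmMoments

variable {n : ℕ} {a b : ℝ}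

/-- Constant in the bound for third moments of generation sizes at growth rate `α`. -/
def cubeConst (α : ℝ) : ℝ := 1 + 3 / (α - 1) + (1 + 3 / (α - 1)) / (α - 1)

namespace BfsState

lemma one_le_growth_div (ha : 0 ≤ a) (hb : 0 ≤ b) (s : Fin n → ℤˣ) :
    (a + b) / 2 ≤ growth a b s := by
  have : 0 ≤ |magnetization s| / n := by positivity
  rw [growth]
  nlinarith

lemma growth_nonneg (ha : 0 ≤ a) (hb : 0 ≤ b) (s : Fin n → ℤˣ) : 0 ≤ growth a b s :=
  le_trans (by positivity) (one_le_growth_div ha hb s)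

lemma kernel_add (p : Sym2 (Fin n) → ℝ) (f g : BfsState (Fin n) → ℝ) (S : BfsState (Fin n)) :
    kernel p (fun S => f S + g S) S = kernel p f S + kernel p g S := bernEx_add _ _

/-- Moment bounds for the size of the frontier after `t` steps from a single vertex. -/
lemma bernEx_card_pow_le (ha : 0 ≤ a) (hb : 0 ≤ b) (hα : 1 < (a + b) / 2) (han : a ≤ n)
    (hbn : b ≤ n) (hn : 0 < n) (s : Fin n → ℤˣ) (S : BfsState (Fin n)) (hS : S.front.card = 1)
    (t : ℕ) :
    bernEx (sbmProb a b s) (fun x => (((step x)^[t] S).front.card : ℝ)) ≤ growth a b s ^ t ∧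
    bernEx (sbmProb a b s) (fun x => (((step x)^[t] S).front.card : ℝ) ^ 2)
      ≤ cubeConst ((a + b) / 2) * growth a b s ^ (2 * t) ∧
    bernEx (sbmProb a b s) (fun x => (((step x)^[t] S).front.card : ℝ) ^ 3)
      ≤ cubeConst ((a + b) / 2) * growth a b s ^ (3 * t) := by
  set α := (a + b) / 2 with hαdef
  have hP := sbmProb_mem ha hb han hbn s
  have hγα := one_le_growth_div ha hb s
  set γ := growth a b s with hγ
  rw [← hαdef] at hγα
  have hα1 : 0 < α - 1 := by linarith
  have hγ0 : 0 ≤ γ := by linarith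
  -- With these constants `f ^ 2 + c1 f` and `f ^ 3 + c1 f ^ 2 + c2 f`, where `f` is the frontier
  -- size, are multiplied by at most `γ ^ 2` and `γ ^ 3` per step: the lower-order terms created by
  -- a step are absorbed because `γ ≥ α > 1`.
  set c1 := 3 / (α - 1) with hc1
  have hc1' : c1 * (α - 1) = 3 := by rw [hc1]; field_simp
  have hc1p : 0 ≤ c1 := by positivity
  set c2 := (1 + c1) / (α - 1) with hc2
  have hc2' : c2 * (α - 1) = 1 + c1 := by rw [hc2]; field_simp
  have hc2p : 0 ≤ c2 := by positivity
  have hK : cubeConst α = 1 + c1 + c2 := by rw [cubeConst]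
  refine ⟨?_, ?_, ?_⟩
  · have := bernEx_iterate_le hP hγ0 (Φ := fun S => (S.front.card : ℝ))
      (kernel_card_le ha hb han hbn hn s) t S
    simpa [hS] using this
  · have h : ∀ S, kernel (sbmProb a b s)
        (fun S => (S.front.card : ℝ) ^ 2 + c1 * S.front.card) S
        ≤ γ ^ 2 * ((S.front.card : ℝ) ^ 2 + c1 * S.front.card) := by
      intro S
      rw [kernel_add, kernel_const_mul]
      have h1 := kernel_card_le ha hb han hbn hn s S
      have h2 := kernel_card_sq_le ha hb han hbn hn s S
      have hf : (0 : ℝ) ≤ S.front.card := Nat.cast_nonneg _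
      have h3 : c1 * (γ - 1) ≥ 1 := by nlinarith
      have h4 : 0 ≤ γ * S.front.card := mul_nonneg hγ0 hf
      nlinarith [mul_le_mul_of_nonneg_left h1 hc1p, mul_le_mul_of_nonneg_right h3 h4]
    have := bernEx_iterate_le hP (by positivity : 0 ≤ γ ^ 2) h t S
    have h5 : bernEx (sbmProb a b s) (fun x => (((step x)^[t] S).front.card : ℝ) ^ 2)
        ≤ bernEx (sbmProb a b s) (fun x => (((step x)^[t] S).front.card : ℝ) ^ 2
          + c1 * ((step x)^[t] S).front.card) := bernEx_mono hP fun x => by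
      have : 0 ≤ c1 * (((step x)^[t] S).front.card : ℝ) := by positivity
      linarith
    refine h5.trans (this.trans ?_)
    rw [hS, hK, ← pow_mul, mul_comm]
    have : 0 ≤ γ ^ (2 * t) := by positivity
    refine mul_le_mul_of_nonneg_right ?_ this
    push_cast
    linarith
  · have h : ∀ S, kernel (sbmProb a b s)
        (fun S => (S.front.card : ℝ) ^ 3 + (c1 * (S.front.card : ℝ) ^ 2 + c2 * S.front.card)) S
        ≤ γ ^ 3 * ((S.front.card : ℝ) ^ 3
          + (c1 * (S.front.card : ℝ) ^ 2 + c2 * S.front.card)) := by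
      intro S
      rw [kernel_add, kernel_add, kernel_const_mul, kernel_const_mul]
      have h1 := kernel_card_le ha hb han hbn hn s S
      have h2 := kernel_card_sq_le ha hb han hbn hn s S
      have h3 := kernel_card_cube_le ha hb han hbn hn s S
      have hf : (0 : ℝ) ≤ S.front.card := Nat.cast_nonneg _
      rw [← hγ] at h1 h2 h3
      set f : ℝ := ((S.front.card : ℕ) : ℝ)
      have k1 : c1 * (γ - 1) ≥ 3 := by nlinarith
      have k2 : c2 * (γ ^ 2 - 1) ≥ 1 + c1 := by
        have : γ ^ 2 - 1 ≥ α - 1 := by nlinarith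
        nlinarith [mul_le_mul_of_nonneg_left this hc2p]
      have g1 : 0 ≤ γ * f := mul_nonneg hγ0 hf
      have g2 : 0 ≤ (γ * f) ^ 2 := sq_nonneg _
      have m1 := mul_le_mul_of_nonneg_left h1 hc2p
      have m2 := mul_le_mul_of_nonneg_left h2 hc1p
      have m3 := mul_le_mul_of_nonneg_right k1 g2
      have m4 := mul_le_mul_of_nonneg_right k2 g1
      have e : γ ^ 3 * (f ^ 3 + (c1 * f ^ 2 + c2 * f)) - ((γ * f) ^ 3 + 3 * (γ * f) ^ 2 + γ * f
          + (c1 * ((γ * f) ^ 2 + γ * f) + c2 * (γ * f)))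
          = (c1 * (γ - 1) - 3) * (γ * f) ^ 2 + (c2 * (γ ^ 2 - 1) - (1 + c1)) * (γ * f) := by ring
      linarith
    have := bernEx_iterate_le hP (by positivity : 0 ≤ γ ^ 3) h t S
    have h5 : bernEx (sbmProb a b s) (fun x => (((step x)^[t] S).front.card : ℝ) ^ 3)
        ≤ bernEx (sbmProb a b s) (fun x => (((step x)^[t] S).front.card : ℝ) ^ 3
          + (c1 * (((step x)^[t] S).front.card : ℝ) ^ 2 + c2 * ((step x)^[t] S).front.card)) :=
      bernEx_mono hP fun x => by
        have : 0 ≤ c1 * (((step x)^[t] S).front.card : ℝ) ^ 2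
          + c2 * (((step x)^[t] S).front.card : ℝ) := by positivity
        linarith
    refine h5.trans (this.trans (le_of_eq ?_))
    rw [hS, hK, ← pow_mul]
    push_cast
    ring

lemma cubeConst_nonneg {α : ℝ} (hα : 1 < α) : 0 ≤ cubeConst α := by
  have : 0 < α - 1 := by linarith
  rw [cubeConst]; positivity

/-- Third moment of the size of a ball. -/
lemma bernEx_ball_cube_le (ha : 0 ≤ a) (hb : 0 ≤ b) (hα : 1 < (a + b) / 2) (han : a ≤ n)
    (hbn : b ≤ n) (hn : 0 < n) (s : Fin n → ℤˣ) (i : Fin n) (t : ℕ) :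
    bernEx (sbmProb a b s)
        (fun x => (((step x)^[t] (root ∅ i (Finset.notMem_empty i))).ball.card : ℝ) ^ 3)
      ≤ (t + 1) ^ 3 * cubeConst ((a + b) / 2) * growth a b s ^ (3 * t) := by
  have hP := sbmProb_mem ha hb han hbn s
  have hγ1 : 1 ≤ growth a b s := le_trans hα.le (one_le_growth_div ha hb s)
  set S := root ∅ i (Finset.notMem_empty i)
  have h1 : ∀ x, (((step x)^[t] S).ball.card : ℝ) ^ 3
      ≤ (t + 1) ^ 2 * ∑ k ∈ Finset.range (t + 1), (((step x)^[k] S).front.card : ℝ) ^ 3 := by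
    intro x
    rw [ball_iterate]
    -- Power mean inequality over the `t + 1` spheres that make up the ball.
    have := pow_sum_div_card_le_sum_pow (s := Finset.range (t + 1))
      (f := fun k => (((step x)^[k] S).front.card : ℝ)) (fun _ _ => Nat.cast_nonneg _) 2
    rw [div_le_iff₀ (by simp; positivity)] at this
    simp only [Finset.card_range, Nat.cast_add, Nat.cast_one] at this
    simp only [S, root, Finset.card_empty, Nat.cast_zero, zero_add]
    simp only [S, root, Nat.reduceAdd] at this
    linarith
  refine (bernEx_mono hP h1).trans ?_
  rw [bernEx_const_mul, bernEx_sum]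
  have h2 : ∑ k ∈ Finset.range (t + 1),
      bernEx (sbmProb a b s) (fun x => (((step x)^[k] S).front.card : ℝ) ^ 3)
      ≤ ∑ _k ∈ Finset.range (t + 1), cubeConst ((a + b) / 2) * growth a b s ^ (3 * t) := by
    refine Finset.sum_le_sum fun k hk => ?_
    refine (bernEx_card_pow_le ha hb hα han hbn hn s S (by simp [S, root]) k).2.2.trans ?_
    have := cubeConst_nonneg hα
    have hk' := Finset.mem_range.mp hk
    gcongr
    omega
  rw [Finset.sum_const, Finset.card_range, nsmul_eq_mul] at h2
  calc _ ≤ ((t : ℝ) + 1) ^ 2 * (((t + 1 : ℕ) : ℝ)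
        * (cubeConst ((a + b) / 2) * growth a b s ^ (3 * t))) := by gcongr
    _ = _ := by push_cast; ring

/-- Second moments of the martingale increments of the spin sums over spheres. -/
lemma bernEx_increment_le (ha : 0 ≤ a) (hb : 0 ≤ b) (hα : 1 < (a + b) / 2) (han : a ≤ n)
    (hbn : b ≤ n) (hn : 0 < n) (s : Fin n → ℤˣ) (i : Fin n) (t : ℕ) :
    bernEx (sbmProb a b s) (fun x =>
        (((step x)^[t + 1] (root ∅ i (Finset.notMem_empty i))).frontSpin s
          - (a - b) / 2 * ((step x)^[t] (root ∅ i (Finset.notMem_empty i))).frontSpin s) ^ 2)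
      ≤ growth a b s ^ (t + 1) + 2 * ((a + b) + (a + b) ^ 2) ^ 2 * cubeConst ((a + b) / 2)
        * ((t + 1) ^ 3 * growth a b s ^ (3 * t) / n
          + magnetization s ^ 2 / n ^ 2 * growth a b s ^ (2 * t)) := by
  have hP := sbmProb_mem ha hb han hbn s
  have hγ0 := growth_nonneg ha hb s
  set S := root ∅ i (Finset.notMem_empty i) with hS
  set C := (a + b) + (a + b) ^ 2 with hC
  set M := magnetization s with hM
  have hn' : (0 : ℝ) < n := by exact_mod_cast hn
  rw [bernEx_iterate_succ (sbmProb a b s) t S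
    (fun S' S'' => (S''.frontSpin s - (a - b) / 2 * S'.frontSpin s) ^ 2)]
  have hpt : ∀ S' : BfsState (Fin n), kernel (sbmProb a b s)
      (fun S'' => (S''.frontSpin s - (a - b) / 2 * S'.frontSpin s) ^ 2) S'
      ≤ 2 * C ^ 2 / n * (S'.ball.card : ℝ) ^ 3
        + 2 * C ^ 2 * M ^ 2 / n ^ 2 * (S'.front.card : ℝ) ^ 2
        + growth a b s * S'.front.card := by
    intro S'
    refine (kernel_frontSpin_sub_sq_le ha hb han hbn hn s S').trans ?_
    have hfb : (S'.front.card : ℝ) ≤ S'.ball.card := by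
      exact_mod_cast Finset.card_le_card Finset.subset_union_right
    have hbn : (S'.ball.card : ℝ) ≤ n := by
      have := Finset.card_le_univ S'.ball
      rw [Fintype.card_fin] at this
      exact_mod_cast this
    have hf0 : (0 : ℝ) ≤ S'.front.card := Nat.cast_nonneg _
    set f : ℝ := ((S'.front.card : ℕ) : ℝ)
    set B : ℝ := ((S'.ball.card : ℕ) : ℝ)
    have e1 : (C * f * (B + |M|) / n) ^ 2 = C ^ 2 / n ^ 2 * (f ^ 2 * (B + |M|) ^ 2) := by
      field_simp
    -- One factor `B` is bounded by `n`, so that third moments of the ball suffice; the price is a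
    -- denominator `n` in place of `n ^ 2`.
    have e2 : (B + |M|) ^ 2 ≤ 2 * (B * n) + 2 * M ^ 2 := by
      rw [← sq_abs M]
      nlinarith [sq_nonneg (B - |M|), mul_le_mul_of_nonneg_left hbn (hf0.trans hfb)]
    have e3 : f ^ 2 * (B + |M|) ^ 2 ≤ 2 * B ^ 3 * n + 2 * M ^ 2 * f ^ 2 := by
      have : f ^ 2 * B ≤ B ^ 2 * B := by gcongr
      calc f ^ 2 * (B + |M|) ^ 2 ≤ f ^ 2 * (2 * (B * n) + 2 * M ^ 2) := by gcongr
        _ = 2 * (f ^ 2 * B) * n + 2 * M ^ 2 * f ^ 2 := by ring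
        _ ≤ 2 * (B ^ 2 * B) * n + 2 * M ^ 2 * f ^ 2 := by gcongr
        _ = _ := by ring
    rw [e1]
    have e4 : C ^ 2 / (n : ℝ) ^ 2 * (f ^ 2 * (B + |M|) ^ 2)
        ≤ C ^ 2 / (n : ℝ) ^ 2 * (2 * B ^ 3 * n + 2 * M ^ 2 * f ^ 2) := by gcongr
    have e5 : C ^ 2 / (n : ℝ) ^ 2 * (2 * B ^ 3 * n + 2 * M ^ 2 * f ^ 2)
        = 2 * C ^ 2 / n * B ^ 3 + 2 * C ^ 2 * M ^ 2 / n ^ 2 * f ^ 2 := by field_simp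
    linarith
  refine (bernEx_mono hP fun x => hpt _).trans ?_
  rw [bernEx_add, bernEx_add, bernEx_const_mul, bernEx_const_mul, bernEx_const_mul]
  obtain ⟨m1, m2, -⟩ := bernEx_card_pow_le ha hb hα han hbn hn s S (by simp [hS, root]) t
  have m3 := bernEx_ball_cube_le ha hb hα han hbn hn s i t
  rw [← hS] at m3
  set K := cubeConst ((a + b) / 2)
  calc _ ≤ 2 * C ^ 2 / n * ((t + 1) ^ 3 * K * growth a b s ^ (3 * t))
        + 2 * C ^ 2 * M ^ 2 / n ^ 2 * (K * growth a b s ^ (2 * t))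
        + growth a b s * growth a b s ^ t := by gcongr
    _ = _ := by ring

end BfsState

/-- The spins are balanced up to `n ^ (2 / 3)`. -/
def BalancedSpins (s : Fin n → ℤˣ) : Prop := |magnetization s| ≤ (n : ℝ) ^ (2 / 3 : ℝ)

end SbmMoments

/-! ### Depth of logarithmic order -/

section Depth

variable {α c : ℝ} {ℓ : ℕ → ℕ}

/-- Since `α ^ (2 ℓ)` is `n` to a power tending to `2 c log α < 1`, a positive power of `n` is left
over to absorb the polylogarithmic factor. This is what limits the depth of the exploration. -/
lemma eventually_depth_pow_le (hα : 1 < α) (hcα : c * Real.log α < 1 / 2)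
    (hℓ : Tendsto (fun n : ℕ => (ℓ n : ℝ) / Real.log n) atTop (𝓝 c)) :
    ∀ᶠ n : ℕ in atTop, α ^ (2 * ℓ n) * ((ℓ n : ℝ) + 1) ^ 3 ≤ n := by
  have hlα : 0 < Real.log α := Real.log_pos hα
  obtain ⟨δ, hδ0, hδ⟩ : ∃ δ > 0, c * Real.log α < 1 / 2 - δ :=
    ⟨(1 / 2 - c * Real.log α) / 2, by linarith, by linarith⟩
  have hlog : Tendsto (fun n : ℕ => Real.log n) atTop atTop :=
    Real.tendsto_log_atTop.comp tendsto_natCast_atTop_atTop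
  have h1 : ∀ᶠ n : ℕ in atTop, (ℓ n : ℝ) / Real.log n * Real.log α < 1 / 2 - δ :=
    (hℓ.mul_const (Real.log α)).eventually_lt_const hδ
  have h2 : ∀ᶠ n : ℕ in atTop, (ℓ n : ℝ) / Real.log n < c + 1 :=
    hℓ.eventually_lt_const (by linarith)
  have h3 : ∀ᶠ n : ℕ in atTop, ‖((c + 2) * Real.log n) ^ 3‖ ≤ 1 * ‖(n : ℝ) ^ (2 * δ)‖ := by
    have := (isLittleO_log_rpow_rpow_atTop 3 (by positivity : 0 < 2 * δ)).const_mul_left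
      ((c + 2) ^ 3)
    have := (this.comp_tendsto tendsto_natCast_atTop_atTop).def one_pos
    filter_upwards [this] with n hn
    simpa [mul_pow] using hn
  filter_upwards [h1, h2, h3, hlog.eventually_ge_atTop 1, eventually_gt_atTop 0]
    with n h1 h2 h3 h4 h5
  have hn : (0 : ℝ) < n := by exact_mod_cast h5
  have hL : 0 < Real.log n := by linarith
  rw [div_mul_eq_mul_div, div_lt_iff₀ hL] at h1
  rw [div_lt_iff₀ hL] at h2
  have e1 : α ^ (2 * ℓ n) ≤ (n : ℝ) ^ (1 - 2 * δ) := by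
    rw [← Real.rpow_natCast, Real.rpow_def_of_pos (by linarith), Real.rpow_def_of_pos hn]
    apply Real.exp_le_exp.mpr
    push_cast
    nlinarith
  have e2 : ((ℓ n : ℝ) + 1) ^ 3 ≤ (n : ℝ) ^ (2 * δ) := by
    rw [one_mul, Real.norm_of_nonneg (by positivity : (0 : ℝ) ≤ (n : ℝ) ^ (2 * δ))] at h3
    refine le_trans ?_ ((le_abs_self _).trans h3)
    gcongr
    linarith
  calc α ^ (2 * ℓ n) * ((ℓ n : ℝ) + 1) ^ 3 ≤ (n : ℝ) ^ (1 - 2 * δ) * (n : ℝ) ^ (2 * δ) := by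
        gcongr
    _ = n := by rw [← Real.rpow_add hn]; simp

/-- For balanced spins the growth rate exceeds `α` by a relative amount of at most `n ^ (-1/3)`.
Over logarithmically many steps this costs no more than a factor two. -/
lemma eventually_depth_le (hℓ : Tendsto (fun n : ℕ => (ℓ n : ℝ) / Real.log n) atTop (𝓝 c)) :
    ∀ᶠ n : ℕ in atTop, (1 + (n : ℝ) ^ (-(1 / 3) : ℝ)) ^ ℓ n ≤ 2 := by
  have hlog : Tendsto (fun n : ℕ => Real.log n) atTop atTop :=
    Real.tendsto_log_atTop.comp tendsto_natCast_atTop_atTop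
  have h2 : ∀ᶠ n : ℕ in atTop, (ℓ n : ℝ) / Real.log n < |c| + 1 :=
    hℓ.eventually_lt_const (by linarith [le_abs_self c])
  have hl2 : 0 < Real.log 2 := Real.log_pos one_lt_two
  have h3 : ∀ᶠ n : ℕ in atTop, ‖(|c| + 1) * Real.log n‖ ≤ Real.log 2 * ‖(n : ℝ) ^ (1 / 3 : ℝ)‖ :=
    (((isLittleO_log_rpow_atTop (by norm_num : (0 : ℝ) < 1 / 3)).const_mul_left
      (|c| + 1)).comp_tendsto tendsto_natCast_atTop_atTop).def hl2
  filter_upwards [h2, h3, hlog.eventually_ge_atTop 1, eventually_gt_atTop 0] with n h2 h3 h4 h5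
  have hn : (0 : ℝ) < n := by exact_mod_cast h5
  rw [div_lt_iff₀ (by linarith)] at h2
  rw [Real.norm_of_nonneg (by positivity : (0 : ℝ) ≤ (n : ℝ) ^ (1 / 3 : ℝ))] at h3
  have h6 : (ℓ n : ℝ) ≤ Real.log 2 * (n : ℝ) ^ (1 / 3 : ℝ) :=
    h2.le.trans ((le_abs_self _).trans h3)
  calc (1 + (n : ℝ) ^ (-(1 / 3) : ℝ)) ^ ℓ n ≤ Real.exp ((n : ℝ) ^ (-(1 / 3) : ℝ)) ^ ℓ n := by
        gcongr
        linarith [Real.add_one_le_exp ((n : ℝ) ^ (-(1 / 3) : ℝ))]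
    _ = Real.exp (ℓ n * (n : ℝ) ^ (-(1 / 3) : ℝ)) := by rw [← Real.exp_nat_mul]
    _ ≤ Real.exp (Real.log 2) := by
        apply Real.exp_le_exp.mpr
        calc (ℓ n : ℝ) * (n : ℝ) ^ (-(1 / 3) : ℝ)
            ≤ Real.log 2 * (n : ℝ) ^ (1 / 3 : ℝ) * (n : ℝ) ^ (-(1 / 3) : ℝ) := by gcongr
          _ = Real.log 2 := by rw [mul_assoc, ← Real.rpow_add hn]; simp
    _ = 2 := Real.exp_log two_pos

end Depth

/-! ### Increments of the spin sums down to depth `ℓ n`. -/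

section Increments

variable {a b c : ℝ} {ℓ : ℕ → ℕ}

lemma growth_le_of_balanced {n : ℕ} (hn : 0 < n) (ha : 0 ≤ a) (hb : 0 ≤ b) {s : Fin n → ℤˣ}
    (hs : BalancedSpins s) :
    BfsState.growth a b s ≤ (a + b) / 2 * (1 + (n : ℝ) ^ (-(1 / 3) : ℝ)) := by
  have hn' : (0 : ℝ) < n := by exact_mod_cast hn
  rw [BfsState.growth]
  have : |magnetization s| / n ≤ (n : ℝ) ^ (-(1 / 3) : ℝ) := by
    rw [div_le_iff₀ hn']
    refine (show |magnetization s| ≤ (n : ℝ) ^ (2 / 3 : ℝ) from hs).trans (le_of_eq ?_)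
    nth_rewrite 3 [← Real.rpow_one (n : ℝ)]
    rw [← Real.rpow_add hn']
    norm_num
  gcongr

open BfsState in
/-- Uniform bound on the increments up to depth `ℓ n`. -/
lemma eventually_increment_le (ha : 0 ≤ a) (hb : 0 ≤ b) (hα : 1 < (a + b) / 2)
    (hcα : c * Real.log ((a + b) / 2) < 1 / 2)
    (hℓ : Tendsto (fun n : ℕ => (ℓ n : ℝ) / Real.log n) atTop (𝓝 c)) :
    ∃ C : ℝ, 0 ≤ C ∧ ∀ᶠ n : ℕ in atTop, ∀ s : Fin n → ℤˣ, BalancedSpins s → ∀ i : Fin n,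
      ∀ t < ℓ n, bernEx (sbmProb a b s) (fun x =>
        (((step x)^[t + 1] (root ∅ i (Finset.notMem_empty i))).frontSpin s
          - (a - b) / 2 * ((step x)^[t] (root ∅ i (Finset.notMem_empty i))).frontSpin s) ^ 2)
      ≤ C * ((a + b) / 2) ^ t := by
  have hK := cubeConst_nonneg hα
  set α := (a + b) / 2 with hαdef
  set K := cubeConst α
  refine ⟨2 * α + 2 * ((a + b) + (a + b) ^ 2) ^ 2 * K * (8 + 4), by positivity, ?_⟩
  filter_upwards [eventually_depth_pow_le hα hcα hℓ, eventually_depth_le hℓ, eventually_gt_atTop 0,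
    tendsto_natCast_atTop_atTop.eventually_ge_atTop a,
    tendsto_natCast_atTop_atTop.eventually_ge_atTop b] with n h1 h2 hn han hbn
  intro s hs i t ht
  have hn' : (0 : ℝ) < n := by exact_mod_cast hn
  refine (bernEx_increment_le ha hb hα han hbn hn s i t).trans ?_
  have hγα := growth_le_of_balanced hn ha hb hs
  have hγ0 := growth_nonneg ha hb s
  rw [← hαdef] at hγα
  set γ := growth a b s
  have hα0 : 0 < α := by linarith
  have hone : (1 : ℝ) ≤ 1 + (n : ℝ) ^ (-(1 / 3) : ℝ) := by
    have : (0 : ℝ) ≤ (n : ℝ) ^ (-(1 / 3) : ℝ) := by positivity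
    linarith
  have hpow : ∀ k ≤ ℓ n, γ ^ k ≤ 2 * α ^ k := by
    intro k hk
    calc γ ^ k ≤ (α * (1 + (n : ℝ) ^ (-(1 / 3) : ℝ))) ^ k := by gcongr
      _ = (1 + (n : ℝ) ^ (-(1 / 3) : ℝ)) ^ k * α ^ k := by rw [mul_pow, mul_comm]
      _ ≤ (1 + (n : ℝ) ^ (-(1 / 3) : ℝ)) ^ ℓ n * α ^ k := by
          gcongr
      _ ≤ 2 * α ^ k := by gcongr
  have g1 : γ ^ (t + 1) ≤ 2 * α * α ^ t := (hpow (t + 1) ht).trans (le_of_eq (by ring))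
  have gt := hpow t ht.le
  have hαt : α ^ (2 * t) ≤ α ^ (2 * ℓ n) := pow_le_pow_right₀ hα.le (by omega)
  have htl : ((t : ℝ) + 1) ^ 3 ≤ ((ℓ n : ℝ) + 1) ^ 3 := by
    have : (t : ℝ) ≤ ℓ n := by exact_mod_cast ht.le
    gcongr
  -- Of the three factors `α ^ t`, one is kept for the bound and the other two, with the polynomial
  -- factor, are paid for by `n`.
  have g3 : (t + 1) ^ 3 * γ ^ (3 * t) / n ≤ 8 * α ^ t := by
    rw [div_le_iff₀ hn']
    calc (t + 1) ^ 3 * γ ^ (3 * t) = ((t : ℝ) + 1) ^ 3 * (γ ^ t) ^ 3 := by rw [← pow_mul]; ring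
      _ ≤ ((ℓ n : ℝ) + 1) ^ 3 * (2 * α ^ t) ^ 3 := by gcongr
      _ = 8 * α ^ t * (α ^ (2 * t) * ((ℓ n : ℝ) + 1) ^ 3) := by ring
      _ ≤ 8 * α ^ t * (α ^ (2 * ℓ n) * ((ℓ n : ℝ) + 1) ^ 3) := by gcongr
      _ ≤ 8 * α ^ t * n := by gcongr
  have hl1 : (1 : ℝ) ≤ ((ℓ n : ℝ) + 1) ^ 3 := one_le_pow₀ (by linarith [(ℓ n).cast_nonneg (α := ℝ)])
  -- Imbalance contributes `n ^ (4/3)` and one factor `α ^ t` at most `n ^ (1/2)`; together `n ^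
  -- (11/6)`, below the available `n ^ 2`.
  have g2 : magnetization s ^ 2 / n ^ 2 * γ ^ (2 * t) ≤ 4 * α ^ t := by
    have hM : magnetization s ^ 2 ≤ (n : ℝ) ^ (4 / 3 : ℝ) := by
      rw [← sq_abs]
      calc |magnetization s| ^ 2 ≤ ((n : ℝ) ^ (2 / 3 : ℝ)) ^ 2 := by gcongr; exact hs
        _ = _ := by rw [← Real.rpow_mul_natCast hn'.le]; norm_num
    have hαn : α ^ t ≤ (n : ℝ) ^ (1 / 2 : ℝ) := by
      rw [← Real.sqrt_eq_rpow]
      apply Real.le_sqrt_of_sq_le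
      calc (α ^ t) ^ 2 = α ^ (2 * t) := by ring
        _ ≤ α ^ (2 * ℓ n) := hαt
        _ ≤ α ^ (2 * ℓ n) * ((ℓ n : ℝ) + 1) ^ 3 := le_mul_of_one_le_right (by positivity) hl1
        _ ≤ n := h1
    rw [div_mul_eq_mul_div, div_le_iff₀ (by positivity)]
    have hn1 : (1 : ℝ) ≤ n := by exact_mod_cast hn
    calc magnetization s ^ 2 * γ ^ (2 * t) = magnetization s ^ 2 * (γ ^ t) ^ 2 := by ring
      _ ≤ (n : ℝ) ^ (4 / 3 : ℝ) * (2 * α ^ t) ^ 2 := by gcongr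
      _ = 4 * α ^ t * ((n : ℝ) ^ (4 / 3 : ℝ) * α ^ t) := by ring
      _ ≤ 4 * α ^ t * ((n : ℝ) ^ (4 / 3 : ℝ) * (n : ℝ) ^ (1 / 2 : ℝ)) := by gcongr
      _ = 4 * α ^ t * (n : ℝ) ^ (11 / 6 : ℝ) := by rw [← Real.rpow_add hn']; norm_num
      _ ≤ 4 * α ^ t * (n : ℝ) ^ (2 : ℝ) := by
          gcongr
          norm_num
      _ = 4 * α ^ t * (n : ℝ) ^ 2 := by norm_num
  calc _ ≤ 2 * α * α ^ t + 2 * ((a + b) + (a + b) ^ 2) ^ 2 * K * (8 * α ^ t + 4 * α ^ t) := by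
        gcongr
    _ = _ := by ring

end Increments

/-! ### Poisson expectations -/

/-- Expectation under the Poisson law of mean `r`. -/
def poissonEx (r : ℝ) (g : ℕ → ℝ) : ℝ := ∫ k, g k ∂poissonMeasure r.toNNReal

section PoissonEx

lemma integrable_of_abs_le {X : Type*} [MeasurableSpace X] [DiscreteMeasurableSpace X]
    [Countable X] {μ : Measure X} [IsFiniteMeasure μ] {g : X → ℝ} {C : ℝ}
    (hg : ∀ k, |g k| ≤ C) : Integrable g μ :=
  Integrable.of_bound (Measurable.of_discrete.aestronglyMeasurable) C
    (Eventually.of_forall fun k => by simpa using hg k)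

lemma abs_poissonEx_le {g : ℕ → ℝ} {C : ℝ} (hg : ∀ k, |g k| ≤ C) (r : ℝ) :
    |poissonEx r g| ≤ C := by
  have := norm_integral_le_of_norm_le_const (μ := poissonMeasure r.toNNReal) (f := g) (C := C)
    (Eventually.of_forall fun k => by simpa using hg k)
  simpa [poissonEx] using this

lemma hasSum_poisson_mean (r : NNReal) :
    HasSum (fun k : ℕ => Real.exp (-r) * r ^ k / (k.factorial : ℝ) * (k : ℝ)) r := by
  rw [← hasSum_nat_add_iff' 1]
  simp only [Finset.sum_range_one, Nat.cast_zero, mul_zero, sub_zero]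
  have := (hasSum_one_poissonMeasure r).mul_left (r : ℝ)
  rw [mul_one] at this
  refine this.congr_fun ?_
  intro k
  rw [Nat.factorial_succ]
  have : (k.factorial : ℝ) ≠ 0 := by positivity
  push_cast
  field_simp
  ring

lemma hasSum_poisson_factorial_moment (r : NNReal) :
    HasSum (fun k : ℕ => Real.exp (-r) * r ^ k / (k.factorial : ℝ) * ((k : ℝ) * (k - 1)))
      ((r : ℝ) ^ 2) := by
  rw [← hasSum_nat_add_iff' 1]
  simp only [Finset.sum_range_one, Nat.cast_zero, mul_zero, sub_zero, zero_mul]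
  have := (hasSum_poisson_mean r).mul_left (r : ℝ)
  rw [← sq] at this
  refine this.congr_fun ?_
  intro k
  rw [Nat.factorial_succ]
  have : (k.factorial : ℝ) ≠ 0 := by positivity
  push_cast
  field_simp
  ring

lemma integrable_poisson_mean (r : NNReal) :
    Integrable (fun k : ℕ => (k : ℝ)) (poissonMeasure r) := by
  rw [integrable_poissonMeasure_iff]
  exact (hasSum_poisson_mean r).summable.congr fun k => by simp

lemma integrable_poisson_factorial_moment (r : NNReal) :
    Integrable (fun k : ℕ => (k : ℝ) * (k - 1)) (poissonMeasure r) := by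
  rw [integrable_poissonMeasure_iff]
  refine (hasSum_poisson_factorial_moment r).summable.congr fun k => ?_
  rw [Real.norm_of_nonneg]
  rcases Nat.eq_zero_or_pos k with rfl | h
  · simp
  · have : (1 : ℝ) ≤ k := by exact_mod_cast h
    exact mul_nonneg (by linarith) (by linarith)

lemma poissonEx_mean {r : ℝ} (hr : 0 ≤ r) : poissonEx r (fun k => (k : ℝ)) = r := by
  have := hasSum_integral_poissonMeasure (integrable_poisson_mean r.toNNReal)
  have h := this.unique (by simpa using hasSum_poisson_mean r.toNNReal)
  rw [poissonEx, h, max_eq_left hr]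

lemma poissonEx_factorial_moment {r : ℝ} (hr : 0 ≤ r) :
    poissonEx r (fun k => (k : ℝ) * (k - 1)) = r ^ 2 := by
  have := hasSum_integral_poissonMeasure (integrable_poisson_factorial_moment r.toNNReal)
  have h := this.unique (by simpa using hasSum_poisson_factorial_moment r.toNNReal)
  rw [poissonEx, h, max_eq_left hr]

lemma poissonEx_add {r r' : ℝ} (hr : 0 ≤ r) (hr' : 0 ≤ r') {g : ℕ → ℝ} {C : ℝ}
    (hg : ∀ k, |g k| ≤ C) :
    poissonEx (r + r') g = poissonEx r fun j => poissonEx r' fun k => g (j + k) := by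
  simp only [poissonEx]
  rw [Real.toNNReal_add hr hr', ← poissonMeasure_conv_poissonMeasure, integral_conv]
  exact integrable_of_abs_le hg

lemma poissonEx_sub {g h : ℕ → ℝ} {C C' : ℝ} (hg : ∀ k, |g k| ≤ C) (hh : ∀ k, |h k| ≤ C') (r : ℝ) :
    poissonEx r (fun k => g k - h k) = poissonEx r g - poissonEx r h :=
  integral_sub (integrable_of_abs_le hg) (integrable_of_abs_le hh)

/-- The Poisson law of small mean is close to the point mass at zero. -/
lemma abs_poissonEx_sub_zero_le {r : ℝ} (hr : 0 ≤ r) {g : ℕ → ℝ} {C : ℝ} (hg : ∀ k, |g k| ≤ C) :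
    |poissonEx r g - g 0| ≤ 2 * C * r := by
  have h0 : poissonEx r g - g 0 = ∫ k, (g k - g 0) ∂poissonMeasure r.toNNReal := by
    rw [integral_sub (integrable_of_abs_le hg) (integrable_const _)]
    simp [poissonEx]
  have h1 : ∫ k : ℕ, 2 * C * (k : ℝ) ∂poissonMeasure r.toNNReal = 2 * C * r := by
    rw [integral_const_mul]
    congr 1
    exact poissonEx_mean hr
  rw [h0, ← h1, ← Real.norm_eq_abs]
  refine norm_integral_le_of_norm_le ((integrable_poisson_mean _).const_mul _)
    (Eventually.of_forall fun k => ?_)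
  rw [Real.norm_eq_abs]
  rcases Nat.eq_zero_or_pos k with rfl | h
  · simp
  · have : (1 : ℝ) ≤ k := by exact_mod_cast h
    have hC : 0 ≤ C := (abs_nonneg _).trans (hg 0)
    calc |g k - g 0| ≤ |g k| + |g 0| := abs_sub _ _
      _ ≤ 2 * C * 1 := by linarith [hg k, hg 0]
      _ ≤ 2 * C * k := by gcongr

/-- Comparison of a Bernoulli and a Poisson variable of the same mean. -/
lemma abs_poissonEx_sub_bernoulli_le {r : ℝ} (hr : 0 ≤ r) {g : ℕ → ℝ} {C : ℝ}
    (hg : ∀ k, |g k| ≤ C) :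
    |poissonEx r g - (r * g 1 + (1 - r) * g 0)| ≤ 4 * C * r ^ 2 := by
  have hi := integrable_poisson_mean r.toNNReal
  have h0 : poissonEx r g - (r * g 1 + (1 - r) * g 0)
      = ∫ k : ℕ, (g k - g 0 - (g 1 - g 0) * (k : ℝ)) ∂poissonMeasure r.toNNReal := by
    have hi' : Integrable (fun k => g k - g 0) (poissonMeasure r.toNNReal) :=
      (integrable_of_abs_le hg).sub (integrable_const _)
    rw [integral_sub hi' (hi.const_mul _),
      integral_sub (integrable_of_abs_le hg) (integrable_const _), integral_const_mul,
      show ∫ k : ℕ, (k : ℝ) ∂poissonMeasure r.toNNReal = r from poissonEx_mean hr]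
    simp [poissonEx]
    ring
  have h1 : ∫ k : ℕ, 4 * C * ((k : ℝ) * (k - 1)) ∂poissonMeasure r.toNNReal = 4 * C * r ^ 2 := by
    rw [integral_const_mul]
    congr 1
    exact poissonEx_factorial_moment hr
  rw [h0, ← h1, ← Real.norm_eq_abs]
  refine norm_integral_le_of_norm_le ((integrable_poisson_factorial_moment _).const_mul _)
    (Eventually.of_forall fun k => ?_)
  rw [Real.norm_eq_abs]
  have hC : 0 ≤ C := (abs_nonneg _).trans (hg 0)
  -- The integrand vanishes at `0` and `1`, as does `k * (k - 1)`; from `2` on, its linear growth is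
  -- dominated by the quadratic bound.
  match k with
  | 0 => simp
  | 1 => simp
  | k + 2 =>
    have hk : (0 : ℝ) ≤ k := Nat.cast_nonneg k
    have h2 := abs_le.mp (hg (k + 2))
    have h3 := abs_le.mp (hg 1)
    have h4 := abs_le.mp (hg 0)
    push_cast
    rw [abs_le]
    constructor <;> nlinarith [mul_nonneg hC hk, mul_nonneg (mul_nonneg hC hk) hk]

/-- Continuity of the Poisson law in its mean. -/
lemma abs_poissonEx_sub_poissonEx_le {r r' : ℝ} (hr : 0 ≤ r) (hr' : 0 ≤ r') {g : ℕ → ℝ} {C : ℝ}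
    (hg : ∀ k, |g k| ≤ C) : |poissonEx r g - poissonEx r' g| ≤ 2 * C * |r - r'| := by
  wlog h : r' ≤ r generalizing r r'
  · rw [abs_sub_comm, abs_sub_comm r]
    exact this hr' hr (le_of_not_ge h)
  -- The variable of larger mean is the other one plus an independent Poisson variable of mean `r -
  -- r'`, which is rarely nonzero.
  have h1 : r = r' + (r - r') := by ring
  have h2 : 0 ≤ r - r' := by linarith
  rw [abs_of_nonneg h2]
  nth_rewrite 1 [h1]
  rw [poissonEx_add hr' h2 hg,
    ← poissonEx_sub (C := C) (fun j => abs_poissonEx_le (fun k => hg _) _) hg]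
  exact abs_poissonEx_le (fun j => abs_poissonEx_sub_zero_le h2 fun k => hg (j + k)) r'

/-- Expectation under the law of two independent Poisson variables of means `r` and `r'`. -/
def poissonEx₂ (r r' : ℝ) (f : ℕ → ℕ → ℝ) : ℝ := poissonEx r fun j => poissonEx r' (f j)

variable {f : ℕ → ℕ → ℝ} {C : ℝ}

lemma abs_poissonEx₂_le (hf : ∀ j k, |f j k| ≤ C) (r r' : ℝ) : |poissonEx₂ r r' f| ≤ C :=
  abs_poissonEx_le (fun j => abs_poissonEx_le (hf j) r') r

lemma poissonEx_comm (hf : ∀ j k, |f j k| ≤ C) (r r' : ℝ) :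
    poissonEx r (fun j => poissonEx r' (f j)) = poissonEx r' fun k => poissonEx r fun j => f j k :=
  integral_integral_swap (integrable_of_abs_le (C := C) fun k => hf k.1 k.2)

lemma poissonEx₂_sub {g : ℕ → ℕ → ℝ} {C' : ℝ} (hf : ∀ j k, |f j k| ≤ C)
    (hg : ∀ j k, |g j k| ≤ C') (r r' : ℝ) :
    poissonEx₂ r r' (fun j k => f j k - g j k) = poissonEx₂ r r' f - poissonEx₂ r r' g := by
  simp only [poissonEx₂, poissonEx_sub (hf _) (hg _)]
  exact poissonEx_sub (fun j => abs_poissonEx_le (hf j) r') (fun j => abs_poissonEx_le (hg j) r') r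

lemma poissonEx₂_add_left (hf : ∀ j k, |f j k| ≤ C) {r p : ℝ} (hr : 0 ≤ r) (hp : 0 ≤ p) (r' : ℝ) :
    poissonEx₂ (r + p) r' f = poissonEx₂ r r' fun j k => poissonEx p fun i => f (j + i) k := by
  rw [poissonEx₂, poissonEx_add hr hp fun j => abs_poissonEx_le (hf j) r', poissonEx₂]
  congr 1
  ext j : 1
  exact poissonEx_comm (fun i k => hf (j + i) k) p r'

lemma poissonEx₂_add_right (hf : ∀ j k, |f j k| ≤ C) {r' p : ℝ} (hr' : 0 ≤ r') (hp : 0 ≤ p)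
    (r : ℝ) :
    poissonEx₂ r (r' + p) f = poissonEx₂ r r' fun j k => poissonEx p fun i => f j (k + i) := by
  simp only [poissonEx₂, poissonEx_add hr' hp (hf _)]

lemma abs_poissonEx₂_sub_le (hf : ∀ j k, |f j k| ≤ C) {r r' t t' : ℝ} (hr : 0 ≤ r) (hr' : 0 ≤ r')
    (ht : 0 ≤ t) (ht' : 0 ≤ t') :
    |poissonEx₂ r r' f - poissonEx₂ t t' f| ≤ 2 * C * (|r - t| + |r' - t'|) := by
  have h1 : |poissonEx₂ r r' f - poissonEx₂ t r' f| ≤ 2 * C * |r - t| :=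
    abs_poissonEx_sub_poissonEx_le hr ht fun j => abs_poissonEx_le (hf j) r'
  have h2 : |poissonEx₂ t r' f - poissonEx₂ t t' f| ≤ 2 * C * |r' - t'| := by
    rw [poissonEx₂, poissonEx₂, ← poissonEx_sub (fun j => abs_poissonEx_le (hf j) r')
      (fun j => abs_poissonEx_le (hf j) t')]
    exact abs_poissonEx_le (fun j => abs_poissonEx_sub_poissonEx_le hr' ht' (hf j)) t
  calc _ ≤ _ := abs_sub_le _ (poissonEx₂ t r' f) _
    _ ≤ _ := by linarith

end PoissonEx

/-! ### Poisson approximation of the numbers of successes in two classes -/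

section LeCam

variable {ι : Type*} [Fintype ι] [DecidableEq ι] {p : ι → ℝ}

/-- Coordinate `i` is independent of those in `W` and can be integrated out first; this is the
Bernoulli half of the induction step in Le Cam's inequality. -/
lemma bernEx_coordinate_mul {i : ι} {W : Finset ι} (hi : i ∉ W) (G H : (ι → Bool) → ℝ)
    (hG : DependsOn G (W : Set ι)) (hH : DependsOn H (W : Set ι)) :
    bernEx p (fun x => ind (x i) * G x + (1 - ind (x i)) * H x)
      = bernEx p (fun x => p i * G x + (1 - p i) * H x) := by
  have hsub : (W : Set ι) ⊆ ({i} : Set ι)ᶜ := fun j hj h => hi (by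
    rw [Set.mem_singleton_iff] at h; rwa [← h])
  have h1 : DependsOn (fun x : ι → Bool => ind (x i)) ({i} : Set ι) := fun x y h => by
    show ind (x i) = ind (y i)
    rw [h i rfl]
  have h2 : DependsOn (fun x : ι → Bool => 1 - ind (x i)) ({i} : Set ι) := fun x y h => by
    show 1 - ind (x i) = 1 - ind (y i)
    rw [h i rfl]
  rw [bernEx_add, bernEx_mul_of_dependsOn h1 (hG.mono hsub),
    bernEx_mul_of_dependsOn h2 (hH.mono hsub), bernEx_sub, bernEx_const, bernEx_ind, bernEx_add,
    bernEx_const_mul, bernEx_const_mul]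

/-- Le Cam's inequality for two classes of independent Bernoulli variables. -/
lemma abs_bernEx_sub_poissonEx₂_le (hp : ∀ i, p i ∈ Set.Icc (0 : ℝ) 1) (P : ι → Prop)
    [DecidablePred P] (W : Finset ι) {f : ℕ → ℕ → ℝ} {C : ℝ} (hf : ∀ j k, |f j k| ≤ C) :
    |bernEx p (fun x => f (W.filter fun i => P i ∧ x i = true).card
          (W.filter fun i => ¬ P i ∧ x i = true).card)
        - poissonEx₂ (∑ i ∈ W with P i, p i) (∑ i ∈ W with ¬ P i, p i) f|
      ≤ 4 * C * ∑ i ∈ W, p i ^ 2 := by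
  -- The bound is proved for all `f` at once: a new coordinate replaces `f` by its average over one
  -- Bernoulli variable on one side and over one Poisson variable on the other. Both averages stay
  -- bounded by `C` and differ by at most `4 C (p i) ^ 2`.
  induction W using Finset.induction_on generalizing f with
  | empty =>
    have h0 : poissonEx₂ 0 0 f = f 0 0 := by
      have h1 : ∀ g : ℕ → ℝ, (∃ C, ∀ k, |g k| ≤ C) → poissonEx 0 g = g 0 := fun g ⟨C, hg⟩ => by
        have := abs_poissonEx_sub_zero_le le_rfl hg
        rw [mul_zero] at this
        exact sub_eq_zero.mp (abs_nonpos_iff.mp this)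
      rw [poissonEx₂, h1 _ ⟨C, fun j => abs_poissonEx_le (hf j) 0⟩, h1 _ ⟨C, hf 0⟩]
    simp [bernEx_const, h0]
  | insert i W hi ih =>
    have hC : 0 ≤ C := (abs_nonneg _).trans (hf 0 0)
    have hpi := hp i
    have hsum1 : 0 ≤ ∑ j ∈ W with P j, p j := Finset.sum_nonneg fun j _ => (hp j).1
    have hsum2 : 0 ≤ ∑ j ∈ W with ¬ P j, p j := Finset.sum_nonneg fun j _ => (hp j).1
    have hdep : ∀ (Q : ι → Prop) [DecidablePred Q] (x y : ι → Bool),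
        (∀ j ∈ (W : Set ι), x j = y j) →
        W.filter (fun j => Q j ∧ x j = true) = W.filter fun j => Q j ∧ y j = true := by
      intro Q _ x y h
      exact Finset.filter_congr fun j hj => by rw [h j hj]
    have hcard : ∀ (Q : ι → Prop) [DecidablePred Q] (x : ι → Bool),
        ((insert i W).filter fun j => Q j ∧ x j = true).card
          = (W.filter fun j => Q j ∧ x j = true).card + if Q i ∧ x i = true then 1 else 0 := by
      intro Q _ x
      rw [Finset.filter_insert]
      split_ifs with h
      · rw [Finset.card_insert_of_notMem (fun h' => hi (Finset.mem_filter.mp h').1)]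
      · rfl
    rw [Finset.sum_insert hi]
    by_cases hP : P i
    · set g : ℕ → ℕ → ℝ := fun j k => p i * f (j + 1) k + (1 - p i) * f j k with hg
      have hgC : ∀ j k, |g j k| ≤ C := fun j k => by
        have h1 := abs_le.mp (hf (j + 1) k)
        have h2 := abs_le.mp (hf j k)
        rw [abs_le]
        constructor <;> simp only [hg] <;> nlinarith [hpi.1, hpi.2]
      have e1 : bernEx p (fun x => f ((insert i W).filter fun i => P i ∧ x i = true).card
          ((insert i W).filter fun i => ¬ P i ∧ x i = true).card)
          = bernEx p (fun x => g (W.filter fun i => P i ∧ x i = true).card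
          (W.filter fun i => ¬ P i ∧ x i = true).card) := by
        rw [← bernEx_coordinate_mul hi]
        · congr 1
          ext x
          rw [hcard P, hcard fun j => ¬ P j]
          cases hx : x i <;> simp [hP, ind]
        · intro x y h
          show f _ _ = f _ _
          rw [hdep P x y h, hdep (fun j => ¬ P j) x y h]
        · intro x y h
          show f _ _ = f _ _
          rw [hdep P x y h, hdep (fun j => ¬ P j) x y h]
      have e2 : poissonEx₂ (∑ j ∈ insert i W with P j, p j) (∑ j ∈ insert i W with ¬ P j, p j) f
          = poissonEx₂ (∑ j ∈ W with P j, p j) (∑ j ∈ W with ¬ P j, p j)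
            (fun j k => poissonEx (p i) fun l => f (j + l) k) := by
        rw [← poissonEx₂_add_left hf hsum1 hpi.1, Finset.filter_insert, if_pos hP,
          Finset.filter_insert, if_neg (not_not.mpr hP),
          Finset.sum_insert (fun h' => hi (Finset.mem_filter.mp h').1), add_comm]
      have hq : ∀ j k, |poissonEx (p i) (fun l => f (j + l) k)| ≤ C := fun j k =>
        abs_poissonEx_le (fun l => hf (j + l) k) _
      rw [e1, e2]
      refine (abs_sub_le _ (poissonEx₂ (∑ j ∈ W with P j, p j) (∑ j ∈ W with ¬ P j, p j) g) _).trans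
        ?_
      rw [mul_add, add_comm]
      refine add_le_add ?_ (ih hgC)
      rw [← poissonEx₂_sub hgC hq]
      refine abs_poissonEx₂_le (fun j k => ?_) _ _
      rw [abs_sub_comm]
      simpa using abs_poissonEx_sub_bernoulli_le hpi.1 (g := fun l => f (j + l) k) fun l => hf _ _
    · set g : ℕ → ℕ → ℝ := fun j k => p i * f j (k + 1) + (1 - p i) * f j k with hg
      have hgC : ∀ j k, |g j k| ≤ C := fun j k => by
        have h1 := abs_le.mp (hf j (k + 1))
        have h2 := abs_le.mp (hf j k)
        rw [abs_le]
        constructor <;> simp only [hg] <;> nlinarith [hpi.1, hpi.2]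
      have e1 : bernEx p (fun x => f ((insert i W).filter fun i => P i ∧ x i = true).card
          ((insert i W).filter fun i => ¬ P i ∧ x i = true).card)
          = bernEx p (fun x => g (W.filter fun i => P i ∧ x i = true).card
          (W.filter fun i => ¬ P i ∧ x i = true).card) := by
        rw [← bernEx_coordinate_mul hi]
        · congr 1
          ext x
          rw [hcard P, hcard fun j => ¬ P j]
          cases hx : x i <;> simp [hP, ind]
        · intro x y h
          show f _ _ = f _ _
          rw [hdep P x y h, hdep (fun j => ¬ P j) x y h]
        · intro x y h
          show f _ _ = f _ _
          rw [hdep P x y h, hdep (fun j => ¬ P j) x y h]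
      have e2 : poissonEx₂ (∑ j ∈ insert i W with P j, p j) (∑ j ∈ insert i W with ¬ P j, p j) f
          = poissonEx₂ (∑ j ∈ W with P j, p j) (∑ j ∈ W with ¬ P j, p j)
            (fun j k => poissonEx (p i) fun l => f j (k + l)) := by
        rw [← poissonEx₂_add_right hf hsum2 hpi.1, Finset.filter_insert, if_neg hP,
          Finset.filter_insert, if_pos hP,
          Finset.sum_insert (fun h' => hi (Finset.mem_filter.mp h').1), add_comm (p i)]
      have hq : ∀ j k, |poissonEx (p i) (fun l => f j (k + l))| ≤ C := fun j k =>
        abs_poissonEx_le (fun l => hf j (k + l)) _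
      rw [e1, e2]
      refine (abs_sub_le _ (poissonEx₂ (∑ j ∈ W with P j, p j) (∑ j ∈ W with ¬ P j, p j) g) _).trans
        ?_
      rw [mul_add, add_comm]
      refine add_le_add ?_ (ih hgC)
      rw [← poissonEx₂_sub hgC hq]
      refine abs_poissonEx₂_le (fun j k => ?_) _ _
      rw [abs_sub_comm]
      simpa using abs_poissonEx_sub_bernoulli_le hpi.1 (g := fun l => f j (k + l)) fun l => hf _ _

end LeCam

/-! ### Comparison of the exploration with the two-type Poisson tree -/

/-- Transition operator of the two-type Poisson tree process. -/
def treeOp (a b : ℝ) (f : ℕ → ℕ → ℝ) (k m : ℕ) : ℝ :=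
  poissonEx₂ (a / 2 * k + b / 2 * m) (a / 2 * m + b / 2 * k) f

lemma abs_treeOp_iterate_le {a b C : ℝ} {f : ℕ → ℕ → ℝ} (hf : ∀ k m, |f k m| ≤ C) (t : ℕ)
    (k m : ℕ) : |(treeOp a b)^[t] f k m| ≤ C := by
  induction t generalizing k m with
  | zero => exact hf k m
  | succ t ih =>
    rw [Function.iterate_succ_apply']
    exact abs_poissonEx₂_le ih _ _

section Compare

variable {n : ℕ} {a b : ℝ}

lemma card_filter_spin (s : Fin n → ℤˣ) (τ : ℤˣ) (A : Finset (Fin n)) :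
    ∑ u ∈ A, spin s u
      = ((τ : ℤ) : ℝ) * ((A.filter fun u => s u = τ).card - (A.filter fun u => ¬ s u = τ).card) := by
  have h : ∀ u, spin s u
      = ((τ : ℤ) : ℝ) * ((if s u = τ then 1 else 0) - if ¬ s u = τ then 1 else 0) := by
    intro u
    rcases Int.units_eq_one_or (s u) with h | h <;> rcases Int.units_eq_one_or τ with h' | h' <;>
      simp [spin, h, h']
  simp only [h]
  rw [← Finset.mul_sum, Finset.sum_sub_distrib, Finset.card_filter, Finset.card_filter]
  push_cast
  rfl

lemma unit_mul_self (τ : ℤˣ) : ((τ : ℤ) : ℝ) * ((τ : ℤ) : ℝ) = 1 := by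
  rcases Int.units_eq_one_or τ with h | h <;> simp [h]

lemma card_filter_add (s : Fin n → ℤˣ) (τ : ℤˣ) (A : Finset (Fin n)) :
    (A.card : ℝ) = (A.filter fun u => s u = τ).card + (A.filter fun u => ¬ s u = τ).card := by
  rw [← Finset.card_filter_add_card_filter_not (s := A) (fun u => s u = τ)]
  push_cast
  rfl

namespace BfsState

/-- The function `f` of the numbers of vertices of spin `τ` and `-τ` in the frontier. -/
def countFun (s : Fin n → ℤˣ) (τ : ℤˣ) (f : ℕ → ℕ → ℝ) (S : BfsState (Fin n)) : ℝ :=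
  f (S.front.filter fun u => s u = τ).card (S.front.filter fun u => ¬ s u = τ).card

lemma meanDeg_eq (a b : ℝ) (s : Fin n → ℤˣ) (τ : ℤˣ) (S : BfsState (Fin n)) (u : Fin n) :
    S.meanDeg a b s u = if s u = τ then
        (a * (S.front.filter fun u => s u = τ).card
          + b * (S.front.filter fun u => ¬ s u = τ).card) / n
      else (a * (S.front.filter fun u => ¬ s u = τ).card
          + b * (S.front.filter fun u => s u = τ).card) / n := by
  rw [meanDeg, frontSpin, card_filter_spin s τ, card_filter_add s τ]
  rcases Int.units_eq_one_or (s u) with h | h <;> rcases Int.units_eq_one_or τ with h' | h' <;>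
    simp [spin, h, h'] <;> ring

/-- Constant in the one-step comparison. -/
def stepConst (a b : ℝ) : ℝ := 8 * (a + b) + 8 * (a + b) ^ 2

lemma stepConst_nonneg (ha : 0 ≤ a) (hb : 0 ≤ b) : 0 ≤ stepConst a b := by
  unfold stepConst; positivity

lemma front_card_le_ball (S : BfsState (Fin n)) : (S.front.card : ℝ) ≤ S.ball.card := by
  exact_mod_cast Finset.card_le_card Finset.subset_union_right

/-- The total means of the next generation, for the vertices of given spin. -/
lemma abs_sum_hitProb_sub_le (ha : 0 ≤ a) (hb : 0 ≤ b) (han : a ≤ n) (hbn : b ≤ n) (hn : 0 < n)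
    (s : Fin n → ℤˣ) (S : BfsState (Fin n)) (A : Finset (Fin n)) (m : ℝ)
    (hA : |(A.card : ℝ) - n / 2| ≤ |magnetization s|) (hm0 : 0 ≤ m)
    (hm : m ≤ (a + b) * S.front.card)
    (hmean : ∀ u ∈ A, S.meanDeg a b s u = m / n) :
    |(∑ u ∈ A.filter fun u => u ∉ S.ball, S.hitProb (sbmProb a b s) u) - m / 2|
      ≤ ((a + b) + (a + b) ^ 2) * S.front.card * (S.ball.card + |magnetization s|) / n := by
  have hn' : (0 : ℝ) < n := by exact_mod_cast hn
  have e1 : ∑ u ∈ A.filter fun u => u ∉ S.ball, S.hitProb (sbmProb a b s) u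
      = ∑ u ∈ A, S.hitProb (sbmProb a b s) u := by
    rw [Finset.sum_filter]
    refine Finset.sum_congr rfl fun u _ => ?_
    split_ifs with h
    · rw [hitProb_of_mem _ _ h]
    · rfl
  have e2 : ∑ u ∈ A, S.meanDeg a b s u = A.card * (m / n) := by
    rw [Finset.sum_congr rfl hmean, Finset.sum_const, nsmul_eq_mul]
  have h1 : ∑ u ∈ A, (S.meanDeg a b s u - S.hitProb (sbmProb a b s) u)
      ≤ ((a + b) + (a + b) ^ 2) * S.front.card * S.ball.card / n :=
    (Finset.sum_le_sum_of_subset_of_nonneg (Finset.subset_univ A) fun u _ _ =>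
      sub_nonneg.mpr (hitProb_le_meanDeg ha hb han hbn s S u)).trans
      (sum_meanDeg_sub_hitProb_le ha hb han hbn hn s S)
  have h0 : 0 ≤ ∑ u ∈ A, (S.meanDeg a b s u - S.hitProb (sbmProb a b s) u) :=
    Finset.sum_nonneg fun u _ => sub_nonneg.mpr (hitProb_le_meanDeg ha hb han hbn s S u)
  rw [Finset.sum_sub_distrib, e2] at h0 h1
  rw [e1]
  have h2 : |(A.card : ℝ) * (m / n) - m / 2|
      ≤ ((a + b) + (a + b) ^ 2) * S.front.card * |magnetization s| / n := by
    have e3 : (A.card : ℝ) * (m / n) - m / 2 = (A.card - n / 2) * m / n := by field_simp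
    rw [e3, abs_div, abs_mul, abs_of_pos hn', abs_of_nonneg hm0]
    have : m ≤ ((a + b) + (a + b) ^ 2) * S.front.card := hm.trans
      (mul_le_mul_of_nonneg_right (by linarith [sq_nonneg (a + b)]) (Nat.cast_nonneg _))
    calc _ ≤ |magnetization s| * (((a + b) + (a + b) ^ 2) * S.front.card) / n := by gcongr
      _ = _ := by ring
  rw [mul_add, add_div]
  have h3 := abs_le.mp h2
  rw [abs_le]
  constructor <;> linarith

lemma abs_card_filter_sub_le (s : Fin n → ℤˣ) (τ : ℤˣ) :
    |((Finset.univ.filter fun u => s u = τ).card : ℝ) - n / 2| ≤ |magnetization s| ∧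
    |((Finset.univ.filter fun u => ¬ s u = τ).card : ℝ) - n / 2| ≤ |magnetization s| := by
  have h1 := card_filter_spin s τ Finset.univ
  have h2 := card_filter_add s τ Finset.univ
  rw [Finset.card_univ, Fintype.card_fin] at h2
  have h3 : |magnetization s| = |((Finset.univ.filter fun u => s u = τ).card : ℝ)
      - (Finset.univ.filter fun u => ¬ s u = τ).card| := by
    rw [magnetization, h1, abs_mul]
    rcases Int.units_eq_one_or τ with h' | h' <;> simp [h']
  have h4 : ∀ x y : ℝ, |x - (x + y) / 2| ≤ |x - y| := fun x y => by
    rw [show x - (x + y) / 2 = (x - y) / 2 by ring, abs_div, abs_two]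
    linarith [abs_nonneg (x - y)]
  rw [h3, h2]
  refine ⟨h4 _ _, ?_⟩
  rw [add_comm, abs_sub_comm (((Finset.univ.filter fun u => s u = τ).card : ℕ) : ℝ)]
  exact h4 _ _

/-- One step of the exploration is close to one step of the Poisson tree process. -/
lemma abs_kernel_sub_treeOp_le (ha : 0 ≤ a) (hb : 0 ≤ b) (han : a ≤ n) (hbn : b ≤ n) (hn : 0 < n)
    (s : Fin n → ℤˣ) (τ : ℤˣ) {f : ℕ → ℕ → ℝ} {C : ℝ} (hf : ∀ k m, |f k m| ≤ C)
    (S : BfsState (Fin n)) :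
    |kernel (sbmProb a b s) (countFun s τ f) S - countFun s τ (treeOp a b f) S|
      ≤ C * (stepConst a b * S.front.card * (S.ball.card + |magnetization s|) / n) := by
  have hn' : (0 : ℝ) < n := by exact_mod_cast hn
  have hC : 0 ≤ C := (abs_nonneg _).trans (hf 0 0)
  set k := (S.front.filter fun u => s u = τ).card with hk
  set m := (S.front.filter fun u => ¬ s u = τ).card with hm
  have hkm : (S.front.card : ℝ) = k + m := card_filter_add s τ S.front
  have hk0 : (0 : ℝ) ≤ k := Nat.cast_nonneg _
  have hm0 : (0 : ℝ) ≤ m := Nat.cast_nonneg _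
  have hP := sbmProb_mem ha hb han hbn s
  have hp := S.hitProb_mem _ hP
  set W := Finset.univ.filter fun u => u ∉ S.ball with hW
  set π := S.hitProb (sbmProb a b s) with hπ
  have h1 := abs_bernEx_sub_poissonEx₂_le hp (fun u => s u = τ) W hf
  have e1 : kernel (sbmProb a b s) (countFun s τ f) S
      = bernEx π (fun y => f (W.filter fun u => s u = τ ∧ y u = true).card
        (W.filter fun u => ¬ s u = τ ∧ y u = true).card) := by
    have hQ : ∀ (Q : Fin n → Prop) [DecidablePred Q] (y : Fin n → Bool),
        (Finset.univ.filter fun u => (u ∉ S.ball ∧ y u = true) ∧ Q u)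
          = Finset.univ.filter fun u => u ∉ S.ball ∧ Q u ∧ y u = true := fun Q _ y =>
      Finset.filter_congr fun u _ => by tauto
    simp only [kernel, countFun, next, hW, Finset.filter_filter]
    congr 1
    ext y
    rw [hQ, hQ]
  have hfb := S.front_card_le_ball
  have hf0 : (0 : ℝ) ≤ S.front.card := Nat.cast_nonneg _
  set R := ((a + b) + (a + b) ^ 2) * S.front.card * (S.ball.card + |magnetization s|) / n with hR
  have h2 : ∑ u ∈ W, π u ^ 2
      ≤ (a + b) ^ 2 * S.front.card * (S.ball.card + |magnetization s|) / n := by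
    calc ∑ u ∈ W, π u ^ 2 ≤ ∑ _u ∈ W, ((a + b) * S.front.card / n) ^ 2 := by
          refine Finset.sum_le_sum fun u _ => ?_
          have := (hitProb_le_meanDeg ha hb han hbn s S u).trans (meanDeg_le ha hb s S u)
          have h0 := (hp u).1
          gcongr
      _ ≤ n * ((a + b) * S.front.card / n) ^ 2 := by
          rw [Finset.sum_const, nsmul_eq_mul]
          have : (W.card : ℝ) ≤ n := by
            have := Finset.card_le_univ W
            rw [Fintype.card_fin] at this
            exact_mod_cast this
          gcongr
      _ = (a + b) ^ 2 * S.front.card * S.front.card / n := by field_simp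
      _ ≤ _ := by
          gcongr
          linarith [abs_nonneg (magnetization s)]
  obtain ⟨c1, c2⟩ := abs_card_filter_sub_le s τ
  have h3 := abs_sum_hitProb_sub_le ha hb han hbn hn s S _ (a * k + b * m) c1 (by positivity)
    (by rw [hkm]; nlinarith) (fun u hu => by
      rw [meanDeg_eq a b s τ, if_pos (Finset.mem_filter.mp hu).2])
  have h4 := abs_sum_hitProb_sub_le ha hb han hbn hn s S _ (a * m + b * k) c2 (by positivity)
    (by rw [hkm]; nlinarith) (fun u hu => by
      rw [meanDeg_eq a b s τ, if_neg (Finset.mem_filter.mp hu).2])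
  have e3 : ((Finset.univ.filter fun u => s u = τ).filter fun u => u ∉ S.ball)
      = W.filter fun u => s u = τ := Finset.filter_comm _ _ _
  have e4 : ((Finset.univ.filter fun u => ¬ s u = τ).filter fun u => u ∉ S.ball)
      = W.filter fun u => ¬ s u = τ := Finset.filter_comm _ _ _
  rw [e3] at h3
  rw [e4] at h4
  -- Le Cam's inequality produced Poisson variables with the actual total hitting probabilities as
  -- means; these are now moved to the means of the tree.
  have h5 := abs_poissonEx₂_sub_le hf (r := ∑ u ∈ W with s u = τ, π u)
    (r' := ∑ u ∈ W with ¬ s u = τ, π u) (t := a / 2 * k + b / 2 * m) (t' := a / 2 * m + b / 2 * k)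
    (Finset.sum_nonneg fun u _ => (hp u).1) (Finset.sum_nonneg fun u _ => (hp u).1)
    (by positivity) (by positivity)
  have e5 : countFun s τ (treeOp a b f) S
      = poissonEx₂ (a / 2 * k + b / 2 * m) (a / 2 * m + b / 2 * k) f := rfl
  rw [e1, e5]
  refine (abs_sub_le _ _ _).trans ((add_le_add h1 h5).trans ?_)
  rw [show (a * k + b * m) / 2 = a / 2 * k + b / 2 * m by ring] at h3
  rw [show (a * m + b * k) / 2 = a / 2 * m + b / 2 * k by ring] at h4
  calc _ ≤ 4 * C * ((a + b) ^ 2 * S.front.card * (S.ball.card + |magnetization s|) / n)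
        + 2 * C * (R + R) := by gcongr
    _ ≤ _ := by
      rw [hR, stepConst]
      have : 0 ≤ C * ((a + b) * S.front.card * (S.ball.card + |magnetization s|) / n) := by
        positivity
      have e : C * ((8 * (a + b) + 8 * (a + b) ^ 2) * S.front.card
            * (S.ball.card + |magnetization s|) / n)
          - (4 * C * ((a + b) ^ 2 * S.front.card * (S.ball.card + |magnetization s|) / n)
            + 2 * C * (((a + b) + (a + b) ^ 2) * S.front.card
              * (S.ball.card + |magnetization s|) / n
              + ((a + b) + (a + b) ^ 2) * S.front.card
              * (S.ball.card + |magnetization s|) / n))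
          = 4 * (C * ((a + b) * S.front.card * (S.ball.card + |magnetization s|) / n)) := by ring
      linarith

/-- Growth rate of the second moment of the size of the explored set. -/
def ballConst (a b : ℝ) : ℝ := (1 + (a + b)) ^ 2 + (a + b)

lemma growth_le (ha : 0 ≤ a) (hb : 0 ≤ b) (hn : 0 < n) (s : Fin n → ℤˣ) :
    growth a b s ≤ a + b := by
  have hn' : (0 : ℝ) < n := by exact_mod_cast hn
  have h : |magnetization s| ≤ n := by
    refine (Finset.abs_sum_le_sum_abs _ _).trans ?_
    simp [abs_spin]
  have : |magnetization s| / n ≤ 1 := by rwa [div_le_one hn']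
  rw [growth]
  nlinarith

/-- The new frontier has first and second moments controlled by the present ball, so this functional
closes on itself. The rate is crude, but at fixed depth any constant independent of `n` will do. -/
lemma kernel_ball_sq_le (ha : 0 ≤ a) (hb : 0 ≤ b) (han : a ≤ n) (hbn : b ≤ n) (hn : 0 < n)
    (s : Fin n → ℤˣ) (S : BfsState (Fin n)) :
    kernel (sbmProb a b s) (fun S => (S.ball.card : ℝ) ^ 2) S
      ≤ ballConst a b * (S.ball.card : ℝ) ^ 2 := by
  have hb1 : ∀ y, ((S.next y).ball.card : ℝ) ^ 2
      = (S.ball.card : ℝ) ^ 2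
        + (2 * S.ball.card * ((S.next y).front.card : ℝ) + ((S.next y).front.card : ℝ) ^ 2) := by
    intro y
    have : ((S.next y).ball.card : ℝ) = S.ball.card + (S.next y).front.card := by
      rw [ball, Finset.card_union_of_disjoint (S.next y).disj]
      push_cast
      rfl
    rw [this]; ring
  simp only [kernel, hb1]
  rw [bernEx_add, bernEx_add, bernEx_const, bernEx_const_mul]
  have h1 := kernel_card_le ha hb han hbn hn s S
  have h2 := kernel_card_sq_le ha hb han hbn hn s S
  simp only [kernel] at h1 h2
  have hg := growth_le ha hb hn s
  have hg0 := growth_nonneg ha hb s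
  have hfb := S.front_card_le_ball
  have hf0 : (0 : ℝ) ≤ S.front.card := Nat.cast_nonneg _
  have hB0 : (0 : ℝ) ≤ S.ball.card := Nat.cast_nonneg _
  have h3 : growth a b s * S.front.card ≤ (a + b) * S.ball.card := by gcongr
  have h4 : (0 : ℝ) ≤ growth a b s * S.front.card := by positivity
  have h5 : (S.ball.card : ℝ) ≤ (S.ball.card : ℝ) ^ 2 := by
    exact_mod_cast Nat.le_self_pow two_ne_zero _
  calc _ ≤ (S.ball.card : ℝ) ^ 2 + (2 * S.ball.card * ((a + b) * S.ball.card)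
        + (((a + b) * S.ball.card) ^ 2 + (a + b) * (S.ball.card : ℝ) ^ 2)) := by
        gcongr
        · exact h1.trans h3
        · refine h2.trans ?_
          gcongr
          exact hfb.trans h5
    _ = _ := by rw [ballConst]; ring

/-- Iterated comparison of the exploration with the Poisson tree process. -/
lemma abs_kernel_iterate_sub_treeOp_le (ha : 0 ≤ a) (hb : 0 ≤ b) (han : a ≤ n) (hbn : b ≤ n)
    (hn : 0 < n) {s : Fin n → ℤˣ} (hs : BalancedSpins s) (τ : ℤˣ) {f : ℕ → ℕ → ℝ} {C : ℝ}
    (hf : ∀ k m, |f k m| ≤ C) (t : ℕ) (S : BfsState (Fin n)) :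
    |(kernel (sbmProb a b s))^[t] (countFun s τ f) S - countFun s τ ((treeOp a b)^[t] f) S|
      ≤ C * (2 * stepConst a b) * (n : ℝ) ^ (-(1 / 3) : ℝ) * (t * ballConst a b ^ t)
        * (S.ball.card : ℝ) ^ 2 := by
  have hn' : (0 : ℝ) < n := by exact_mod_cast hn
  have hC : 0 ≤ C := (abs_nonneg _).trans (hf 0 0)
  have hP := sbmProb_mem ha hb han hbn s
  have hst := stepConst_nonneg ha hb
  have hbc : 1 ≤ ballConst a b := by rw [ballConst]; nlinarith
  set η := (n : ℝ) ^ (-(1 / 3) : ℝ) with hη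
  have hη0 : 0 ≤ η := by positivity
  have hMη : |magnetization s| / n ≤ η := by
    rw [div_le_iff₀ hn']
    refine (show |magnetization s| ≤ (n : ℝ) ^ (2 / 3 : ℝ) from hs).trans (le_of_eq ?_)
    rw [hη]
    nth_rewrite 3 [← Real.rpow_one (n : ℝ)]
    rw [← Real.rpow_add hn']
    norm_num
  have hnη : 1 / (n : ℝ) ≤ η := by
    rw [hη, one_div, ← Real.rpow_neg_one]
    apply Real.rpow_le_rpow_of_exponent_le
    · exact_mod_cast hn
    · norm_num
  induction t generalizing S with
  | zero => simp
  | succ t ih =>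
    rw [Function.iterate_succ_apply', Function.iterate_succ_apply']
    -- The error after `t` steps is carried through one more transition, which multiplies the
    -- squared ball size by at most `ballConst`; a fresh one-step error is then added.
    have h1 : |kernel (sbmProb a b s) ((kernel (sbmProb a b s))^[t] (countFun s τ f)) S
        - kernel (sbmProb a b s) (countFun s τ ((treeOp a b)^[t] f)) S|
        ≤ C * (2 * stepConst a b) * η * (t * ballConst a b ^ t)
          * (ballConst a b * (S.ball.card : ℝ) ^ 2) := by
      rw [← kernel_sub]
      refine (abs_kernel_le hP _ S).trans ((kernel_mono hP ih S).trans ?_)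
      rw [kernel_const_mul]
      have := kernel_ball_sq_le ha hb han hbn hn s S
      gcongr
    have h2 := abs_kernel_sub_treeOp_le ha hb han hbn hn s τ
      (abs_treeOp_iterate_le (a := a) (b := b) hf t) S
    have h3 : stepConst a b * S.front.card * (S.ball.card + |magnetization s|) / n
        ≤ 2 * stepConst a b * η * (S.ball.card : ℝ) ^ 2 := by
      have hfb := S.front_card_le_ball
      have hB0 : (0 : ℝ) ≤ S.ball.card := Nat.cast_nonneg _
      have h5 : (S.ball.card : ℝ) ≤ (S.ball.card : ℝ) ^ 2 := by
        exact_mod_cast Nat.le_self_pow two_ne_zero _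
      have e : stepConst a b * S.front.card * (S.ball.card + |magnetization s|) / n
          = stepConst a b * S.front.card * (S.ball.card * (1 / n) + |magnetization s| / n) := by
        ring
      rw [e]
      calc _ ≤ stepConst a b * S.ball.card * (S.ball.card * η + η) := by gcongr
        _ = stepConst a b * η * ((S.ball.card : ℝ) ^ 2 + S.ball.card) := by ring
        _ ≤ stepConst a b * η * ((S.ball.card : ℝ) ^ 2 + (S.ball.card : ℝ) ^ 2) := by gcongr
        _ = _ := by ring
    refine (abs_sub_le _ _ _).trans ((add_le_add h1 h2).trans ?_)
    -- The extra power of `ballConst`, at least one, puts the fresh error on the same scale, so that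
    -- `t` errors simply become `t + 1`.
    have h4 : C * (stepConst a b * S.front.card * (S.ball.card + |magnetization s|) / n)
        ≤ C * (2 * stepConst a b * η * (S.ball.card : ℝ) ^ 2) * ballConst a b ^ (t + 1) := by
      refine le_trans ?_ (le_mul_of_one_le_right (by positivity) (one_le_pow₀ hbc))
      gcongr
    refine (add_le_add le_rfl h4).trans (le_of_eq ?_)
    push_cast
    ring

end BfsState

end Compare

/-! ### The limit of the two-type Poisson tree process -/

/-- Cauchy–Schwarz applied to the telescoping sum with weights `ρ ^ k`. It yields a geometric rate
from second moments of increments alone, without orthogonality. It serves pointwise on the tree and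
under expectation on the graph. -/
lemma sq_sub_le_geometric (x : ℕ → ℝ) {ρ : ℝ} (hρ : 0 < ρ) (hρ1 : ρ < 1) {r t : ℕ} (h : r ≤ t) :
    (x t - x r) ^ 2
      ≤ ρ ^ r / (1 - ρ) * ∑ k ∈ Finset.Ico r t, (ρ ^ k)⁻¹ * (x (k + 1) - x k) ^ 2 := by
  rw [← Finset.sum_Ico_sub x h]
  have h1 := Finset.sum_sq_le_sum_mul_sum_of_sq_le_mul (Finset.Ico r t)
    (r := fun k => x (k + 1) - x k) (f := fun k => ρ ^ k)
    (g := fun k => (ρ ^ k)⁻¹ * (x (k + 1) - x k) ^ 2) (fun k _ => by positivity)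
    (fun k _ => by positivity) (fun k _ => by field_simp; rfl)
  refine h1.trans ?_
  have h2 : ∑ k ∈ Finset.Ico r t, ρ ^ k ≤ ρ ^ r / (1 - ρ) :=
    geom_sum_Ico_le_of_lt_one hρ.le hρ1
  gcongr

lemma integral_poisson_sub_sq {r : ℝ} (hr : 0 ≤ r) (x : ℝ) :
    Integrable (fun k : ℕ => ((k : ℝ) - x) ^ 2) (poissonMeasure r.toNNReal) ∧
      ∫ k : ℕ, ((k : ℝ) - x) ^ 2 ∂poissonMeasure r.toNNReal = (r - x) ^ 2 + r := by
  have h1 := integrable_poisson_mean r.toNNReal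
  have h2 := integrable_poisson_factorial_moment r.toNNReal
  have e : (fun k : ℕ => ((k : ℝ) - x) ^ 2)
      = fun k : ℕ => (k : ℝ) * (k - 1) + ((1 - 2 * x) * (k : ℝ) + x ^ 2) := by ext; ring
  have m1 := poissonEx_mean hr
  have m2 := poissonEx_factorial_moment hr
  rw [poissonEx] at m1 m2
  have h3 : Integrable (fun k : ℕ => (1 - 2 * x) * (k : ℝ) + x ^ 2) (poissonMeasure r.toNNReal) :=
    (h1.const_mul _).add (integrable_const _)
  rw [e]
  refine ⟨h2.add h3, ?_⟩
  rw [integral_add h2 h3, integral_add (h1.const_mul _) (integrable_const _), integral_const_mul,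
    m1, m2]
  simp
  ring

/-- The additive constant lets the formula be used twice in a row: the inner Poisson integral leaves
its variance as the constant for the outer one. -/
lemma lintegral_poisson_sub_sq {r : ℝ} (hr : 0 ≤ r) (x c : ℝ) (hc : 0 ≤ c) :
    ∫⁻ k : ℕ, ENNReal.ofReal (((k : ℝ) - x) ^ 2 + c) ∂poissonMeasure r.toNNReal
      = ENNReal.ofReal ((r - x) ^ 2 + r + c) := by
  obtain ⟨h1, h2⟩ := integral_poisson_sub_sq hr x
  have h3 : Integrable (fun k : ℕ => ((k : ℝ) - x) ^ 2 + c) (poissonMeasure r.toNNReal) :=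
    h1.add (integrable_const _)
  rw [← ofReal_integral_eq_lintegral_ofReal h3 (Eventually.of_forall fun k => by positivity),
    integral_add h1 (integrable_const _), h2]
  simp

lemma lintegral_poisson_mean {r : ℝ} (hr : 0 ≤ r) (c : ℝ) (hc : 0 ≤ c) :
    ∫⁻ k : ℕ, ENNReal.ofReal ((k : ℝ) + c) ∂poissonMeasure r.toNNReal
      = ENNReal.ofReal (r + c) := by
  have h1 := integrable_poisson_mean r.toNNReal
  have h3 : Integrable (fun k : ℕ => (k : ℝ) + c) (poissonMeasure r.toNNReal) :=
    h1.add (integrable_const _)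
  rw [← ofReal_integral_eq_lintegral_ofReal h3 (Eventually.of_forall fun k => by positivity),
    integral_add h1 (integrable_const _),
    show ∫ k : ℕ, (k : ℝ) ∂poissonMeasure r.toNNReal = r from poissonEx_mean hr]
  simp

/-- The transition kernel of the two-type Poisson tree process. -/
def treeKernel (a b : ℝ) : Kernel (ℕ × ℕ) (ℕ × ℕ) where
  toFun x := (poissonMeasure (a / 2 * x.1 + b / 2 * x.2).toNNReal).prod
    (poissonMeasure (a / 2 * x.2 + b / 2 * x.1).toNNReal)
  measurable' := Measurable.of_discrete

instance (a b : ℝ) : IsMarkovKernel (treeKernel a b) :=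
  ⟨fun x => by
    change IsProbabilityMeasure ((poissonMeasure _).prod (poissonMeasure _))
    infer_instance⟩

section Tree

variable {a b : ℝ} {Ω : Type*} [MeasurableSpace Ω] {μ : Measure Ω} [IsProbabilityMeasure μ]
  {Vp Vm : ℕ → Ω → ℕ}

namespace IsPoissonTreeProcess

lemma measurable_pair (hV : IsPoissonTreeProcess a b μ Vp Vm) (t : ℕ) :
    Measurable fun ω => (Vp t ω, Vm t ω) := (hV.measurable_plus t).prodMk (hV.measurable_minus t)

lemma treeHistory_le (hV : IsPoissonTreeProcess a b μ Vp Vm) (t : ℕ) :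
    treeHistory Vp Vm t ≤ ‹MeasurableSpace Ω› :=
  iSup₂_le fun k _ => sup_le (hV.measurable_plus k).comap_le (hV.measurable_minus k).comap_le

/-- The joint law of two successive generations. -/
lemma map_pair (hV : IsPoissonTreeProcess a b μ Vp Vm) (t : ℕ) :
    μ.map (fun ω => ((Vp t ω, Vm t ω), (Vp (t + 1) ω, Vm (t + 1) ω)))
      = (μ.map fun ω => (Vp t ω, Vm t ω)) ⊗ₘ treeKernel a b := by
  have hm := (hV.measurable_pair t).prodMk (hV.measurable_pair (t + 1))
  refine Measure.ext_of_singleton ?_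
  rintro ⟨⟨k, m⟩, ⟨k', m'⟩⟩
  rw [Measure.map_apply hm (measurableSet_singleton _), ← Set.singleton_prod_singleton,
    Measure.compProd_apply_prod (measurableSet_singleton _) (measurableSet_singleton _),
    Measure.restrict_singleton, lintegral_smul_measure, lintegral_dirac,
    Measure.map_apply (hV.measurable_pair t) (measurableSet_singleton _)]
  set A : Set Ω := (fun ω => (Vp t ω, Vm t ω)) ⁻¹' {(k, m)} with hA
  set B : Set Ω := {ω | Vp (t + 1) ω = k' ∧ Vm (t + 1) ω = m'} with hB
  have hBm : MeasurableSet B := by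
    have : B = (fun ω => (Vp (t + 1) ω, Vm (t + 1) ω)) ⁻¹' {(k', m')} := by
      ext ω; simp [hB]
    rw [this]
    exact hV.measurable_pair (t + 1) (measurableSet_singleton _)
  have hAh : MeasurableSet[treeHistory Vp Vm t] A := by
    have : A = Vp t ⁻¹' {k} ∩ Vm t ⁻¹' {m} := by ext ω; simp [hA]
    rw [this]
    have hle : MeasurableSpace.comap (Vp t) ⊤ ⊔ MeasurableSpace.comap (Vm t) ⊤
        ≤ treeHistory Vp Vm t :=
      le_iSup₂ (f := fun k (_ : k ≤ t) =>
        MeasurableSpace.comap (Vp k) ⊤ ⊔ MeasurableSpace.comap (Vm k) ⊤) t le_rfl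
    refine MeasurableSet.inter (hle _ ?_) (hle _ ?_)
    · exact (le_sup_left : MeasurableSpace.comap (Vp t) ⊤ ≤ _) _ ⟨{k}, trivial, rfl⟩
    · exact (le_sup_right : MeasurableSpace.comap (Vm t) ⊤ ≤ _) _ ⟨{m}, trivial, rfl⟩
  have hle := hV.treeHistory_le t
  -- On the event `A` the conditional probability is a constant, so integrating the conditional law
  -- over `A` gives the mass of the joint atom.
  have h1 := setIntegral_condExp (μ := μ) hle
    ((integrable_const (1 : ℝ)).indicator hBm) hAh
  rw [setIntegral_congr_ae (hle _ hAh) (g := fun _ =>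
      (poissonMeasure (a / 2 * k + b / 2 * m).toNNReal).real {k'} *
      (poissonMeasure (a / 2 * m + b / 2 * k).toNNReal).real {m'})] at h1
  · rw [setIntegral_const, setIntegral_indicator hBm, setIntegral_const] at h1
    simp only [smul_eq_mul, mul_one] at h1
    have e1 : (fun ω => ((Vp t ω, Vm t ω), (Vp (t + 1) ω, Vm (t + 1) ω))) ⁻¹'
        ({(k, m)} ×ˢ {(k', m')}) = A ∩ B := by
      ext ω; simp [hA, hB]
    have e2 : treeKernel a b (k, m) {(k', m')}
        = poissonMeasure (a / 2 * k + b / 2 * m).toNNReal {k'} *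
          poissonMeasure (a / 2 * m + b / 2 * k).toNNReal {m'} := by
      rw [← Set.singleton_prod_singleton]
      exact Measure.prod_prod _ _
    rw [e1, e2, smul_eq_mul]
    rw [← ENNReal.toReal_eq_toReal_iff' (measure_ne_top _ _) (by finiteness)]
    rw [ENNReal.toReal_mul, ENNReal.toReal_mul]
    exact h1.symm
  · filter_upwards [hV.condLaw t k' m'] with ω hω hωA
    rw [hω]
    have : Vp t ω = k ∧ Vm t ω = m := by simpa [hA] using hωA
    rw [this.1, this.2]

/-- For nonnegative functions no integrability is needed, so unbounded moments can be computed
before they are known to be finite. -/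
lemma lintegral_pair (hV : IsPoissonTreeProcess a b μ Vp Vm) (t : ℕ)
    (F : ℕ × ℕ → ℕ × ℕ → ENNReal) :
    ∫⁻ ω, F (Vp t ω, Vm t ω) (Vp (t + 1) ω, Vm (t + 1) ω) ∂μ
      = ∫⁻ ω, (∫⁻ j, ∫⁻ k, F (Vp t ω, Vm t ω) (j, k)
          ∂poissonMeasure (a / 2 * Vm t ω + b / 2 * Vp t ω).toNNReal
          ∂poissonMeasure (a / 2 * Vp t ω + b / 2 * Vm t ω).toNNReal) ∂μ := by
  have hm := (hV.measurable_pair t).prodMk (hV.measurable_pair (t + 1))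
  have h1 : ∫⁻ ω, F (Vp t ω, Vm t ω) (Vp (t + 1) ω, Vm (t + 1) ω) ∂μ
      = ∫⁻ y, F y.1 y.2 ∂μ.map (fun ω => ((Vp t ω, Vm t ω), (Vp (t + 1) ω, Vm (t + 1) ω))) :=
    (lintegral_map (f := fun y : (ℕ × ℕ) × (ℕ × ℕ) => F y.1 y.2) Measurable.of_discrete hm).symm
  rw [h1, hV.map_pair, Measure.lintegral_compProd Measurable.of_discrete,
    lintegral_map Measurable.of_discrete (hV.measurable_pair t)]
  refine lintegral_congr fun ω => ?_
  exact lintegral_prod _ Measurable.of_discrete.aemeasurable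

lemma integral_succ (hV : IsPoissonTreeProcess a b μ Vp Vm) (t : ℕ) {f : ℕ → ℕ → ℝ} {C : ℝ}
    (hf : ∀ j k, |f j k| ≤ C) :
    ∫ ω, f (Vp (t + 1) ω) (Vm (t + 1) ω) ∂μ = ∫ ω, treeOp a b f (Vp t ω) (Vm t ω) ∂μ := by
  have hm := (hV.measurable_pair t).prodMk (hV.measurable_pair (t + 1))
  have h1 : ∫ ω, f (Vp (t + 1) ω) (Vm (t + 1) ω) ∂μ
      = ∫ y, f y.2.1 y.2.2
        ∂μ.map (fun ω => ((Vp t ω, Vm t ω), (Vp (t + 1) ω, Vm (t + 1) ω))) :=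
    (integral_map (f := fun y : (ℕ × ℕ) × (ℕ × ℕ) => f y.2.1 y.2.2) hm.aemeasurable
      Measurable.of_discrete.aestronglyMeasurable).symm
  have : IsProbabilityMeasure (μ.map fun ω => (Vp t ω, Vm t ω)) :=
    Measure.isProbabilityMeasure_map (hV.measurable_pair t).aemeasurable
  rw [h1, hV.map_pair, Measure.integral_compProd (integrable_of_abs_le fun y => hf _ _),
    integral_map (hV.measurable_pair t).aemeasurable Measurable.of_discrete.aestronglyMeasurable]
  refine integral_congr_ae (Eventually.of_forall fun ω => ?_)
  exact integral_prod _ (integrable_of_abs_le fun y => hf _ _)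

/-- Expectations along the tree process are given by the iterated transition operator. -/
lemma integral_eq_iterate (hV : IsPoissonTreeProcess a b μ Vp Vm) (t : ℕ) {f : ℕ → ℕ → ℝ} {C : ℝ}
    (hf : ∀ j k, |f j k| ≤ C) :
    ∫ ω, f (Vp t ω) (Vm t ω) ∂μ = (treeOp a b)^[t] f 1 0 := by
  induction t generalizing f with
  | zero =>
    have : ∫ ω, f (Vp 0 ω) (Vm 0 ω) ∂μ = ∫ _, f 1 0 ∂μ := by
      refine integral_congr_ae ?_
      filter_upwards [hV.zero_plus, hV.zero_minus] with ω h1 h2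
      rw [h1, h2]
    rw [this]
    simp
  | succ t ih =>
    rw [hV.integral_succ t hf, ih (f := treeOp a b f) fun j k => abs_poissonEx₂_le hf _ _,
      Function.iterate_succ_apply]

/-- The two Poisson means in a generation add up to `(a + b) / 2` times the present total
population. -/
lemma lintegral_size (hV : IsPoissonTreeProcess a b μ Vp Vm) (ha : 0 ≤ a) (hb : 0 ≤ b) (t : ℕ) :
    ∫⁻ ω, ENNReal.ofReal (Vp t ω + Vm t ω) ∂μ = ENNReal.ofReal (((a + b) / 2) ^ t) := by
  induction t with
  | zero =>
    have : ∫⁻ ω, ENNReal.ofReal (Vp 0 ω + Vm 0 ω) ∂μ = ∫⁻ _, 1 ∂μ := by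
      refine lintegral_congr_ae ?_
      filter_upwards [hV.zero_plus, hV.zero_minus] with ω h1 h2
      rw [h1, h2]
      simp
    rw [this]
    simp
  | succ t ih =>
    rw [hV.lintegral_pair t fun _ y => ENNReal.ofReal (y.1 + y.2), pow_succ,
      ENNReal.ofReal_mul (by positivity), ← ih, ← lintegral_mul_const']
    · refine lintegral_congr fun ω => ?_
      have : ∀ j : ℕ, ∫⁻ k : ℕ, ENNReal.ofReal ((j : ℝ) + k)
          ∂poissonMeasure (a / 2 * Vm t ω + b / 2 * Vp t ω).toNNReal
          = ENNReal.ofReal ((j : ℝ) + (a / 2 * Vm t ω + b / 2 * Vp t ω)) := fun j => by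
        simp_rw [add_comm (j : ℝ)]
        exact lintegral_poisson_mean (by positivity) _ (by positivity)
      simp only [this]
      rw [lintegral_poisson_mean (by positivity) _ (by positivity),
        ← ENNReal.ofReal_mul (by positivity)]
      congr 1
      ring
    · finiteness

/-- Given generation `t`, the next difference has mean `β (V⁺ - V⁻)`, and as a difference of
independent Poisson variables its variance is the sum of the means, `α (V⁺ + V⁻)`. The choice `c =
β` gives the martingale increment and `c = 0` the second moment. -/
lemma lintegral_sub_sq (hV : IsPoissonTreeProcess a b μ Vp Vm) (ha : 0 ≤ a) (hb : 0 ≤ b) (t : ℕ)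
    (c : ℝ) :
    ∫⁻ ω, ENNReal.ofReal (((Vp (t + 1) ω : ℝ) - Vm (t + 1) ω - c * (Vp t ω - Vm t ω)) ^ 2) ∂μ
      = ∫⁻ ω, ENNReal.ofReal ((((a - b) / 2 - c) * (Vp t ω - Vm t ω)) ^ 2
          + (a + b) / 2 * (Vp t ω + Vm t ω)) ∂μ := by
  rw [hV.lintegral_pair t fun x y =>
    ENNReal.ofReal (((y.1 : ℝ) - y.2 - c * ((x.1 : ℝ) - x.2)) ^ 2)]
  refine lintegral_congr fun ω => ?_
  set u : ℝ := (Vp t ω : ℝ) with hu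
  set v : ℝ := (Vm t ω : ℝ) with hv
  have hu0 : 0 ≤ u := Nat.cast_nonneg _
  have hv0 : 0 ≤ v := Nat.cast_nonneg _
  have : ∀ j : ℕ, ∫⁻ k : ℕ, ENNReal.ofReal (((j : ℝ) - k - c * (u - v)) ^ 2)
      ∂poissonMeasure (a / 2 * v + b / 2 * u).toNNReal
      = ENNReal.ofReal (((j : ℝ) - (a / 2 * v + b / 2 * u + c * (u - v))) ^ 2
        + (a / 2 * v + b / 2 * u)) := fun j => by
    have h := lintegral_poisson_sub_sq (r := a / 2 * v + b / 2 * u) (by positivity)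
      ((j : ℝ) - c * (u - v)) 0 le_rfl
    simp only [add_zero] at h
    have e : ∀ k : ℕ, ((j : ℝ) - k - c * (u - v)) ^ 2 = ((k : ℝ) - (j - c * (u - v))) ^ 2 :=
      fun k => by ring
    simp only [e]
    rw [h]
    congr 1
    ring
  simp only [this]
  rw [lintegral_poisson_sub_sq (by positivity) _ _ (by positivity)]
  congr 1
  ring

/-- Second moment of the martingale increments. -/
lemma lintegral_increment (hV : IsPoissonTreeProcess a b μ Vp Vm) (ha : 0 ≤ a) (hb : 0 ≤ b)
    (t : ℕ) :
    ∫⁻ ω, ENNReal.ofReal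
        (((Vp (t + 1) ω : ℝ) - Vm (t + 1) ω - (a - b) / 2 * (Vp t ω - Vm t ω)) ^ 2) ∂μ
      = ENNReal.ofReal (((a + b) / 2) ^ (t + 1)) := by
  rw [hV.lintegral_sub_sq ha hb]
  simp only [sub_self, zero_mul, ne_eq, OfNat.ofNat_ne_zero, not_false_eq_true, zero_pow, zero_add]
  rw [pow_succ', ENNReal.ofReal_mul (by positivity), ← hV.lintegral_size ha hb t,
    ← lintegral_const_mul']
  · exact lintegral_congr fun ω => ENNReal.ofReal_mul (by positivity)
  · finiteness

/-- Only the squared mean of each step is kept and its variance dropped. After normalization the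
second moment is at least one in every generation, which prevents a degenerate limit. -/
lemma le_lintegral_sq (hV : IsPoissonTreeProcess a b μ Vp Vm) (ha : 0 ≤ a) (hb : 0 ≤ b) (t : ℕ) :
    ENNReal.ofReal (((a - b) / 2) ^ (2 * t))
      ≤ ∫⁻ ω, ENNReal.ofReal (((Vp t ω : ℝ) - Vm t ω) ^ 2) ∂μ := by
  induction t with
  | zero =>
    have : ∫⁻ ω, ENNReal.ofReal (((Vp 0 ω : ℝ) - Vm 0 ω) ^ 2) ∂μ = ∫⁻ _, 1 ∂μ := by
      refine lintegral_congr_ae ?_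
      filter_upwards [hV.zero_plus, hV.zero_minus] with ω h1 h2
      rw [h1, h2]
      simp
    rw [this]
    simp
  | succ t ih =>
    have h := hV.lintegral_sub_sq ha hb t 0
    simp only [zero_mul, sub_zero] at h
    rw [h, show 2 * (t + 1) = 2 + 2 * t by ring, pow_add, ENNReal.ofReal_mul (sq_nonneg _)]
    refine (mul_le_mul_right ih _).trans ?_
    rw [← lintegral_const_mul' _ _ (by finiteness)]
    refine lintegral_mono fun ω => ?_
    rw [← ENNReal.ofReal_mul (sq_nonneg _)]
    apply ENNReal.ofReal_le_ofReal
    have : 0 ≤ (a + b) / 2 * ((Vp t ω : ℝ) + Vm t ω) := by positivity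
    rw [mul_pow]
    linarith

end IsPoissonTreeProcess

end Tree

/-- Nonnegativity of `a` and `b` gives `|β| ≤ α`, hence `α < β ^ 2 ≤ α ^ 2`. -/
lemma one_lt_of_lt_sq {a b : ℝ} (ha : 0 ≤ a) (hb : 0 ≤ b)
    (h : (a + b) / 2 < ((a - b) / 2) ^ 2) : 1 < (a + b) / 2 := by
  have h1 := BfsState.abs_half_sub_le ha hb
  have h2 : ((a - b) / 2) ^ 2 ≤ ((a + b) / 2) ^ 2 := by rw [← sq_abs]; gcongr
  nlinarith

lemma sq_pos_of_lt_sq {a b : ℝ} (ha : 0 ≤ a) (hb : 0 ≤ b)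
    (h : (a + b) / 2 < ((a - b) / 2) ^ 2) : 0 < ((a - b) / 2) ^ 2 := by
  have := one_lt_of_lt_sq ha hb h
  linarith

/-! ### Almost sure and mean-square limit of `Δ_t`. -/

section TreeLimit

variable {a b : ℝ} {Ω : Type*} [MeasurableSpace Ω] {μ : Measure Ω} [IsProbabilityMeasure μ]
  {Vp Vm : ℕ → Ω → ℕ}

namespace IsPoissonTreeProcess

lemma measurable_treeDelta (hV : IsPoissonTreeProcess a b μ Vp Vm) (β : ℝ) (t : ℕ) :
    Measurable (treeDelta β Vp Vm t) := by
  have h1 : Measurable fun ω => (Vp t ω : ℝ) :=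
    (Measurable.of_discrete (f := fun k : ℕ => (k : ℝ))).comp (hV.measurable_plus t)
  have h2 : Measurable fun ω => (Vm t ω : ℝ) :=
    (Measurable.of_discrete (f := fun k : ℕ => (k : ℝ))).comp (hV.measurable_minus t)
  exact (h1.sub h2).const_mul _

lemma lintegral_treeDelta_increment (hV : IsPoissonTreeProcess a b μ Vp Vm) (ha : 0 ≤ a)
    (hb : 0 ≤ b) (h : (a + b) / 2 < ((a - b) / 2) ^ 2) (t : ℕ) :
    ∫⁻ ω, ENNReal.ofReal ((treeDelta ((a - b) / 2) Vp Vm (t + 1) ω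
        - treeDelta ((a - b) / 2) Vp Vm t ω) ^ 2) ∂μ
      = ENNReal.ofReal (((a + b) / 2 / ((a - b) / 2) ^ 2) ^ (t + 1)) := by
  have hβ2 := sq_pos_of_lt_sq ha hb h
  set β := (a - b) / 2 with hβ
  have hβ0 : β ≠ 0 := fun h0 => by simp [h0] at hβ2
  have e : ∀ ω, (treeDelta β Vp Vm (t + 1) ω - treeDelta β Vp Vm t ω) ^ 2
      = ((β ^ (t + 1)) ^ 2)⁻¹ *
        ((Vp (t + 1) ω : ℝ) - Vm (t + 1) ω - β * (Vp t ω - Vm t ω)) ^ 2 := fun ω => by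
    rw [treeDelta, treeDelta, pow_succ]
    field_simp
    ring
  simp only [e]
  have h1 : ∀ ω, ENNReal.ofReal (((β ^ (t + 1)) ^ 2)⁻¹ *
        ((Vp (t + 1) ω : ℝ) - Vm (t + 1) ω - β * (Vp t ω - Vm t ω)) ^ 2)
      = ENNReal.ofReal (((β ^ (t + 1)) ^ 2)⁻¹) * ENNReal.ofReal
        (((Vp (t + 1) ω : ℝ) - Vm (t + 1) ω - β * (Vp t ω - Vm t ω)) ^ 2) := fun ω =>
    ENNReal.ofReal_mul (by positivity)
  simp only [h1]
  rw [lintegral_const_mul' _ _ (by finiteness), hV.lintegral_increment ha hb,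
    ← ENNReal.ofReal_mul (by positivity)]
  congr 1
  rw [div_pow ((a + b) / 2), ← pow_mul, ← pow_mul, mul_comm 2, inv_mul_eq_div]

/-- The normalized difference of the populations converges almost surely and in `L²`, to a
nondegenerate limit. -/
theorem treeDelta_limit (hV : IsPoissonTreeProcess a b μ Vp Vm) (ha : 0 ≤ a) (hb : 0 ≤ b)
    (h : (a + b) / 2 < ((a - b) / 2) ^ 2) :
    (∀ᵐ ω ∂μ, Tendsto (fun t => treeDelta ((a - b) / 2) Vp Vm t ω) atTop
      (𝓝 (treeDeltaLimit ((a - b) / 2) Vp Vm ω))) ∧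
    MemLp (treeDeltaLimit ((a - b) / 2) Vp Vm) 2 μ ∧
    (∀ r, MemLp (treeDelta ((a - b) / 2) Vp Vm r) 2 μ) ∧
    Tendsto (fun r => ∫ ω, (treeDelta ((a - b) / 2) Vp Vm r ω
      - treeDeltaLimit ((a - b) / 2) Vp Vm ω) ^ 2 ∂μ) atTop (𝓝 0) ∧
    0 < ∫ ω, treeDeltaLimit ((a - b) / 2) Vp Vm ω ^ 2 ∂μ := by
  have hα1 := one_lt_of_lt_sq ha hb h
  have hβ2 := sq_pos_of_lt_sq ha hb h
  have hinc := hV.lintegral_treeDelta_increment ha hb h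
  have hsq := hV.le_lintegral_sq ha hb
  set β := (a - b) / 2 with hβ
  have hβ0 : β ≠ 0 := fun h0 => by simp [h0] at hβ2
  set θ := (a + b) / 2 / β ^ 2 with hθ
  have hθ0 : 0 < θ := by positivity
  have hθ1 : θ < 1 := by rw [hθ, div_lt_one hβ2]; exact h
  -- Increments have second moments `θ ^ (t + 1)`. Dividing by `ρ ^ t` spends only half of the
  -- decay, so the weighted sum `W` still has finite mean, while the other half becomes the rate of
  -- convergence.
  set ρ := Real.sqrt θ with hρ
  have hρ0 : 0 < ρ := Real.sqrt_pos.mpr hθ0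
  have hρ1 : ρ < 1 := by rw [hρ, Real.sqrt_lt' one_pos]; simpa using hθ1
  have hρθ : ρ ^ 2 = θ := Real.sq_sqrt hθ0.le
  set Δ := treeDelta β Vp Vm with hΔ
  set Δi := treeDeltaLimit β Vp Vm with hΔi
  have hmeas : ∀ t, Measurable (Δ t) := hV.measurable_treeDelta β
  let w : ℕ → Ω → ENNReal := fun t ω =>
    ENNReal.ofReal ((ρ ^ t)⁻¹ * (Δ (t + 1) ω - Δ t ω) ^ 2)
  have hw : ∀ t, Measurable (w t) := fun t =>
    ((((hmeas (t + 1)).sub (hmeas t)).pow_const 2).const_mul _).ennreal_ofReal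
  let W : Ω → ENNReal := fun ω => ∑' t, w t ω
  have hWm : Measurable W := Measurable.tsum hw
  have hWint : ∫⁻ ω, W ω ∂μ ≠ ⊤ := by
    rw [lintegral_tsum fun t => (hw t).aemeasurable]
    have e : ∀ t, ∫⁻ ω, w t ω ∂μ = ENNReal.ofReal (θ * ρ ^ t) := fun t => by
      have : ∀ ω, w t ω = ENNReal.ofReal ((ρ ^ t)⁻¹)
          * ENNReal.ofReal ((Δ (t + 1) ω - Δ t ω) ^ 2) := fun ω =>
        ENNReal.ofReal_mul (by positivity)
      simp only [this]
      rw [lintegral_const_mul' _ _ (by finiteness), hinc, ← ENNReal.ofReal_mul (by positivity)]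
      congr 1
      rw [← hρθ]
      field_simp
      ring
    simp only [e]
    rw [← ENNReal.ofReal_tsum_of_nonneg (fun t => by positivity)
      ((summable_geometric_of_lt_one hρ0.le hρ1).mul_left θ)]
    finiteness
  let Z : Ω → ℝ := fun ω => (W ω).toReal
  have hZint : Integrable Z μ := integrable_toReal_of_lintegral_ne_top hWm.aemeasurable hWint
  have hZ0 : ∀ ω, 0 ≤ Z ω := fun ω => ENNReal.toReal_nonneg
  have hfin : ∀ᵐ ω ∂μ, W ω < ⊤ := ae_lt_top hWm hWint
  have hbound : ∀ ω, W ω < ⊤ → ∀ r t, r ≤ t →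
      (Δ t ω - Δ r ω) ^ 2 ≤ ρ ^ r / (1 - ρ) * Z ω := by
    intro ω hω r t hrt
    refine (sq_sub_le_geometric (fun t => Δ t ω) hρ0 hρ1 hrt).trans ?_
    have h1ρ : 0 < 1 - ρ := by linarith
    refine mul_le_mul_of_nonneg_left ?_ (by positivity)
    rw [← ENNReal.ofReal_le_iff_le_toReal hω.ne,
      ENNReal.ofReal_sum_of_nonneg fun k _ => by positivity]
    exact ENNReal.sum_le_tsum _
  have hρlim : Tendsto (fun r : ℕ => ρ ^ r / (1 - ρ)) atTop (𝓝 0) := by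
    simpa using (tendsto_pow_atTop_nhds_zero_of_lt_one hρ0.le hρ1).div_const (1 - ρ)
  have hconv : ∀ ω, W ω < ⊤ → Tendsto (fun t => Δ t ω) atTop (𝓝 (Δi ω)) := by
    intro ω hω
    apply tendsto_nhds_limUnder
    apply cauchySeq_tendsto_of_complete
    refine cauchySeq_of_le_tendsto_0' (fun r => Real.sqrt (ρ ^ r / (1 - ρ) * Z ω)) ?_ ?_
    · intro r t hrt
      rw [dist_comm, Real.dist_eq]
      exact Real.abs_le_sqrt (hbound ω hω r t hrt)
    · have := (hρlim.mul_const (Z ω)).sqrt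
      simpa using this
  have hlimbound : ∀ ω, W ω < ⊤ → ∀ r, (Δ r ω - Δi ω) ^ 2 ≤ ρ ^ r / (1 - ρ) * Z ω := by
    intro ω hω r
    have h1 : Tendsto (fun t => (Δ t ω - Δ r ω) ^ 2) atTop (𝓝 ((Δi ω - Δ r ω) ^ 2)) :=
      ((hconv ω hω).sub_const _).pow 2
    rw [show (Δ r ω - Δi ω) ^ 2 = (Δi ω - Δ r ω) ^ 2 by ring]
    refine le_of_tendsto h1 ?_
    filter_upwards [eventually_ge_atTop r] with t ht using hbound ω hω r t ht
  have hΔ0 : ∀ᵐ ω ∂μ, Δ 0 ω = 1 := by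
    filter_upwards [hV.zero_plus, hV.zero_minus] with ω h1 h2
    simp [hΔ, treeDelta, h1, h2]
  have hae : ∀ᵐ ω ∂μ, Tendsto (fun t => Δ t ω) atTop (𝓝 (Δi ω)) := hfin.mono hconv
  have hΔim : AEStronglyMeasurable Δi μ :=
    aestronglyMeasurable_of_tendsto_ae atTop (fun t => (hmeas t).aestronglyMeasurable) hae
  -- Comparison with generation zero, where `Δ` equals one: `Δ_r ^ 2 ≤ 2 (Δ_r - 1) ^ 2 + 2` with a
  -- bound independent of `r`.
  have hdom : Integrable (fun ω => 2 * (1 / (1 - ρ) * Z ω) + 2) μ :=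
    ((hZint.const_mul _).const_mul _).add (integrable_const _)
  have hΔr : ∀ r, MemLp (Δ r) 2 μ := by
    intro r
    rw [memLp_two_iff_integrable_sq (hmeas r).aestronglyMeasurable]
    refine hdom.mono' ((hmeas r).pow_const 2).aestronglyMeasurable ?_
    filter_upwards [hfin, hΔ0] with ω hω h0
    have := hbound ω hω 0 r (Nat.zero_le r)
    rw [h0, pow_zero] at this
    rw [Real.norm_of_nonneg (sq_nonneg _)]
    nlinarith [sq_nonneg (Δ r ω - 2)]
  have hΔi2 : MemLp Δi 2 μ := by
    rw [memLp_two_iff_integrable_sq hΔim]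
    refine hdom.mono' (hΔim.pow 2) ?_
    filter_upwards [hfin, hΔ0] with ω hω h0
    have := hlimbound ω hω 0
    rw [h0, pow_zero] at this
    rw [Real.norm_of_nonneg (sq_nonneg _)]
    nlinarith [sq_nonneg (Δi ω - 2)]
  have hL2 : Tendsto (fun r => ∫ ω, (Δ r ω - Δi ω) ^ 2 ∂μ) atTop (𝓝 0) := by
    have h1 : Tendsto (fun r => ρ ^ r / (1 - ρ) * ∫ ω, Z ω ∂μ) atTop (𝓝 0) := by
      simpa using hρlim.mul_const (∫ ω, Z ω ∂μ)
    refine squeeze_zero (fun r => integral_nonneg fun ω => sq_nonneg _) (fun r => ?_) h1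
    rw [← integral_const_mul]
    refine integral_mono_of_nonneg (Eventually.of_forall fun ω => sq_nonneg _)
      (hZint.const_mul _) ?_
    filter_upwards [hfin] with ω hω using hlimbound ω hω r
  refine ⟨hae, hΔi2, hΔr, hL2, ?_⟩
  have hone : ∀ r, 1 ≤ ∫ ω, Δ r ω ^ 2 ∂μ := by
    intro r
    have h1 : ENNReal.ofReal 1 ≤ ∫⁻ ω, ENNReal.ofReal (Δ r ω ^ 2) ∂μ := by
      have e : ∀ ω, ENNReal.ofReal (Δ r ω ^ 2) = ENNReal.ofReal (((β ^ r) ^ 2)⁻¹)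
          * ENNReal.ofReal (((Vp r ω : ℝ) - Vm r ω) ^ 2) := fun ω => by
        rw [← ENNReal.ofReal_mul (by positivity), hΔ, treeDelta, mul_pow, inv_pow]
      simp only [e]
      rw [lintegral_const_mul' _ _ (by finiteness)]
      refine le_trans (le_of_eq ?_) (mul_le_mul_right (hsq r) _)
      rw [← ENNReal.ofReal_mul (by positivity)]
      congr 1
      rw [mul_comm 2 r, pow_mul, inv_mul_cancel₀ (by positivity)]
    rw [← ofReal_integral_eq_lintegral_ofReal (hΔr r).integrable_sq
      (Eventually.of_forall fun ω => sq_nonneg _)] at h1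
    exact (ENNReal.ofReal_le_ofReal_iff (integral_nonneg fun ω => sq_nonneg _)).mp h1
  -- Once the squared distance is below `1/2`, the inequality `1 ≤ E Δ_r ^ 2 ≤ 2 E (Δ_r - Δ_∞) ^ 2 +
  -- 2 E Δ_∞ ^ 2` leaves `E Δ_∞ ^ 2` positive.
  obtain ⟨r, hr⟩ := (hL2.eventually_lt_const (by norm_num : (0 : ℝ) < 1 / 2)).exists
  have h2 : ∫ ω, Δ r ω ^ 2 ∂μ ≤ ∫ ω, (2 * (Δ r ω - Δi ω) ^ 2 + 2 * Δi ω ^ 2) ∂μ := by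
    refine integral_mono (hΔr r).integrable_sq
      ((((hΔr r).sub hΔi2).integrable_sq.const_mul 2).add (hΔi2.integrable_sq.const_mul 2)) ?_
    intro ω
    show Δ r ω ^ 2 ≤ 2 * (Δ r ω - Δi ω) ^ 2 + 2 * Δi ω ^ 2
    nlinarith [sq_nonneg (Δ r ω - 2 * Δi ω)]
  have hi : Integrable (fun ω => (Δ r ω - Δi ω) ^ 2) μ := ((hΔr r).sub hΔi2).integrable_sq
  have h3 : ∫ ω, (2 * (Δ r ω - Δi ω) ^ 2 + 2 * Δi ω ^ 2) ∂μ
      = 2 * ∫ ω, (Δ r ω - Δi ω) ^ 2 ∂μ + 2 * ∫ ω, Δi ω ^ 2 ∂μ := by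
    rw [integral_add (hi.const_mul 2) (hΔi2.integrable_sq.const_mul 2), integral_const_mul,
      integral_const_mul]
  have := hone r
  linarith

end IsPoissonTreeProcess

end TreeLimit

/-! ### Empirical means of functions of neighbourhoods of fixed depth -/

section FixedDepth

variable {n : ℕ} {a b : ℝ}

namespace BfsState

/-- The state of the exploration from `i` after `t` steps. -/
def bfs (x : Sym2 (Fin n) → Bool) (i : Fin n) (t : ℕ) : BfsState (Fin n) :=
  (step x)^[t] (root ∅ i (Finset.notMem_empty i))

lemma card_ball_root (R : Finset (Fin n)) (j : Fin n) (hj : j ∉ R) :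
    ((root R j hj).ball.card : ℝ) = R.card + 1 := by
  rw [ball, Finset.card_union_of_disjoint (root R j hj).disj]
  simp [root]

/-- Counting relative to the spin of the root makes every exploration start from `(1, 0)`, the
initial state of the tree; the spin itself returns as a sign in `countFun_truncFun`. -/
lemma countFun_root (s : Fin n → ℤˣ) (f : ℕ → ℕ → ℝ) (R : Finset (Fin n)) (j : Fin n)
    (hj : j ∉ R) : countFun s (s j) f (root R j hj) = f 1 0 := by
  simp [countFun, root, Finset.filter_singleton]

/-- Constant in the comparison at depth `r`. -/
def depthConst (a b : ℝ) (r : ℕ) : ℝ := 2 * stepConst a b * (r * ballConst a b ^ r)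

lemma one_le_ballConst (ha : 0 ≤ a) (hb : 0 ≤ b) : 1 ≤ ballConst a b := by
  rw [ballConst]; nlinarith

lemma depthConst_nonneg (ha : 0 ≤ a) (hb : 0 ≤ b) (r : ℕ) : 0 ≤ depthConst a b r := by
  have := one_le_ballConst ha hb
  have := stepConst_nonneg ha hb
  rw [depthConst]; positivity

/-- A set `R` is removed from the graph beforehand because, in the two-vertex estimate, `R` will be
what the first exploration has used up. It enters the error only through its size. -/
lemma abs_bernEx_root_sub_le (ha : 0 ≤ a) (hb : 0 ≤ b) (han : a ≤ n) (hbn : b ≤ n) (hn : 0 < n)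
    {s : Fin n → ℤˣ} (hs : BalancedSpins s) {f : ℕ → ℕ → ℝ} {C : ℝ}
    (hf : ∀ k m, |f k m| ≤ C) (r : ℕ) (R : Finset (Fin n)) (j : Fin n) (hj : j ∉ R) :
    |bernEx (sbmProb a b s) (fun x => countFun s (s j) f ((step x)^[r] (root R j hj)))
        - (treeOp a b)^[r] f 1 0|
      ≤ C * depthConst a b r * (n : ℝ) ^ (-(1 / 3) : ℝ) * (R.card + 1) ^ 2 := by
  have h := abs_kernel_iterate_sub_treeOp_le ha hb han hbn hn hs (s j) hf r (root R j hj)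
  rw [← bernEx_iterate, countFun_root, card_ball_root] at h
  refine h.trans (le_of_eq ?_)
  rw [depthConst]
  ring

lemma bernEx_ball_sq_le (ha : 0 ≤ a) (hb : 0 ≤ b) (han : a ≤ n) (hbn : b ≤ n) (hn : 0 < n)
    (s : Fin n → ℤˣ) (i : Fin n) (t : ℕ) :
    bernEx (sbmProb a b s) (fun x => ((bfs x i t).ball.card : ℝ) ^ 2) ≤ ballConst a b ^ t := by
  have hb1 := one_le_ballConst ha hb
  have h := bernEx_iterate_le (sbmProb_mem ha hb han hbn s) (by linarith)
    (kernel_ball_sq_le ha hb han hbn hn s) t (root ∅ i (Finset.notMem_empty i))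
  rw [card_ball_root] at h
  simpa [bfs] using h

/-- Two explorations from vertices at distance more than `2 r` do not meet. -/
lemma disjoint_of_notMem_ball (x : Sym2 (Fin n) → Bool) {i j : Fin n} {r : ℕ}
    (h : j ∉ (bfs x i (2 * r)).ball) : Disjoint (bfs x i r).removed (bfs x j r).ball := by
  rw [Finset.disjoint_left]
  intro v hi hj
  apply h
  have hi' : v ∈ (bfs x i r).ball := Finset.mem_union_left _ hi
  rw [bfs, (mem_iterate_root x _ _).2] at hi' hj ⊢
  calc (edgeGraph x).edist i j ≤ (edgeGraph x).edist i v + (edgeGraph x).edist v j :=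
        SimpleGraph.edist_triangle
    _ ≤ r + r := by
        gcongr
        rw [SimpleGraph.edist_comm]
        exact hj
    _ = ((2 * r : ℕ) : ℕ∞) := by push_cast; ring

lemma self_mem_ball_bfs (x : Sym2 (Fin n) → Bool) (j : Fin n) (r : ℕ) : j ∈ (bfs x j r).ball := by
  rw [bfs, (mem_iterate_root x _ _).2, SimpleGraph.edist_self]
  exact zero_le

/-- Asymptotic independence of the explorations from two vertices. -/
lemma bernEx_pair_le (ha : 0 ≤ a) (hb : 0 ≤ b) (han : a ≤ n) (hbn : b ≤ n) (hn : 0 < n)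
    {s : Fin n → ℤˣ} (hs : BalancedSpins s) {f : ℕ → ℕ → ℝ} {C : ℝ}
    (hf : ∀ k m, |f k m| ≤ C) (r : ℕ) (i j : Fin n) :
    bernEx (sbmProb a b s) (fun x => countFun s (s j) f (bfs x i r)
        * (countFun s (s j) f (bfs x j r) - (treeOp a b)^[r] f 1 0))
      ≤ C * (C * depthConst a b r * (n : ℝ) ^ (-(1 / 3) : ℝ)) * (2 * ballConst a b ^ r + 2)
        + 2 * C ^ 2 * bernEx (sbmProb a b s)
          (fun x => if j ∈ (bfs x i (2 * r)).ball then 1 else 0) := by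
  classical
  have hC : 0 ≤ C := (abs_nonneg _).trans (hf 0 0)
  have hP := sbmProb_mem ha hb han hbn s
  have hdc := depthConst_nonneg ha hb r
  set q := (treeOp a b)^[r] f 1 0 with hq
  have hqC : |q| ≤ C := abs_treeOp_iterate_le hf r 1 0
  set δ := C * depthConst a b r * (n : ℝ) ^ (-(1 / 3) : ℝ) with hδ
  have hδ0 : 0 ≤ δ := by positivity
  have hcf : ∀ S, |countFun s (s j) f S| ≤ C := fun S => hf _ _
  -- The exploration from `j` in the graph without the vertices removed by the exploration from `i`;
  -- it uses fresh edges only. The default `q` makes the centred value zero when `j` itself has been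
  -- removed.
  let G : BfsState (Fin n) → (Sym2 (Fin n) → Bool) → ℝ := fun S x =>
    if h : j ∉ S.removed then countFun s (s j) f ((step x)^[r] (root S.removed j h)) else q
  have hGdep : ∀ S, DependsOn (G S) (edgesAvoiding S.removed) := by
    intro S x y hxy
    simp only [G]
    split_ifs with h
    · rfl
    · rw [show (step x)^[r] (root S.removed j h) = (step y)^[r] (root S.removed j h) from
        dependsOn_iterate_step r (root S.removed j h) hxy]
  have hGE : ∀ S, |bernEx (sbmProb a b s) (G S) - q| ≤ δ * (S.removed.card + 1) ^ 2 := by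
    intro S
    by_cases h : j ∉ S.removed
    · simp only [G, dif_pos h]
      exact abs_bernEx_root_sub_le ha hb han hbn hn hs hf r S.removed j h
    · simp only [G, dif_neg h, bernEx_const, sub_self, abs_zero]
      positivity
  have hGC : ∀ S x, |G S x| ≤ C := by
    intro S x
    simp only [G]
    split_ifs
    · exact hqC
    · exact hcf _
  have hsplit : ∀ x, countFun s (s j) f (bfs x i r) * (countFun s (s j) f (bfs x j r) - q)
      = countFun s (s j) f (bfs x i r) * (G (bfs x i r) x - q)
        + countFun s (s j) f (bfs x i r)
          * (countFun s (s j) f (bfs x j r) - G (bfs x i r) x) := fun x => by ring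
  simp only [hsplit]
  rw [bernEx_add]
  refine add_le_add ?_ ?_
  · have h1 := bernEx_iterate_step (sbmProb a b s) r (root ∅ i (Finset.notMem_empty i))
      (fun S x => countFun s (s j) f S * (G S x - q)) (fun S x y hxy => by
        show _ * (G S x - q) = _ * (G S y - q)
        rw [hGdep S hxy])
    have h2 : ∀ S, bernEx (sbmProb a b s) (fun x => countFun s (s j) f S * (G S x - q))
        ≤ C * δ * (2 * (S.ball.card : ℝ) ^ 2 + 2) := by
      intro S
      rw [bernEx_const_mul, bernEx_sub, bernEx_const]
      refine (le_abs_self _).trans ?_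
      rw [abs_mul, mul_assoc]
      have hR : (S.removed.card : ℝ) ≤ S.ball.card := by
        exact_mod_cast Finset.card_le_card Finset.subset_union_left
      have hR0 : (0 : ℝ) ≤ S.removed.card := Nat.cast_nonneg _
      have h3 : ((S.removed.card : ℝ) + 1) ^ 2 ≤ 2 * (S.ball.card : ℝ) ^ 2 + 2 := by
        nlinarith [sq_nonneg ((S.removed.card : ℝ) - 1)]
      have h4 := hGE S
      have h5 := hcf S
      calc _ ≤ C * (δ * (S.removed.card + 1) ^ 2) := by gcongr
        _ ≤ _ := by gcongr
    simp only [bfs]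
    rw [h1]
    refine (kernel_iterate_mono hP h2 r _).trans ?_
    rw [← bernEx_iterate, bernEx_const_mul, bernEx_add, bernEx_const, bernEx_const_mul]
    have h6 := bernEx_ball_sq_le ha hb han hbn hn s i r
    simp only [bfs] at h6
    gcongr
  · rw [← bernEx_const_mul]
    refine bernEx_mono hP fun x => ?_
    -- When `j` is farther than `2 r` from `i`, the two explorations of depth `r` do not interfere
    -- and the second term vanishes; otherwise it is bounded trivially.
    by_cases h : j ∈ (bfs x i (2 * r)).ball
    · rw [if_pos h, mul_one]
      refine (le_abs_self _).trans ?_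
      rw [abs_mul]
      have h1 : |countFun s (s j) f (bfs x j r) - G (bfs x i r) x| ≤ 2 * C :=
        (abs_sub _ _).trans (by linarith [hcf (bfs x j r), hGC (bfs x i r) x])
      have h2 := hcf (bfs x i r)
      calc _ ≤ C * (2 * C) := by gcongr
        _ = _ := by ring
    · rw [if_neg h, mul_zero]
      have hd := disjoint_of_notMem_ball x h
      have hj : j ∉ (bfs x i r).removed := fun hj =>
        Finset.disjoint_left.mp hd hj (self_mem_ball_bfs x j r)
      have hfr := (front_iterate_root_eq x _ j hj r hd).1
      have : countFun s (s j) f (bfs x j r) = G (bfs x i r) x := by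
        simp only [G, dif_pos hj, countFun, hfr]
        rfl
      rw [this, sub_self, mul_zero]

/-- The empirical mean over the vertices of spin `τ`. -/
def empMean (s : Fin n → ℤˣ) (τ : ℤˣ) (φ : Fin n → ℝ) : ℝ :=
  1 / (n : ℝ) * ∑ i, if s i = τ then φ i else 0

/-- Law of large numbers for functions of neighbourhoods of fixed depth. -/
lemma bernEx_empMean_sub_sq_le (ha : 0 ≤ a) (hb : 0 ≤ b) (han : a ≤ n) (hbn : b ≤ n) (hn : 0 < n)
    {s : Fin n → ℤˣ} (hs : BalancedSpins s) (τ : ℤˣ) {f : ℕ → ℕ → ℝ} {C : ℝ}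
    (hf : ∀ k m, |f k m| ≤ C) (r : ℕ) :
    bernEx (sbmProb a b s) (fun x => (empMean s τ (fun i => countFun s τ f (bfs x i r))
        - 1 / 2 * (treeOp a b)^[r] f 1 0) ^ 2)
      ≤ C ^ 2 * (2 * depthConst a b r * (2 * ballConst a b ^ r + 3)
        + 4 * ballConst a b ^ (2 * r) + 2) * (n : ℝ) ^ (-(1 / 3) : ℝ) := by
  have hn' : (0 : ℝ) < n := by exact_mod_cast hn
  have hC : 0 ≤ C := (abs_nonneg _).trans (hf 0 0)
  have hP := sbmProb_mem ha hb han hbn s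
  have hdc := depthConst_nonneg ha hb r
  have hbc := one_le_ballConst ha hb
  set q := (treeOp a b)^[r] f 1 0 with hq
  have hqC : |q| ≤ C := abs_treeOp_iterate_le hf r 1 0
  set η := (n : ℝ) ^ (-(1 / 3) : ℝ) with hη
  have hη0 : 0 ≤ η := by positivity
  have hη1 : η ≤ 1 := Real.rpow_le_one_of_one_le_of_nonpos (by exact_mod_cast hn) (by norm_num)
  have hMη : |magnetization s| / n ≤ η := by
    rw [div_le_iff₀ hn']
    refine (show |magnetization s| ≤ (n : ℝ) ^ (2 / 3 : ℝ) from hs).trans (le_of_eq ?_)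
    rw [hη]
    nth_rewrite 3 [← Real.rpow_one (n : ℝ)]
    rw [← Real.rpow_add hn']
    norm_num
  have hnη : 1 / (n : ℝ) ≤ η := by
    rw [hη, one_div, ← Real.rpow_neg_one]
    apply Real.rpow_le_rpow_of_exponent_le
    · exact_mod_cast hn
    · norm_num
  set δ := C * depthConst a b r * η with hδ
  have hδ0 : 0 ≤ δ := by positivity
  let A : Finset (Fin n) := Finset.univ.filter fun i => s i = τ
  let g : Fin n → (Sym2 (Fin n) → Bool) → ℝ := fun i x => countFun s τ f (bfs x i r)
  let e : Fin n → Fin n → ℝ := fun i j =>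
    bernEx (sbmProb a b s) (fun x => if j ∈ (bfs x i (2 * r)).ball then 1 else 0)
  have hone : ∀ j ∈ A, |bernEx (sbmProb a b s) (g j) - q| ≤ δ := by
    intro j hj
    have hj' : s j = τ := (Finset.mem_filter.mp hj).2
    have := abs_bernEx_root_sub_le ha hb han hbn hn hs hf r ∅ j (Finset.notMem_empty j)
    rw [hj'] at this
    simp only [Finset.card_empty, Nat.cast_zero, zero_add, one_pow, mul_one] at this
    exact this
  -- An upper bound on correlations is enough for a second moment. The diagonal needs no separate
  -- treatment, since `e i i` equals one.
  have hpair : ∀ i ∈ A, ∀ j ∈ A, bernEx (sbmProb a b s) (fun x => (g i x - q) * (g j x - q))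
      ≤ C * δ * (2 * ballConst a b ^ r + 3) + 2 * C ^ 2 * e i j := by
    intro i _ j hj
    have hj' : s j = τ := (Finset.mem_filter.mp hj).2
    have h1 := bernEx_pair_le ha hb han hbn hn hs hf r i j
    rw [hj'] at h1
    have h2 : ∀ x, (g i x - q) * (g j x - q) = g i x * (g j x - q) - q * (g j x - q) :=
      fun x => by ring
    simp only [h2]
    rw [bernEx_sub, bernEx_const_mul, bernEx_sub (p := sbmProb a b s) (g j), bernEx_const]
    have h3 : -(q * (bernEx (sbmProb a b s) (g j) - q)) ≤ C * δ := by
      refine (neg_le_abs _).trans ?_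
      rw [abs_mul]
      exact mul_le_mul hqC (hone j hj) (abs_nonneg _) hC
    have h4 : C * δ * (2 * ballConst a b ^ r + 3) = C * δ * (2 * ballConst a b ^ r + 2) + C * δ := by
      ring
    rw [h4]
    linarith
  -- Close pairs are few: each vertex has a bounded expected number of vertices within distance `2
  -- r`, so out of about `n ^ 2` pairs only `O(n)` count.
  have hsum_e : ∑ i ∈ A, ∑ j ∈ A, e i j ≤ n * ballConst a b ^ (2 * r) := by
    have h1 : ∀ i, ∑ j ∈ A, e i j ≤ ballConst a b ^ (2 * r) := by
      intro i
      refine le_trans ?_ (bernEx_ball_sq_le ha hb han hbn hn s i (2 * r))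
      rw [← bernEx_sum]
      refine bernEx_mono hP fun x => ?_
      calc ∑ j ∈ A, (if j ∈ (bfs x i (2 * r)).ball then (1 : ℝ) else 0)
          ≤ ∑ j, (if j ∈ (bfs x i (2 * r)).ball then (1 : ℝ) else 0) :=
            Finset.sum_le_sum_of_subset_of_nonneg (Finset.subset_univ _) fun j _ _ => by
              split_ifs <;> norm_num
        _ = (bfs x i (2 * r)).ball.card := by simp
        _ ≤ ((bfs x i (2 * r)).ball.card : ℝ) ^ 2 := by
            exact_mod_cast Nat.le_self_pow two_ne_zero _
    calc ∑ i ∈ A, ∑ j ∈ A, e i j ≤ ∑ _i ∈ A, ballConst a b ^ (2 * r) :=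
          Finset.sum_le_sum fun i _ => h1 i
      _ ≤ n * ballConst a b ^ (2 * r) := by
          rw [Finset.sum_const, nsmul_eq_mul]
          have : (A.card : ℝ) ≤ n := by
            have := Finset.card_le_univ A
            rw [Fintype.card_fin] at this
            exact_mod_cast this
          gcongr
  have hAn : (A.card : ℝ) ≤ n := by
    have := Finset.card_le_univ A
    rw [Fintype.card_fin] at this
    exact_mod_cast this
  have hY : bernEx (sbmProb a b s) (fun x => (∑ i ∈ A, (g i x - q)) ^ 2)
      ≤ n ^ 2 * (C * δ * (2 * ballConst a b ^ r + 3))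
        + 2 * C ^ 2 * (n * ballConst a b ^ (2 * r)) := by
    have h1 : ∀ x, (∑ i ∈ A, (g i x - q)) ^ 2
        = ∑ i ∈ A, ∑ j ∈ A, (g i x - q) * (g j x - q) := fun x => by
      rw [sq, Finset.sum_mul_sum]
    simp only [h1, bernEx_sum]
    refine (Finset.sum_le_sum fun i hi => Finset.sum_le_sum fun j hj => hpair i hi j hj).trans ?_
    simp only [Finset.sum_add_distrib, Finset.sum_const, nsmul_eq_mul, ← Finset.mul_sum]
    have hc0 : 0 ≤ C * δ * (2 * ballConst a b ^ r + 3) := by positivity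
    refine add_le_add ?_ (by gcongr)
    calc _ = (A.card : ℝ) ^ 2 * (C * δ * (2 * ballConst a b ^ r + 3)) := by ring
      _ ≤ _ := by gcongr
  -- The fluctuation of the centred sum is separated from the deviation of the class size from `n /
  -- 2`; balance controls the latter.
  have hpt : ∀ x, (empMean s τ (fun i => countFun s τ f (bfs x i r)) - 1 / 2 * q) ^ 2
      ≤ 2 / (n : ℝ) ^ 2 * (∑ i ∈ A, (g i x - q)) ^ 2 + 2 * (C ^ 2 * η) := by
    intro x
    have e1 : empMean s τ (fun i => countFun s τ f (bfs x i r)) - 1 / 2 * q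
        = 1 / n * ∑ i ∈ A, (g i x - q) + (A.card - n / 2) / n * q := by
      rw [empMean, ← Finset.sum_filter, Finset.sum_sub_distrib, Finset.sum_const, nsmul_eq_mul]
      field_simp
      ring
    have h1 : ((A.card - n / 2) / n * q) ^ 2 ≤ C ^ 2 * η := by
      have h2 : |((A.card : ℝ) - n / 2) / n| ≤ η := by
        rw [abs_div, abs_of_pos hn']
        refine le_trans ?_ hMη
        have := (abs_card_filter_sub_le s τ).1
        gcongr
      rw [mul_pow, ← sq_abs, ← sq_abs q]
      calc _ ≤ η ^ 2 * C ^ 2 := by gcongr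
        _ ≤ η * C ^ 2 := by
            gcongr
            rw [sq]
            exact mul_le_of_le_one_left hη0 hη1
        _ = _ := mul_comm _ _
    rw [e1]
    have h3 : ∀ u v : ℝ, (u + v) ^ 2 ≤ 2 * u ^ 2 + 2 * v ^ 2 := fun u v => by
      nlinarith [sq_nonneg (u - v)]
    refine (h3 _ _).trans (add_le_add (le_of_eq ?_) (by linarith))
    rw [mul_pow, div_pow]
    ring
  refine (bernEx_mono hP hpt).trans ?_
  rw [bernEx_add, bernEx_const_mul, bernEx_const]
  calc _ ≤ 2 / (n : ℝ) ^ 2 * (n ^ 2 * (C * δ * (2 * ballConst a b ^ r + 3))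
        + 2 * C ^ 2 * (n * ballConst a b ^ (2 * r))) + 2 * (C ^ 2 * η) := by gcongr
    _ = 2 * (C * δ * (2 * ballConst a b ^ r + 3))
        + 4 * C ^ 2 * ballConst a b ^ (2 * r) * (1 / n) + 2 * (C ^ 2 * η) := by
        field_simp
        ring
    _ ≤ 2 * (C * δ * (2 * ballConst a b ^ r + 3))
        + 4 * C ^ 2 * ballConst a b ^ (2 * r) * η + 2 * (C ^ 2 * η) := by gcongr
    _ = _ := by rw [hδ]; ring

end BfsState

end FixedDepth

/-! ### Pseudo-Lipschitz test functions -/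

/-- `h` is pseudo-Lipschitz of order two. -/
structure PseudoLipschitz (h : ℝ → ℝ) (L : ℝ) : Prop where
  nonneg : 0 ≤ L
  continuous : Continuous h
  bound : ∀ x y, |h x - h y| ≤ L * (|x - y| * (1 + |x| + |y|))

namespace PseudoLipschitz

variable {h : ℝ → ℝ} {L : ℝ}

/-- Young's inequality with a free parameter `κ`: mean-square closeness, with any large factor, plus
a small multiple of a bounded second moment. -/
lemma abs_sub_le (hh : PseudoLipschitz h L) {κ : ℝ} (hκ : 0 < κ) (x y : ℝ) :
    |h x - h y| ≤ L * ((1 + 1 / κ) * (x - y) ^ 2 + κ * (1 + 2 * y ^ 2)) := by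
  refine (hh.bound x y).trans (mul_le_mul_of_nonneg_left ?_ hh.nonneg)
  have h1 : |x| ≤ |x - y| + |y| := by
    calc |x| = |(x - y) + y| := by ring_nf
      _ ≤ _ := abs_add_le _ _
  have h2 : 0 ≤ |x - y| := abs_nonneg _
  have h3 : 0 ≤ |y| := abs_nonneg _
  rw [← sq_abs (x - y), ← sq_abs y]
  set d := |x - y|
  set u := |y|
  have h4 : d * (1 + 2 * u) ≤ 1 / κ * d ^ 2 + κ * (1 + 2 * u ^ 2) := by
    have e : 1 / κ * d ^ 2 + κ * (1 + 2 * u ^ 2) - d * (1 + 2 * u)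
        = κ * ((d / κ - (1 + 2 * u) / 2) ^ 2 + (3 / 4 + u ^ 2 - u)) := by
      field_simp
      ring
    have : 0 ≤ κ * ((d / κ - (1 + 2 * u) / 2) ^ 2 + (3 / 4 + u ^ 2 - u)) := by
      refine mul_nonneg hκ.le (add_nonneg (sq_nonneg _) ?_)
      nlinarith [sq_nonneg (u - 1 / 2)]
    linarith
  calc d * (1 + |x| + u) ≤ d * (1 + (d + u) + u) := by gcongr
    _ = d ^ 2 + d * (1 + 2 * u) := by ring
    _ ≤ d ^ 2 + (1 / κ * d ^ 2 + κ * (1 + 2 * u ^ 2)) := by gcongr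
    _ = _ := by ring

lemma abs_le (hh : PseudoLipschitz h L) (y : ℝ) : |h y| ≤ (|h 0| + 2 * L) * (1 + y ^ 2) := by
  have h1 := hh.bound y 0
  simp only [sub_zero, abs_zero, add_zero] at h1
  have h2 : |h y| ≤ |h y - h 0| + |h 0| := by
    calc |h y| = |(h y - h 0) + h 0| := by ring_nf
      _ ≤ _ := abs_add_le _ _
  have h3 : |y| * (1 + |y|) ≤ 2 * (1 + y ^ 2) := by
    rw [← sq_abs y]
    nlinarith [sq_nonneg (|y| - 1)]
  have h4 := mul_le_mul_of_nonneg_left h3 hh.nonneg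
  nlinarith [mul_nonneg (abs_nonneg (h 0)) (sq_nonneg y)]

/-- Composition with a change of sign. -/
lemma comp_unit (hh : PseudoLipschitz h L) (τ : ℤˣ) :
    PseudoLipschitz (fun x => h (((τ : ℤ) : ℝ) * x)) L where
  nonneg := hh.nonneg
  continuous := hh.continuous.comp (continuous_const.mul continuous_id)
  bound x y := by
    refine (hh.bound _ _).trans (le_of_eq ?_)
    have : |((τ : ℤ) : ℝ)| = 1 := by rcases Int.units_eq_one_or τ with h | h <;> simp [h]
    rw [← mul_sub, abs_mul, abs_mul, abs_mul, this]
    ring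

end PseudoLipschitz

/-- Truncation of `h` outside `[-K, K]`. -/
def truncFun (h : ℝ → ℝ) (K : ℝ) (y : ℝ) : ℝ := if |y| ≤ K then h y else 0

namespace PseudoLipschitz

variable {h : ℝ → ℝ} {L : ℝ}

/-- A sharp cutoff is enough: the comparison with the tree at fixed depth asks for boundedness of
the test function, not for continuity. -/
lemma abs_truncFun_le (hh : PseudoLipschitz h L) (K y : ℝ) :
    |truncFun h K y| ≤ (|h 0| + 2 * L) * (1 + K ^ 2) := by
  have h0 := hh.nonneg
  rw [truncFun]
  split_ifs with hy
  · refine (hh.abs_le y).trans ?_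
    have : y ^ 2 ≤ K ^ 2 := by rw [← sq_abs y]; gcongr
    gcongr
  · rw [abs_zero]; positivity

/-- Beyond `K ≥ 1` quadratic growth is at most `2 |y| ^ 3 / K`, so a third moment bounds the
truncation error uniformly in `n`. -/
lemma abs_sub_truncFun_le (hh : PseudoLipschitz h L) {K : ℝ} (hK : 1 ≤ K) (y : ℝ) :
    |h y - truncFun h K y| ≤ (|h 0| + 2 * L) * (2 * |y| ^ 3 / K) := by
  have h0 := hh.nonneg
  rw [truncFun]
  split_ifs with hy
  · rw [sub_self, abs_zero]; positivity
  · rw [sub_zero]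
    refine (hh.abs_le y).trans ?_
    have h1 : 1 + y ^ 2 ≤ 2 * |y| ^ 3 / K := by
      rw [le_div_iff₀ (by linarith), ← sq_abs y]
      have hy' : K < |y| := not_le.mp hy
      have h2 : 1 + |y| ^ 2 ≤ 2 * |y| ^ 2 := by nlinarith
      calc (1 + |y| ^ 2) * K ≤ 2 * |y| ^ 2 * |y| := by gcongr
        _ = _ := by ring
    gcongr

section Limits

variable {Ω : Type*} [MeasurableSpace Ω] {μ : Measure Ω} [IsProbabilityMeasure μ]

lemma integrable_comp (hh : PseudoLipschitz h L) {X : Ω → ℝ} (hX : MemLp X 2 μ) :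
    Integrable (fun ω => h (X ω)) μ := by
  refine (((integrable_const 1).add hX.integrable_sq).const_mul (|h 0| + 2 * L)).mono'
    (hh.continuous.comp_aestronglyMeasurable hX.1) (Eventually.of_forall fun ω => ?_)
  exact hh.abs_le (X ω)

lemma tendsto_integral (hh : PseudoLipschitz h L) {X : ℕ → Ω → ℝ} {Y : Ω → ℝ}
    (hX : ∀ r, MemLp (X r) 2 μ) (hY : MemLp Y 2 μ)
    (hXY : Tendsto (fun r => ∫ ω, (X r ω - Y ω) ^ 2 ∂μ) atTop (𝓝 0)) :
    Tendsto (fun r => ∫ ω, h (X r ω) ∂μ) atTop (𝓝 (∫ ω, h (Y ω) ∂μ)) := by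
  have h0 := hh.nonneg
  rw [Metric.tendsto_atTop']
  intro ε hε
  set m := ∫ ω, Y ω ^ 2 ∂μ with hm
  have hm0 : 0 ≤ m := integral_nonneg fun ω => sq_nonneg _
  -- Chosen to make the term without decay at most `ε / 4`; only afterwards is `r` taken large,
  -- depending on `κ`.
  set κ := ε / (4 * (L + 1) * (1 + 2 * m)) with hκ
  have hκ0 : 0 < κ := by positivity
  have h1 : Tendsto (fun r => L * ((1 + 1 / κ) * ∫ ω, (X r ω - Y ω) ^ 2 ∂μ)) atTop (𝓝 0) := by
    simpa using (hXY.const_mul (1 + 1 / κ)).const_mul L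
  obtain ⟨N, hN⟩ := (h1.eventually_lt_const (by positivity : 0 < ε / 2)).exists_forall_of_atTop
  refine ⟨N, fun r hr => ?_⟩
  have h2 := hN r hr.le
  rw [Real.dist_eq, ← integral_sub (hh.integrable_comp (hX r)) (hh.integrable_comp hY)]
  have hsq : Integrable (fun ω => (X r ω - Y ω) ^ 2) μ := ((hX r).sub hY).integrable_sq
  have hi1 : Integrable (fun ω => (1 + 1 / κ) * (X r ω - Y ω) ^ 2) μ := hsq.const_mul _
  have hi3 : Integrable (fun ω => 2 * Y ω ^ 2) μ := hY.integrable_sq.const_mul 2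
  have hi2 : Integrable (fun ω => κ * (1 + 2 * Y ω ^ 2)) μ :=
    ((integrable_const 1).add hi3).const_mul κ
  have h3 : |∫ ω, (h (X r ω) - h (Y ω)) ∂μ|
      ≤ ∫ ω, L * ((1 + 1 / κ) * (X r ω - Y ω) ^ 2 + κ * (1 + 2 * Y ω ^ 2)) ∂μ := by
    rw [← Real.norm_eq_abs]
    exact norm_integral_le_of_norm_le ((hi1.add hi2).const_mul L)
      (Eventually.of_forall fun ω => hh.abs_sub_le hκ0 _ _)
  rw [integral_const_mul, integral_add hi1 hi2, integral_const_mul, integral_const_mul,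
    integral_add (integrable_const 1) hi3, integral_const_mul, integral_const] at h3
  simp only [probReal_univ, smul_eq_mul, mul_one] at h3
  have h4 : L * (κ * (1 + 2 * m)) ≤ ε / 4 := by
    have : κ * (1 + 2 * m) = ε / (4 * (L + 1)) := by rw [hκ]; field_simp
    rw [this, mul_div_assoc', div_le_div_iff₀ (by positivity) (by norm_num)]
    nlinarith
  rw [mul_add] at h3
  linarith

lemma tendsto_integral_truncFun (hh : PseudoLipschitz h L) {X : Ω → ℝ} (hX : MemLp X 2 μ) :
    Tendsto (fun K : ℕ => ∫ ω, truncFun h K (X ω) ∂μ) atTop (𝓝 (∫ ω, h (X ω) ∂μ)) := by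
  refine tendsto_integral_of_dominated_convergence (fun ω => |h (X ω)|) (fun K => ?_)
    (hh.integrable_comp hX).abs (fun K => Eventually.of_forall fun ω => ?_)
    (Eventually.of_forall fun ω => ?_)
  · have : Measurable (truncFun h K) :=
      Measurable.ite (measurableSet_le measurable_norm measurable_const) hh.continuous.measurable
        measurable_const
    exact (this.comp_aemeasurable hX.1.aemeasurable).aestronglyMeasurable
  · rw [truncFun, Real.norm_eq_abs]
    split_ifs
    · exact le_rfl
    · rw [abs_zero]; exact abs_nonneg _
  · refine tendsto_const_nhds.congr' ?_
    filter_upwards [eventually_ge_atTop ⌈|X ω|⌉₊] with K hK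
    rw [truncFun, if_pos]
    exact (Nat.le_ceil _).trans (by exact_mod_cast hK)

end Limits

end PseudoLipschitz

/-! ### Empirical means at depth of logarithmic order -/

section LogDepth

open BfsState

variable {n : ℕ} {a b c : ℝ} {ℓ : ℕ → ℕ}

/-- The normalized spin sum over the sphere of radius `t` around `i`. -/
def normSpin (β : ℝ) (s : Fin n → ℤˣ) (x : Sym2 (Fin n) → Bool) (i : Fin n) (t : ℕ) : ℝ :=
  (β ^ t)⁻¹ * (bfs x i t).frontSpin s

lemma normSpin_zero (β : ℝ) (s : Fin n → ℤˣ) (x : Sym2 (Fin n) → Bool) (i : Fin n) :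
    normSpin β s x i 0 ^ 2 = 1 := by
  simp [normSpin, bfs, root, frontSpin, sq, spin_mul_self]

/-- Increments of order `α ^ k`, divided by `β ^ (2 k + 2)`, form a geometric sequence because `α <
β ^ 2`. Neither `C` nor `ρ` depends on `n`, the spins or the vertex, so depth `ℓ n` can be traded
for a fixed depth. -/
lemma eventually_normSpin_sub_sq_le (ha : 0 ≤ a) (hb : 0 ≤ b)
    (h : (a + b) / 2 < ((a - b) / 2) ^ 2) (hcα : c * Real.log ((a + b) / 2) < 1 / 2)
    (hℓ : Tendsto (fun n : ℕ => (ℓ n : ℝ) / Real.log n) atTop (𝓝 c)) :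
    ∃ C : ℝ, 0 ≤ C ∧ ∃ ρ : ℝ, 0 < ρ ∧ ρ < 1 ∧ ∀ᶠ n : ℕ in atTop, ∀ s : Fin n → ℤˣ,
      BalancedSpins s → ∀ i : Fin n, ∀ r t, r ≤ t → t ≤ ℓ n →
      bernEx (sbmProb a b s) (fun x =>
        (normSpin ((a - b) / 2) s x i t - normSpin ((a - b) / 2) s x i r) ^ 2) ≤ C * ρ ^ r := by
  have hα1 := one_lt_of_lt_sq ha hb h
  have hβ2 := sq_pos_of_lt_sq ha hb h
  obtain ⟨C, hC, hev⟩ := eventually_increment_le ha hb hα1 hcα hℓ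
  set β := (a - b) / 2 with hβ
  have hβ0 : β ≠ 0 := fun h0 => by simp [h0] at hβ2
  set θ := (a + b) / 2 / β ^ 2 with hθ
  have hθ0 : 0 < θ := by positivity
  have hθ1 : θ < 1 := by rw [hθ, div_lt_one hβ2]; exact h
  set ρ := Real.sqrt θ with hρ
  have hρ0 : 0 < ρ := Real.sqrt_pos.mpr hθ0
  have hρ1 : ρ < 1 := by rw [hρ, Real.sqrt_lt' one_pos]; simpa using hθ1
  have hρθ : ρ ^ 2 = θ := Real.sq_sqrt hθ0.le
  have h1ρ : 0 < 1 - ρ := by linarith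
  refine ⟨C / β ^ 2 / (1 - ρ) ^ 2, by positivity, ρ, hρ0, hρ1, ?_⟩
  filter_upwards [hev, tendsto_natCast_atTop_atTop.eventually_ge_atTop a,
    tendsto_natCast_atTop_atTop.eventually_ge_atTop b] with n hn han hbn
  intro s hs i r t hrt htl
  have hP := sbmProb_mem ha hb han hbn s
  refine (bernEx_mono hP fun x =>
    sq_sub_le_geometric (fun t => normSpin β s x i t) hρ0 hρ1 hrt).trans ?_
  rw [bernEx_const_mul, bernEx_sum]
  have h1 : ∀ k ∈ Finset.Ico r t, bernEx (sbmProb a b s)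
      (fun x => (ρ ^ k)⁻¹ * (normSpin β s x i (k + 1) - normSpin β s x i k) ^ 2)
      ≤ C / β ^ 2 * ρ ^ k := by
    intro k hk
    have hkl : k < ℓ n := lt_of_lt_of_le (Finset.mem_Ico.mp hk).2 htl
    have h2 := hn s hs i k hkl
    have e : ∀ x, (ρ ^ k)⁻¹ * (normSpin β s x i (k + 1) - normSpin β s x i k) ^ 2
        = (ρ ^ k)⁻¹ * ((β ^ (k + 1)) ^ 2)⁻¹ *
          ((bfs x i (k + 1)).frontSpin s - β * (bfs x i k).frontSpin s) ^ 2 := fun x => by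
      rw [normSpin, normSpin, pow_succ β]
      field_simp
    simp only [e]
    rw [bernEx_const_mul]
    calc _ ≤ (ρ ^ k)⁻¹ * ((β ^ (k + 1)) ^ 2)⁻¹ * (C * ((a + b) / 2) ^ k) := by
          gcongr
          exact h2
      _ = C / β ^ 2 * ((ρ ^ k)⁻¹ * θ ^ k) := by
          rw [hθ, div_pow ((a + b) / 2), ← pow_mul, ← pow_mul]
          field_simp
          ring
      _ = C / β ^ 2 * ρ ^ k := by
          rw [← hρθ]
          field_simp
          ring
  have h3 : ∑ k ∈ Finset.Ico r t, ρ ^ k ≤ ρ ^ r / (1 - ρ) := geom_sum_Ico_le_of_lt_one hρ0.le hρ1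
  calc _ ≤ ρ ^ r / (1 - ρ) * ∑ k ∈ Finset.Ico r t, C / β ^ 2 * ρ ^ k := by
        gcongr with k hk
        exact h1 k hk
    _ ≤ ρ ^ r / (1 - ρ) * (C / β ^ 2 * (ρ ^ r / (1 - ρ))) := by
        rw [← Finset.mul_sum]
        gcongr
    _ = C / β ^ 2 / (1 - ρ) ^ 2 * ρ ^ r * ρ ^ r := by
        field_simp
    _ ≤ C / β ^ 2 / (1 - ρ) ^ 2 * ρ ^ r :=
        mul_le_of_le_one_right (by positivity) (pow_le_one₀ hρ0.le hρ1.le)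

/-- Since `|β| ≥ 1`, normalization only decreases the spin sum, which is at most the sphere size.
The bound grows with `r` but not with `n`, and `r` is fixed when it is used. -/
lemma bernEx_abs_normSpin_cube_le (ha : 0 ≤ a) (hb : 0 ≤ b)
    (h : (a + b) / 2 < ((a - b) / 2) ^ 2) (han : a ≤ n) (hbn : b ≤ n) (hn : 0 < n)
    (s : Fin n → ℤˣ) (i : Fin n) (r : ℕ) :
    bernEx (sbmProb a b s) (fun x => |normSpin ((a - b) / 2) s x i r| ^ 3)
      ≤ cubeConst ((a + b) / 2) * (a + b) ^ (3 * r) := by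
  have hα1 := one_lt_of_lt_sq ha hb h
  have hP := sbmProb_mem ha hb han hbn s
  have hβ1 : 1 ≤ |(a - b) / 2| := by
    rw [← one_le_sq_iff_one_le_abs]
    linarith
  have hpt : ∀ x, |normSpin ((a - b) / 2) s x i r| ^ 3 ≤ ((bfs x i r).front.card : ℝ) ^ 3 := by
    intro x
    have : |normSpin ((a - b) / 2) s x i r| ≤ (bfs x i r).front.card := by
      rw [normSpin, abs_mul, abs_inv, abs_pow]
      have h1 : (|(a - b) / 2| ^ r)⁻¹ ≤ 1 := inv_le_one_of_one_le₀ (one_le_pow₀ hβ1)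
      calc _ ≤ 1 * |(bfs x i r).frontSpin s| := by gcongr
        _ ≤ _ := by rw [one_mul]; exact abs_frontSpin_le s _
    gcongr
  refine (bernEx_mono hP hpt).trans ?_
  have h3 := (bernEx_card_pow_le ha hb hα1 han hbn hn s (root ∅ i (Finset.notMem_empty i))
    (by simp [root]) r).2.2
  refine h3.trans ?_
  have := cubeConst_nonneg hα1
  have := growth_le ha hb hn s
  have := growth_nonneg ha hb s
  gcongr

lemma bernEx_abs_empMean_sub_le {p : Sym2 (Fin n) → ℝ} (hp : ∀ e, p e ∈ Set.Icc (0 : ℝ) 1)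
    (hn : 0 < n) (s : Fin n → ℤˣ) (τ : ℤˣ) (φ ψ : Fin n → (Sym2 (Fin n) → Bool) → ℝ) {B : ℝ}
    (hB : ∀ i, bernEx p (fun x => |φ i x - ψ i x|) ≤ B) :
    bernEx p (fun x => |empMean s τ (fun i => φ i x) - empMean s τ (fun i => ψ i x)|) ≤ B := by
  have hn' : (0 : ℝ) < n := by exact_mod_cast hn
  have hpt : ∀ x, |empMean s τ (fun i => φ i x) - empMean s τ (fun i => ψ i x)|
      ≤ 1 / n * ∑ i, |φ i x - ψ i x| := by
    intro x
    rw [empMean, empMean, ← mul_sub, ← Finset.sum_sub_distrib, abs_mul,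
      abs_of_nonneg (by positivity : (0 : ℝ) ≤ 1 / n)]
    gcongr
    refine (Finset.abs_sum_le_sum_abs _ _).trans (Finset.sum_le_sum fun i _ => ?_)
    split_ifs
    · exact le_rfl
    · simp
  refine (bernEx_mono hp hpt).trans ?_
  rw [bernEx_const_mul, bernEx_sum]
  calc _ ≤ 1 / (n : ℝ) * ∑ _i : Fin n, B := by
        gcongr with i
        exact hB i
    _ = B := by
        rw [Finset.sum_const, Finset.card_univ, Fintype.card_fin, nsmul_eq_mul]
        field_simp

/-- A frontier's spin sum is `τ` times the difference of its counts relative to `τ`; as `τ` squares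
to one, the count difference is `τ` times the spin sum. -/
lemma countFun_truncFun (β : ℝ) (h : ℝ → ℝ) (K : ℝ) (s : Fin n → ℤˣ) (τ : ℤˣ)
    (x : Sym2 (Fin n) → Bool) (i : Fin n) (r : ℕ) :
    countFun s τ (fun k m => truncFun h K ((β ^ r)⁻¹ * ((k : ℝ) - m))) (bfs x i r)
      = truncFun h K (((τ : ℤ) : ℝ) * normSpin β s x i r) := by
  rw [countFun, normSpin, frontSpin, card_filter_spin s τ]
  congr 1
  linear_combination (-(β ^ r)⁻¹ * (((bfs x i r).front.filter fun u => s u = τ).card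
    - ((bfs x i r).front.filter fun u => ¬ s u = τ).card)) * unit_mul_self τ

lemma abs_le_sq_div_add {δ : ℝ} (hδ : 0 < δ) (y : ℝ) : |y| ≤ 1 / (4 * δ) * y ^ 2 + δ := by
  rw [div_mul_eq_mul_div, one_mul, ← sub_le_iff_le_add, le_div_iff₀ (by positivity), ← sq_abs y]
  nlinarith [sq_nonneg (|y| - 2 * δ)]

set_option maxHeartbeats 1000000 in
/-- Law of large numbers at depth `ℓ n`, uniformly over balanced spins. -/
theorem eventually_bernEx_abs_empMean_sub_le {Ω : Type*} [MeasurableSpace Ω] {μ : Measure Ω}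
    [IsProbabilityMeasure μ] {Vp Vm : ℕ → Ω → ℕ} (hV : IsPoissonTreeProcess a b μ Vp Vm)
    (ha : 0 ≤ a) (hb : 0 ≤ b) (hαβ : (a + b) / 2 < ((a - b) / 2) ^ 2) (hc : 0 < c)
    (hcα : c * Real.log ((a + b) / 2) < 1 / 2)
    (hℓ : Tendsto (fun n : ℕ => (ℓ n : ℝ) / Real.log n) atTop (𝓝 c))
    {h : ℝ → ℝ} {L : ℝ} (hh : PseudoLipschitz h L) {ε : ℝ} (hε : 0 < ε) :
    ∀ᶠ n : ℕ in atTop, ∀ s : Fin n → ℤˣ, BalancedSpins s → ∀ τ : ℤˣ,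
      bernEx (sbmProb a b s) (fun x =>
        |empMean s τ (fun i => h (((τ : ℤ) : ℝ) * normSpin ((a - b) / 2) s x i (ℓ n)))
          - 1 / 2 * ∫ ω, h (treeDeltaLimit ((a - b) / 2) Vp Vm ω) ∂μ|) ≤ ε := by
  have hα1 := one_lt_of_lt_sq ha hb hαβ
  obtain ⟨-, hΔi, hΔr, hL2, -⟩ := hV.treeDelta_limit ha hb hαβ
  obtain ⟨C, hC, ρ, hρ0, hρ1, hev⟩ := eventually_normSpin_sub_sq_le ha hb hαβ hcα hℓ
  set β := (a - b) / 2 with hβ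
  set Δ := treeDelta β Vp Vm with hΔ
  set Δi := treeDeltaLimit β Vp Vm with hΔi'
  have hL0 := hh.nonneg
  -- The parameters are fixed in the order `κ`, depth `r`, cutoff `K`, and finally `n`; the errors
  -- add up to six times `ε / 8`. The factor `5 + 4 C` is `1 + 2 (2 C + 2)`, from the second moment
  -- bound `2 C + 2` at depth `r`.
  obtain ⟨κ, hκ0, hκ⟩ : ∃ κ > 0, L * (κ * (5 + 4 * C)) ≤ ε / 8 := by
    refine ⟨ε / (8 * (L + 1) * (5 + 4 * C)), by positivity, ?_⟩
    have : ε / (8 * (L + 1) * (5 + 4 * C)) * (5 + 4 * C) = ε / (8 * (L + 1)) := by field_simp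
    rw [this, mul_div_assoc', div_le_div_iff₀ (by positivity) (by norm_num)]
    nlinarith
  have hr1 : Tendsto (fun r : ℕ => L * ((1 + 1 / κ) * (C * ρ ^ r))) atTop (𝓝 0) := by
    simpa using (((tendsto_pow_atTop_nhds_zero_of_lt_one hρ0.le hρ1).const_mul C).const_mul
      (1 + 1 / κ)).const_mul L
  have hr2 := (hh.tendsto_integral hΔr hΔi hL2)
  obtain ⟨r, hr1, hr2⟩ := ((hr1.eventually_lt_const (by positivity : 0 < ε / 8)).and
    (hr2.eventually (Metric.ball_mem_nhds _ (by positivity : 0 < ε / 8)))).exists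
  rw [Real.dist_eq] at hr2
  set T := cubeConst ((a + b) / 2) * (a + b) ^ (3 * r) with hT
  have hT0 : 0 ≤ T := by
    have := cubeConst_nonneg hα1
    positivity
  have hK1 : Tendsto (fun K : ℕ => (|h 0| + 2 * L) * (2 * T / (K : ℝ))) atTop (𝓝 0) := by
    simpa using (tendsto_const_div_atTop_nhds_zero_nat (2 * T)).const_mul (|h 0| + 2 * L)
  obtain ⟨K, hK1, hK2, hK3⟩ := ((hK1.eventually_lt_const (by positivity : 0 < ε / 8)).and
    (((hh.tendsto_integral_truncFun (hΔr r)).eventually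
      (Metric.ball_mem_nhds _ (by positivity : 0 < ε / 8))).and (eventually_ge_atTop 1))).exists
  rw [Real.dist_eq] at hK2
  have hK3' : (1 : ℝ) ≤ K := by exact_mod_cast hK3
  let f : ℕ → ℕ → ℝ := fun k m => truncFun h K ((β ^ r)⁻¹ * ((k : ℝ) - m))
  have hf : ∀ k m, |f k m| ≤ (|h 0| + 2 * L) * (1 + (K : ℝ) ^ 2) := fun k m =>
    hh.abs_truncFun_le _ _
  have hQ : ∫ ω, truncFun h K (Δ r ω) ∂μ = (treeOp a b)^[r] f 1 0 :=
    hV.integral_eq_iterate r hf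
  set Cf := (|h 0| + 2 * L) * (1 + (K : ℝ) ^ 2)
  set K' := Cf ^ 2 * (2 * depthConst a b r * (2 * ballConst a b ^ r + 3)
        + 4 * ballConst a b ^ (2 * r) + 2) with hK'
  have hnlim : Tendsto (fun n : ℕ => K' * (n : ℝ) ^ (-(1 / 3) : ℝ) / (4 * (ε / 8))) atTop (𝓝 0) := by
    have := ((tendsto_rpow_neg_atTop (by norm_num : (0 : ℝ) < 1 / 3)).comp
      tendsto_natCast_atTop_atTop).const_mul K'
    simpa using this.div_const (4 * (ε / 8))
  -- Positivity of `c` makes `ℓ n` tend to infinity and hence pass the fixed depth `r`.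
  have hℓr : ∀ᶠ n : ℕ in atTop, r ≤ ℓ n := by
    have h1 : ∀ᶠ n : ℕ in atTop, c / 2 < (ℓ n : ℝ) / Real.log n :=
      hℓ.eventually_const_lt (by linarith)
    have h2 : Tendsto (fun n : ℕ => Real.log n) atTop atTop :=
      Real.tendsto_log_atTop.comp tendsto_natCast_atTop_atTop
    filter_upwards [h1, h2.eventually_ge_atTop (2 * r / c), h2.eventually_gt_atTop 0]
      with n h3 h4 h5
    rw [lt_div_iff₀ h5] at h3
    rw [div_le_iff₀ hc] at h4
    have : (r : ℝ) ≤ ℓ n := by linarith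
    exact_mod_cast this
  filter_upwards [hev, hℓr, hnlim.eventually_lt_const (by positivity : 0 < ε / 8),
    tendsto_natCast_atTop_atTop.eventually_ge_atTop a,
    tendsto_natCast_atTop_atTop.eventually_ge_atTop b, eventually_gt_atTop 0]
    with n hev hr hnε han hbn hn
  intro s hs τ
  have hP := sbmProb_mem ha hb han hbn s
  set u : ℝ := ((τ : ℤ) : ℝ) with hu
  have hu2 : u * u = 1 := unit_mul_self τ
  have hu1 : |u| = 1 := by rcases Int.units_eq_one_or τ with h | h <;> simp [hu, h]
  have hX2 : ∀ i, bernEx (sbmProb a b s) (fun x => normSpin β s x i r ^ 2) ≤ 2 * C + 2 := by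
    intro i
    have h1 := hev s hs i 0 r (Nat.zero_le r) hr
    rw [pow_zero, mul_one] at h1
    have h2 : ∀ x, normSpin β s x i r ^ 2
        ≤ 2 * (normSpin β s x i r - normSpin β s x i 0) ^ 2 + 2 := fun x => by
      have := normSpin_zero β s x i
      nlinarith [sq_nonneg (normSpin β s x i r - 2 * normSpin β s x i 0)]
    refine (bernEx_mono hP h2).trans ?_
    rw [bernEx_add, bernEx_const_mul, bernEx_const]
    linarith
  have t1 : bernEx (sbmProb a b s) (fun x =>
      |empMean s τ (fun i => h (u * normSpin β s x i (ℓ n)))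
        - empMean s τ (fun i => h (u * normSpin β s x i r))|) ≤ ε / 8 + ε / 8 := by
    refine bernEx_abs_empMean_sub_le hP hn s τ (fun i x => h (u * normSpin β s x i (ℓ n)))
      (fun i x => h (u * normSpin β s x i r)) fun i => ?_
    have h1 : ∀ x, |h (u * normSpin β s x i (ℓ n)) - h (u * normSpin β s x i r)|
        ≤ L * ((1 + 1 / κ) * (normSpin β s x i (ℓ n) - normSpin β s x i r) ^ 2
          + κ * (1 + 2 * normSpin β s x i r ^ 2)) := by
      intro x
      refine (hh.abs_sub_le hκ0 _ _).trans (le_of_eq ?_)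
      rw [← mul_sub, mul_pow, mul_pow, sq u, hu2, one_mul, one_mul]
    refine (bernEx_mono hP h1).trans ?_
    rw [bernEx_const_mul, bernEx_add, bernEx_const_mul, bernEx_const_mul, bernEx_add, bernEx_const,
      bernEx_const_mul]
    have h2 := hev s hs i r (ℓ n) hr le_rfl
    have h3 := hX2 i
    calc _ ≤ L * ((1 + 1 / κ) * (C * ρ ^ r) + κ * (1 + 2 * (2 * C + 2))) := by gcongr
      _ = L * ((1 + 1 / κ) * (C * ρ ^ r)) + L * (κ * (5 + 4 * C)) := by ring
      _ ≤ _ := by linarith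
  have t2 : bernEx (sbmProb a b s) (fun x =>
      |empMean s τ (fun i => h (u * normSpin β s x i r))
        - empMean s τ (fun i => truncFun h K (u * normSpin β s x i r))|) ≤ ε / 8 := by
    refine bernEx_abs_empMean_sub_le hP hn s τ (fun i x => h (u * normSpin β s x i r))
      (fun i x => truncFun h K (u * normSpin β s x i r)) fun i => ?_
    have h1 : ∀ x, |h (u * normSpin β s x i r) - truncFun h K (u * normSpin β s x i r)|
        ≤ (|h 0| + 2 * L) * (2 / K) * |normSpin β s x i r| ^ 3 := by
      intro x
      refine (hh.abs_sub_truncFun_le hK3' _).trans (le_of_eq ?_)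
      rw [abs_mul, hu1, one_mul]
      ring
    refine (bernEx_mono hP h1).trans ?_
    rw [bernEx_const_mul]
    have h3 := bernEx_abs_normSpin_cube_le ha hb hαβ han hbn hn s i r
    calc _ ≤ (|h 0| + 2 * L) * (2 / K) * T := by gcongr
      _ = (|h 0| + 2 * L) * (2 * T / (K : ℝ)) := by ring
      _ ≤ _ := hK1.le
  have t3 : bernEx (sbmProb a b s) (fun x =>
      |empMean s τ (fun i => truncFun h K (u * normSpin β s x i r))
        - 1 / 2 * (treeOp a b)^[r] f 1 0|) ≤ ε / 8 + ε / 8 := by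
    have h1 := bernEx_empMean_sub_sq_le ha hb han hbn hn hs τ hf r
    have e : ∀ x i, countFun s τ f (bfs x i r) = truncFun h K (u * normSpin β s x i r) :=
      fun x i => countFun_truncFun β h K s τ x i r
    simp only [e] at h1
    refine (bernEx_mono hP fun x => abs_le_sq_div_add (by positivity : 0 < ε / 8) _).trans ?_
    rw [bernEx_add, bernEx_const_mul, bernEx_const]
    have h3 : 1 / (4 * (ε / 8)) * (K' * (n : ℝ) ^ (-(1 / 3) : ℝ)) < ε / 8 := by
      refine lt_of_le_of_lt (le_of_eq ?_) hnε
      ring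
    have h4 := mul_le_mul_of_nonneg_left h1 (by positivity : 0 ≤ 1 / (4 * (ε / 8)))
    linarith
  have hpt : ∀ x, |empMean s τ (fun i => h (u * normSpin β s x i (ℓ n)))
        - 1 / 2 * ∫ ω, h (Δi ω) ∂μ|
      ≤ |empMean s τ (fun i => h (u * normSpin β s x i (ℓ n)))
          - empMean s τ (fun i => h (u * normSpin β s x i r))|
        + (|empMean s τ (fun i => h (u * normSpin β s x i r))
          - empMean s τ (fun i => truncFun h K (u * normSpin β s x i r))|
        + (|empMean s τ (fun i => truncFun h K (u * normSpin β s x i r))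
          - 1 / 2 * (treeOp a b)^[r] f 1 0| + ε / 8)) := by
    intro x
    have h1 : |1 / 2 * (treeOp a b)^[r] f 1 0 - 1 / 2 * ∫ ω, h (Δi ω) ∂μ| ≤ ε / 8 := by
      rw [← hQ, ← mul_sub, abs_mul, abs_of_pos (by norm_num : (0 : ℝ) < 1 / 2)]
      have := _root_.abs_sub_le (∫ ω, truncFun h K (Δ r ω) ∂μ) (∫ ω, h (Δ r ω) ∂μ)
        (∫ ω, h (Δi ω) ∂μ)
      linarith
    refine (_root_.abs_sub_le _ (empMean s τ (fun i => h (u * normSpin β s x i r))) _).trans ?_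
    gcongr
    refine (_root_.abs_sub_le _
      (empMean s τ (fun i => truncFun h K (u * normSpin β s x i r))) _).trans ?_
    gcongr
    refine (_root_.abs_sub_le _ (1 / 2 * (treeOp a b)^[r] f 1 0) _).trans ?_
    gcongr
  refine (bernEx_mono hP hpt).trans ?_
  rw [bernEx_add, bernEx_add, bernEx_add, bernEx_const]
  linarith

end LogDepth

/-! ### From the block model to products of Bernoulli laws -/

section Law

open BfsState

variable {n : ℕ} {a b : ℝ}

lemma edgeGraph_eq_iff {V : Type*} (x : Sym2 V → Bool) (H : SimpleGraph V) :
    edgeGraph x = H ↔ ∀ e : Sym2 V, ¬ e.IsDiag → (x e = true ↔ e ∈ H.edgeSet) := by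
  constructor
  · rintro rfl e
    induction e with
    | h u v =>
      intro h
      rw [Sym2.mk_isDiag_iff] at h
      rw [SimpleGraph.mem_edgeSet]
      exact ⟨fun h' => ⟨h, h'⟩, fun h' => h'.2⟩
  · intro h
    ext u v
    have h1 := h s(u, v)
    rw [Sym2.mk_isDiag_iff, SimpleGraph.mem_edgeSet] at h1
    constructor
    · rintro ⟨h2, h3⟩
      exact (h1 h2).1 h3
    · intro h2
      exact ⟨h2.ne, (h1 h2.ne).2 h2⟩

-- Indicators of loops do not affect the graph and integrate to one; the remaining unordered pairs
-- are represented by their increasing orderings.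
open Classical in
lemma bernEx_edgeGraph_eq (p : Sym2 (Fin n) → ℝ) (H : SimpleGraph (Fin n)) :
    bernEx p (fun x => if edgeGraph x = H then 1 else 0) =
      ∏ q : Fin n × Fin n with q.1 < q.2,
        if H.Adj q.1 q.2 then p s(q.1, q.2) else 1 - p s(q.1, q.2) := by
  have h1 : (fun x : Sym2 (Fin n) → Bool => if edgeGraph x = H then (1 : ℝ) else 0) = fun x =>
      ∏ e : Sym2 (Fin n),
        (fun (e : Sym2 (Fin n)) (y : Bool) =>
          if e.IsDiag then (1 : ℝ) else if (y = true ↔ e ∈ H.edgeSet) then 1 else 0) e (x e) := by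
    funext x
    by_cases h : edgeGraph x = H
    · rw [if_pos h]
      rw [edgeGraph_eq_iff] at h
      refine (Finset.prod_eq_one fun e _ => ?_).symm
      by_cases hd : e.IsDiag
      · simp only [if_pos hd]
      · simp only [if_neg hd, if_pos (h e hd)]
    · rw [if_neg h]
      rw [edgeGraph_eq_iff] at h
      push Not at h
      obtain ⟨e, hd, he⟩ := h
      refine (Finset.prod_eq_zero (Finset.mem_univ e) ?_).symm
      have : ¬ (x e = true ↔ e ∈ H.edgeSet) := by tauto
      simp only [if_neg hd, if_neg this]
  rw [h1]
  refine (bernEx_prod (p := p) fun (e : Sym2 (Fin n)) (y : Bool) =>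
    if e.IsDiag then (1 : ℝ) else if (y = true ↔ e ∈ H.edgeSet) then 1 else 0).trans ?_
  rw [← Finset.prod_subset (Finset.subset_univ (Finset.univ.filter fun e : Sym2 (Fin n) =>
    ¬ e.IsDiag))]
  · symm
    refine Finset.prod_bij (fun q _ => s(q.1, q.2)) ?_ ?_ ?_ ?_
    · intro q hq
      simp only [Finset.mem_filter, Finset.mem_univ, true_and] at hq ⊢
      rw [Sym2.mk_isDiag_iff]
      exact hq.ne
    · rintro ⟨u, v⟩ hq ⟨u', v'⟩ hq' h
      simp only [Finset.mem_filter, Finset.mem_univ, true_and] at hq hq'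
      rcases Sym2.eq_iff.mp h with ⟨rfl, rfl⟩ | ⟨rfl, rfl⟩
      · rfl
      · exact absurd hq' hq.asymm
    · intro e
      induction e with
      | h u v =>
        intro he
        simp only [Finset.mem_filter, Finset.mem_univ, true_and, Sym2.mk_isDiag_iff] at he
        rcases lt_or_gt_of_ne he with h | h
        · exact ⟨(u, v), by simpa using h, rfl⟩
        · exact ⟨(v, u), by simpa using h, Sym2.eq_swap⟩
    · rintro ⟨u, v⟩ hq
      simp only [Finset.mem_filter, Finset.mem_univ, true_and] at hq
      have hd : ¬ (s(u, v) : Sym2 (Fin n)).IsDiag := by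
        rw [Sym2.mk_isDiag_iff]; exact hq.ne
      simp only [if_neg hd, SimpleGraph.mem_edgeSet]
      by_cases hH : H.Adj u v <;> simp [hH]
  · intro e _ he
    simp only [Finset.mem_filter, Finset.mem_univ, true_and, not_not] at he
    simp [he]

lemma sbmMass_eq (a b : ℝ) (s : Fin n → ℤˣ) (H : SimpleGraph (Fin n)) :
    sbmMass a b s H = (1 / 2) ^ n *
      open Classical in bernEx (sbmProb a b s) (fun x => if edgeGraph x = H then 1 else 0) := by
  rw [bernEx_edgeGraph_eq, sbmMass]
  simp only [sbmProb_mk]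

-- A union bound over the finitely many pairs of spins and graph. An upper bound is all that
-- convergence in probability needs, and it requires no measurability of the event.
open Classical in
lemma IsStochasticBlockModel.measure_le {Ω : Type*} [MeasurableSpace Ω] {P : Measure Ω}
    {σ : Ω → Fin n → ℤˣ} {G : Ω → SimpleGraph (Fin n)} (hG : IsStochasticBlockModel a b P σ G)
    (ha : 0 ≤ a) (hb : 0 ≤ b) (han : a ≤ n) (hbn : b ≤ n)
    (Q : (Fin n → ℤˣ) → SimpleGraph (Fin n) → Prop) :
    P {ω | Q (σ ω) (G ω)} ≤ ENNReal.ofReal (∑ s : Fin n → ℤˣ, (1 / 2) ^ n *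
      bernEx (sbmProb a b s) (fun x => if Q s (edgeGraph x) then 1 else 0)) := by
  have hmass : ∀ s H, 0 ≤ sbmMass a b s H := fun s H => by
    rw [sbmMass_eq]
    refine mul_nonneg (by positivity) (bernEx_nonneg (sbmProb_mem ha hb han hbn s) fun x => ?_)
    split_ifs <;> norm_num
  have hsum : ∀ s : Fin n → ℤˣ, (1 / 2) ^ n *
      bernEx (sbmProb a b s) (fun x => if Q s (edgeGraph x) then 1 else 0)
        = ∑ H : SimpleGraph (Fin n), if Q s H then sbmMass a b s H else 0 := by
    intro s
    have : (fun x => if Q s (edgeGraph x) then (1 : ℝ) else 0) = fun x =>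
        ∑ H : SimpleGraph (Fin n), (if Q s H then 1 else 0) * if edgeGraph x = H then 1 else 0 := by
      funext x
      simp
    rw [this, bernEx_sum, Finset.mul_sum]
    refine Finset.sum_congr rfl fun H _ => ?_
    rw [bernEx_const_mul, sbmMass_eq]
    split_ifs <;> simp
  have hsub : {ω | Q (σ ω) (G ω)} ⊆
      ⋃ s, ⋃ H, {ω | (σ ω = s ∧ G ω = H) ∧ Q s H} := fun ω hω => by
    simp only [Set.mem_iUnion]
    exact ⟨σ ω, G ω, ⟨rfl, rfl⟩, hω⟩
  calc P {ω | Q (σ ω) (G ω)} ≤ ∑ s, P (⋃ H, {ω | (σ ω = s ∧ G ω = H) ∧ Q s H}) :=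
        (measure_mono hsub).trans (measure_iUnion_fintype_le _ _)
    _ ≤ ∑ s, ∑ H, P {ω | (σ ω = s ∧ G ω = H) ∧ Q s H} :=
        Finset.sum_le_sum fun s _ => measure_iUnion_fintype_le _ _
    _ ≤ ∑ s, ∑ H, ENNReal.ofReal (if Q s H then sbmMass a b s H else 0) := by
        refine Finset.sum_le_sum fun s _ => Finset.sum_le_sum fun H _ => ?_
        by_cases h : Q s H
        · simp only [h, and_true, if_true, hG.law]
          exact le_rfl
        · simp [h]
    _ = _ := by
        simp only [hsum]
        rw [ENNReal.ofReal_sum_of_nonneg]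
        · refine Finset.sum_congr rfl fun s _ => ?_
          rw [ENNReal.ofReal_sum_of_nonneg]
          intro H _
          split_ifs
          exacts [hmass s H, le_rfl]
        · intro s _
          refine Finset.sum_nonneg fun H _ => ?_
          split_ifs
          exacts [hmass s H, le_rfl]

lemma sphereSpin_edgeGraph (s : Fin n → ℤˣ) (x : Sym2 (Fin n) → Bool) (t : ℕ) (i : Fin n) :
    sphereSpin s (edgeGraph x) t i = (bfs x i t).frontSpin s := by
  rw [sphereSpin, frontSpin]
  refine Finset.sum_congr ?_ fun u _ => rfl
  ext u
  simp only [Finset.mem_filter, Finset.mem_univ, true_and, bfs]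
  exact ((mem_iterate_root x i t).1 u).symm

/-! ### Balanced spins -/

/-- Flipping the spin at `u` permutes the configurations and reverses the sign of the summand. -/
lemma sum_spin_mul_spin {u v : Fin n} (h : u ≠ v) :
    ∑ s : Fin n → ℤˣ, spin s u * spin s v = 0 := by
  have h1 := Equiv.sum_comp (Equiv.mulRight (Pi.mulSingle u (-1) : Fin n → ℤˣ))
    (fun s : Fin n → ℤˣ => spin s u * spin s v)
  have h2 : ∀ s : Fin n → ℤˣ, spin (Equiv.mulRight (Pi.mulSingle u (-1) : Fin n → ℤˣ) s) u *
      spin (Equiv.mulRight (Pi.mulSingle u (-1) : Fin n → ℤˣ) s) v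
      = -(spin s u * spin s v) := fun s => by
    simp [spin, h.symm]
  simp only [h2, Finset.sum_neg_distrib] at h1
  linarith

lemma sum_magnetization_sq : ∑ s : Fin n → ℤˣ, (1 / 2 : ℝ) ^ n * magnetization s ^ 2 = n := by
  have h1 : ∑ s : Fin n → ℤˣ, magnetization s ^ 2 = 2 ^ n * n := by
    simp only [magnetization, sq, Finset.sum_mul_sum]
    rw [Finset.sum_comm]
    have : ∀ u : Fin n, ∑ s : Fin n → ℤˣ, ∑ v, spin s u * spin s v = 2 ^ n := fun u => by
      rw [Finset.sum_comm, Finset.sum_eq_single u (fun v _ hv => sum_spin_mul_spin hv.symm)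
        (fun h => absurd (Finset.mem_univ u) h)]
      simp [spin_mul_self]
    simp only [this]
    simp [mul_comm]
  rw [← Finset.mul_sum, h1, ← mul_assoc, ← mul_pow]
  norm_num

lemma sum_half_pow : ∑ _s : Fin n → ℤˣ, (1 / 2 : ℝ) ^ n = 1 := by
  rw [Finset.sum_const, nsmul_eq_mul, Finset.card_univ]
  simp

-- Chebyshev: the spin sum has second moment `n`, to be compared with the square `n ^ (4/3)` of the
-- threshold.
open Classical in
lemma sum_not_balanced_le (hn : 0 < n) :
    ∑ s : Fin n → ℤˣ, (1 / 2 : ℝ) ^ n * (if BalancedSpins s then 0 else 1)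
      ≤ (n : ℝ) ^ (-(1 / 3) : ℝ) := by
  have hn' : (0 : ℝ) < n := by exact_mod_cast hn
  have h0 : (0 : ℝ) < (n : ℝ) ^ (4 / 3 : ℝ) := Real.rpow_pos_of_pos hn' _
  have h1 : ∀ s : Fin n → ℤˣ, (1 / 2 : ℝ) ^ n * (if BalancedSpins s then 0 else 1)
      ≤ (1 / 2 : ℝ) ^ n * magnetization s ^ 2 * ((n : ℝ) ^ (4 / 3 : ℝ))⁻¹ := by
    intro s
    rw [mul_assoc]
    gcongr
    split_ifs with h
    · positivity
    · rw [← div_eq_mul_inv, one_le_div h0, ← sq_abs (magnetization s)]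
      rw [BalancedSpins, not_le] at h
      have : (n : ℝ) ^ (4 / 3 : ℝ) = ((n : ℝ) ^ (2 / 3 : ℝ)) ^ 2 := by
        rw [← Real.rpow_natCast, ← Real.rpow_mul hn'.le]
        norm_num
      rw [this]
      gcongr
  refine (Finset.sum_le_sum fun s _ => h1 s).trans ?_
  rw [← Finset.sum_mul, sum_magnetization_sq, ← Real.rpow_neg hn'.le]
  nth_rewrite 1 [← Real.rpow_one (n : ℝ)]
  rw [← Real.rpow_add hn']
  norm_num

end Law

/-! ### Law of large numbers for the block model. -/

section LawOfLargeNumbers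

open BfsState

variable {a b c : ℝ} {Ω : ℕ → Type*} [∀ n, MeasurableSpace (Ω n)] {P : ∀ n, Measure (Ω n)}
  {σ : ∀ n, Ω n → Fin n → ℤˣ} {G : ∀ n, Ω n → SimpleGraph (Fin n)}

lemma tendsto_measure_zero_of_eventually_le {f : ℕ → ENNReal}
    (h : ∀ η : ℝ, 0 < η → ∀ᶠ n in atTop, f n ≤ ENNReal.ofReal η) :
    Tendsto f atTop (𝓝 0) := by
  rw [ENNReal.tendsto_nhds_zero]
  intro ε hε
  obtain ⟨r, hr0, hr⟩ := ENNReal.lt_iff_exists_nnreal_btwn.mp hε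
  filter_upwards [h r (by exact_mod_cast hr0)] with n hn
  refine hn.trans ?_
  rw [ENNReal.ofReal_coe_nnreal]
  exact hr.le

/-- A uniform `L¹` bound over balanced spins gives convergence in probability. -/
lemma tendstoInProb_of_bernEx_le (ha : 0 ≤ a) (hb : 0 ≤ b)
    (hG : ∀ᶠ n in atTop, IsStochasticBlockModel a b (P n) (σ n) (G n))
    (F : ∀ n, (Fin n → ℤˣ) → SimpleGraph (Fin n) → ℝ) (m : ℝ)
    (hF : ∀ ε : ℝ, 0 < ε → ∀ᶠ n : ℕ in atTop, ∀ s : Fin n → ℤˣ, BalancedSpins s →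
      bernEx (sbmProb a b s) (fun x => |F n s (edgeGraph x) - m|) ≤ ε) :
    TendstoInProb P (fun n ω => F n (σ n ω) (G n ω)) m := by
  classical
  intro ε hε
  refine tendsto_measure_zero_of_eventually_le fun η hη => ?_
  have hnlim : Tendsto (fun n : ℕ => (n : ℝ) ^ (-(1 / 3) : ℝ)) atTop (𝓝 0) :=
    (tendsto_rpow_neg_atTop (by norm_num : (0 : ℝ) < 1 / 3)).comp tendsto_natCast_atTop_atTop
  -- Half of `η` pays for Markov's inequality at level `ε` on balanced spins, the other half for
  -- unbalanced spins.
  filter_upwards [hG, hF (ε * (η / 2)) (by positivity),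
    hnlim.eventually_lt_const (by positivity : 0 < η / 2),
    tendsto_natCast_atTop_atTop.eventually_ge_atTop a,
    tendsto_natCast_atTop_atTop.eventually_ge_atTop b, eventually_gt_atTop 0]
    with n hG hF hn han hbn hn0
  refine (hG.measure_le ha hb han hbn (fun s H => ε ≤ |F n s H - m|)).trans
    (ENNReal.ofReal_le_ofReal ?_)
  have h1 : ∀ s : Fin n → ℤˣ, (1 / 2 : ℝ) ^ n * bernEx (sbmProb a b s)
        (fun x => if ε ≤ |F n s (edgeGraph x) - m| then 1 else 0)
      ≤ (1 / 2 : ℝ) ^ n * (if BalancedSpins s then 0 else 1) + (1 / 2 : ℝ) ^ n * (η / 2) := by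
    intro s
    have hP := sbmProb_mem ha hb han hbn s
    rw [← mul_add]
    gcongr
    split_ifs with hs
    · have h2 : ∀ x, (if ε ≤ |F n s (edgeGraph x) - m| then (1 : ℝ) else 0)
          ≤ ε⁻¹ * |F n s (edgeGraph x) - m| := fun x => by
        split_ifs with h
        · rw [inv_mul_eq_div, one_le_div hε]; exact h
        · positivity
      refine (bernEx_mono hP h2).trans ?_
      rw [bernEx_const_mul, zero_add, inv_mul_le_iff₀ hε]
      exact hF s hs
    · have h2 : ∀ x, (if ε ≤ |F n s (edgeGraph x) - m| then (1 : ℝ) else 0) ≤ 1 := fun x => by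
        split_ifs <;> norm_num
      refine (bernEx_mono hP h2).trans ?_
      rw [bernEx_const]
      linarith
  refine (Finset.sum_le_sum fun s _ => h1 s).trans ?_
  rw [Finset.sum_add_distrib, ← Finset.sum_mul, sum_half_pow]
  have := sum_not_balanced_le hn0
  linarith

/-- Law of large numbers for the normalized sphere sums of the block model. -/
theorem tendstoInProb_empMean (ha : 0 ≤ a) (hb : 0 ≤ b)
    (hαβ : (a + b) / 2 < ((a - b) / 2) ^ 2) (hc : 0 < c)
    (hcα : c * Real.log ((a + b) / 2) < 1 / 2) {ℓ : ℕ → ℕ}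
    (hℓ : Tendsto (fun n : ℕ => (ℓ n : ℝ) / Real.log n) atTop (𝓝 c))
    (hG : ∀ᶠ n in atTop, IsStochasticBlockModel a b (P n) (σ n) (G n))
    {Ω' : Type*} [MeasurableSpace Ω'] {μ : Measure Ω'} [IsProbabilityMeasure μ]
    {Vp Vm : ℕ → Ω' → ℕ} (hV : IsPoissonTreeProcess a b μ Vp Vm)
    {h : ℝ → ℝ} {L : ℝ} (hh : PseudoLipschitz h L) (τ : ℤˣ) :
    TendstoInProb P (fun n ω => empMean (σ n ω) τ fun i =>
        h ((((a - b) / 2) ^ ℓ n)⁻¹ * sphereSpin (σ n ω) (G n ω) (ℓ n) i))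
      (1 / 2 * ∫ ω, h (((τ : ℤ) : ℝ) * treeDeltaLimit ((a - b) / 2) Vp Vm ω) ∂μ) := by
  refine tendstoInProb_of_bernEx_le ha hb hG (fun n s H => empMean s τ fun i =>
    h ((((a - b) / 2) ^ ℓ n)⁻¹ * sphereSpin s H (ℓ n) i)) _ fun ε hε => ?_
  -- Applied to `h(τ ·)`, the signs cancel on the graph side because `τ` squares to one, and the
  -- sign moves to the tree side.
  filter_upwards [eventually_bernEx_abs_empMean_sub_le hV ha hb hαβ hc hcα hℓ (hh.comp_unit τ) hε]
    with n hn s hs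
  have := hn s hs τ
  simp only [← mul_assoc, unit_mul_self, one_mul] at this
  simpa only [sphereSpin_edgeGraph, normSpin] using this

end LawOfLargeNumbers

/-! ### Calculus of convergence in probability -/

namespace TendstoInProb

variable {Ω : ℕ → Type*} [∀ n, MeasurableSpace (Ω n)] {P : ∀ n, Measure (Ω n)}
  {X Y : ∀ n, Ω n → ℝ} {x y : ℝ}

/-- The bracketing variables and their limits may change with `ε`, as happens when an indicator is
approximated by steeper and steeper ramps. -/
lemma of_squeeze {m : ℝ}
    (h : ∀ ε : ℝ, 0 < ε → ∃ (U V : ∀ n, Ω n → ℝ) (u v : ℝ), TendstoInProb P U u ∧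
      TendstoInProb P V v ∧ m - ε ≤ u ∧ v ≤ m + ε ∧
      ∀ᶠ n in atTop, ∀ ω, U n ω ≤ X n ω ∧ X n ω ≤ V n ω) :
    TendstoInProb P X m := by
  intro ε hε
  obtain ⟨U, V, u, v, hU, hV, hu, hv, hUV⟩ := h (ε / 2) (by positivity)
  have h1 := (hU (ε / 2) (by positivity)).add (hV (ε / 2) (by positivity))
  rw [add_zero] at h1
  refine tendsto_of_tendsto_of_tendsto_of_le_of_le' tendsto_const_nhds h1
    (Eventually.of_forall fun n => zero_le) ?_
  filter_upwards [hUV] with n hn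
  refine (measure_mono fun ω hω => ?_).trans (measure_union_le _ _)
  simp only [Set.mem_ofPred_eq, Set.mem_union] at hω ⊢
  by_contra hcon
  rw [not_or, not_le, not_le, abs_lt, abs_lt] at hcon
  have := hn ω
  rcases le_abs'.mp hω with h | h <;> linarith [hcon.1.1, hcon.2.2]

lemma congr (hX : TendstoInProb P X x) (h : ∀ᶠ n in atTop, ∀ ω, X n ω = Y n ω) :
    TendstoInProb P Y x := by
  refine of_squeeze fun ε hε => ⟨X, X, x, x, hX, hX, by linarith, by linarith, ?_⟩
  filter_upwards [h] with n hn
  exact fun ω => ⟨(hn ω).le, (hn ω).ge⟩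

lemma add (hX : TendstoInProb P X x) (hY : TendstoInProb P Y y) :
    TendstoInProb P (fun n ω => X n ω + Y n ω) (x + y) := by
  intro ε hε
  have h1 := (hX (ε / 2) (by positivity)).add (hY (ε / 2) (by positivity))
  rw [add_zero] at h1
  refine tendsto_of_tendsto_of_tendsto_of_le_of_le tendsto_const_nhds h1
    (fun n => zero_le) fun n => ?_
  refine (measure_mono fun ω hω => ?_).trans (measure_union_le _ _)
  simp only [Set.mem_ofPred_eq, Set.mem_union] at hω ⊢
  by_contra hcon
  rw [not_or, not_le, not_le, abs_lt, abs_lt] at hcon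
  rcases le_abs'.mp hω with h | h <;> linarith [hcon.1.1, hcon.1.2, hcon.2.1, hcon.2.2]

lemma comp (hX : TendstoInProb P X x) {g : ℝ → ℝ} (hg : ContinuousAt g x) :
    TendstoInProb P (fun n ω => g (X n ω)) (g x) := by
  intro ε hε
  obtain ⟨δ, hδ, h⟩ := Metric.continuousAt_iff.mp hg ε hε
  refine tendsto_of_tendsto_of_tendsto_of_le_of_le tendsto_const_nhds (hX δ hδ)
    (fun n => zero_le) fun n => measure_mono fun ω hω => ?_
  simp only [Set.mem_ofPred_eq] at hω ⊢
  by_contra hcon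
  have := h (show dist (X n ω) x < δ from not_le.mp hcon)
  rw [Real.dist_eq] at this
  linarith

lemma const_mul (hX : TendstoInProb P X x) (c : ℝ) :
    TendstoInProb P (fun n ω => c * X n ω) (c * x) :=
  hX.comp (g := fun y => c * y) (by fun_prop)

lemma sub (hX : TendstoInProb P X x) (hY : TendstoInProb P Y y) :
    TendstoInProb P (fun n ω => X n ω - Y n ω) (x - y) := by
  simpa [sub_eq_add_neg] using hX.add (hY.const_mul (-1))

end TendstoInProb

/-! ### The normed vector -/

section NormedVector

variable {n : ℕ} {β : ℝ}

lemma sqrt_sub_sqrt_sq_le {A B : ℝ} (hA : 0 ≤ A) (hB : 0 ≤ B) :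
    (Real.sqrt A - Real.sqrt B) ^ 2 ≤ |A - B| := by
  have h1 : |Real.sqrt A - Real.sqrt B| ≤ |Real.sqrt A + Real.sqrt B| := by
    rw [abs_of_nonneg (add_nonneg (Real.sqrt_nonneg A) (Real.sqrt_nonneg B)), abs_le]
    constructor <;> linarith [Real.sqrt_nonneg A, Real.sqrt_nonneg B]
  have h2 : A - B = (Real.sqrt A + Real.sqrt B) * (Real.sqrt A - Real.sqrt B) := by
    nth_rewrite 1 [← Real.sq_sqrt hA, ← Real.sq_sqrt hB]
    ring
  rw [h2, abs_mul, ← sq_abs, sq]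
  gcongr

/-- The norm of the rescaled vector carries `|β| ^ (-t)`, and the sign in `normalizedSphereSpin`
turns this into `β ^ (-t)`. If all sphere sums vanish, both sides are zero by the convention for
division. -/
lemma sqrt_mul_normalizedSphereSpin (hβ : β ≠ 0) (s : Fin n → ℤˣ) (H : SimpleGraph (Fin n))
    (t : ℕ) (i : Fin n) :
    Real.sqrt (∑ j, ((β ^ t)⁻¹ * sphereSpin s H t j) ^ 2) * normalizedSphereSpin β s H t i
      = (β ^ t)⁻¹ * sphereSpin s H t i := by
  have h1 : ∑ j, ((β ^ t)⁻¹ * sphereSpin s H t j) ^ 2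
      = ((β ^ t)⁻¹) ^ 2 * ∑ j, sphereSpin s H t j ^ 2 := by
    rw [Finset.mul_sum]
    exact Finset.sum_congr rfl fun j _ => by ring
  have hab : |β| ≠ 0 := abs_ne_zero.mpr hβ
  rw [h1, Real.sqrt_mul (sq_nonneg _), Real.sqrt_sq_eq_abs, normalizedSphereSpin]
  simp only [abs_inv, abs_pow, div_pow]
  by_cases hS : Real.sqrt (∑ j, sphereSpin s H t j ^ 2) = 0
  · rw [Real.sqrt_eq_zero (Finset.sum_nonneg fun j _ => sq_nonneg _),
      Finset.sum_eq_zero_iff_of_nonneg fun j _ => sq_nonneg _] at hS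
    have := pow_eq_zero_iff (two_ne_zero) |>.mp (hS i (Finset.mem_univ i))
    simp [this]
  · have h2 : |β| ^ t * |β| ^ t = β ^ t * β ^ t := by
      rw [← mul_pow, ← mul_pow, abs_mul_abs_self]
    field_simp
    linear_combination (-sphereSpin s H t i) * h2

/-- An inequality rather than an equality because the vector is zero when all sphere sums vanish. -/
lemma norm_normalizedSphereSpin_sq_le (s : Fin n → ℤˣ) (H : SimpleGraph (Fin n)) (t : ℕ) :
    ‖normalizedSphereSpin β s H t‖ ^ 2 ≤ 1 := by
  rw [EuclideanSpace.real_norm_sq_eq]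
  have hS : 0 ≤ ∑ j, sphereSpin s H t j ^ 2 := Finset.sum_nonneg fun j _ => sq_nonneg _
  have h1 : ((β / |β|) ^ t) ^ 2 ≤ 1 := by
    rw [← pow_mul, mul_comm, pow_mul, div_pow, sq_abs]
    exact pow_le_one₀ (by positivity) (div_self_le_one _)
  calc ∑ i, normalizedSphereSpin β s H t i ^ 2
      = ((β / |β|) ^ t) ^ 2 * ((∑ i, sphereSpin s H t i ^ 2) / ∑ j, sphereSpin s H t j ^ 2) := by
        rw [Finset.sum_div, Finset.mul_sum]
        refine Finset.sum_congr rfl fun i _ => ?_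
        simp only [normalizedSphereSpin]
        rw [mul_pow, div_pow (sphereSpin s H t i), Real.sq_sqrt hS]
    _ ≤ 1 * 1 := mul_le_mul h1 (div_self_le_one _) (by positivity) (by norm_num)
    _ = 1 := one_mul 1

/-- With `S` the sum of squares of the rescaled sphere sums, `√(n m) x - √S y = √(n m) (x - y) +
(√(n m) - √S) y`. The second part is controlled by `‖y‖ ≤ 1` and `(√A - √B) ^ 2 ≤ |A - B|`. -/
lemma mean_sq_scaled_sub_le (hβ : β ≠ 0) (hn : 0 < n) {m : ℝ} (hm : 0 ≤ m) (s : Fin n → ℤˣ)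
    (H : SimpleGraph (Fin n)) (t : ℕ) (x : EuclideanSpace ℝ (Fin n)) :
    1 / (n : ℝ) * ∑ i, (Real.sqrt (n * m) * x i - (β ^ t)⁻¹ * sphereSpin s H t i) ^ 2
      ≤ 2 * m * ‖x - normalizedSphereSpin β s H t‖ ^ 2
        + 2 * |1 / (n : ℝ) * ∑ i, ((β ^ t)⁻¹ * sphereSpin s H t i) ^ 2 - m| := by
  have hn' : (0 : ℝ) < n := by exact_mod_cast hn
  set S := ∑ i, ((β ^ t)⁻¹ * sphereSpin s H t i) ^ 2 with hS
  have hS0 : 0 ≤ S := Finset.sum_nonneg fun i _ => sq_nonneg _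
  set y := normalizedSphereSpin β s H t with hy
  have h1 : ∀ i, (Real.sqrt (n * m) * x i - (β ^ t)⁻¹ * sphereSpin s H t i) ^ 2
      ≤ 2 * (n * m) * (x - y) i ^ 2 + 2 * (Real.sqrt (n * m) - Real.sqrt S) ^ 2 * y i ^ 2 := by
    intro i
    rw [← sqrt_mul_normalizedSphereSpin hβ s H t i, ← hS, ← hy, PiLp.sub_apply]
    have h2 : Real.sqrt (n * m) ^ 2 = n * m := Real.sq_sqrt (by positivity)
    generalize Real.sqrt (n * m) = r at h2 ⊢
    rw [← h2]
    nlinarith [sq_nonneg (r * (x i - y i) - (r - Real.sqrt S) * y i)]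
  have h3 : ∑ i, (Real.sqrt (n * m) * x i - (β ^ t)⁻¹ * sphereSpin s H t i) ^ 2
      ≤ 2 * (n * m) * ‖x - y‖ ^ 2 + 2 * |S - n * m| := by
    refine (Finset.sum_le_sum fun i _ => h1 i).trans ?_
    rw [Finset.sum_add_distrib, ← Finset.mul_sum, ← Finset.mul_sum,
      ← EuclideanSpace.real_norm_sq_eq, ← EuclideanSpace.real_norm_sq_eq]
    have h4 := norm_normalizedSphereSpin_sq_le (β := β) s H t
    have h5 := sqrt_sub_sqrt_sq_le (by positivity : 0 ≤ (n : ℝ) * m) hS0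
    rw [abs_sub_comm] at h5
    have h6 := mul_le_mul h5 h4 (sq_nonneg _) (abs_nonneg _)
    linarith
  calc _ ≤ 1 / (n : ℝ) * (2 * (n * m) * ‖x - y‖ ^ 2 + 2 * |S - n * m|) := by gcongr
    _ = 2 * m * ‖x - y‖ ^ 2 + 2 * (1 / (n : ℝ) * |S - n * m|) := by
        field_simp
    _ = _ := by
        have : 1 / (n : ℝ) * S - m = 1 / (n : ℝ) * (S - n * m) := by field_simp
        rw [this, abs_mul, abs_of_pos (by positivity : (0 : ℝ) < 1 / n)]

end NormedVector

/-! ### Ramp functions -/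

/-- The piecewise linear function equal to `0` on `(-∞, 0]` and to `1` on `[1, ∞)`. -/
def ramp (u : ℝ) : ℝ := max 0 (min 1 u)

section Ramp

lemma ramp_nonneg (u : ℝ) : 0 ≤ ramp u := le_max_left _ _

lemma ramp_le_one (u : ℝ) : ramp u ≤ 1 := max_le zero_le_one (min_le_left _ _)

lemma ramp_of_one_le {u : ℝ} (h : 1 ≤ u) : ramp u = 1 := by
  rw [ramp, min_eq_left h, max_eq_right zero_le_one]

lemma ramp_of_nonpos {u : ℝ} (h : u ≤ 0) : ramp u = 0 := by
  rw [ramp, max_eq_left ((min_le_right _ _).trans h)]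

lemma continuous_ramp : Continuous ramp := by unfold ramp; fun_prop

lemma abs_ramp_sub_le (u v : ℝ) : |ramp u - ramp v| ≤ |u - v| := by
  have h1 : |min 1 u - min 1 v| ≤ |u - v| := by
    have := abs_min_sub_min_le_max 1 u 1 v
    simpa using this
  have h2 : |ramp u - ramp v| ≤ |min 1 u - min 1 v| := by
    have := abs_max_sub_max_le_max 0 (min 1 u) 0 (min 1 v)
    simpa [ramp] using this
  exact h2.trans h1

lemma abs_ramp_affine_sub_le (d t : ℝ) (k : ℕ) (u v : ℝ) :
    |ramp (d + k * (u - t)) - ramp (d + k * (v - t))| ≤ k * |u - v| := by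
  refine (abs_ramp_sub_le _ _).trans (le_of_eq ?_)
  rw [show d + k * (u - t) - (d + k * (v - t)) = k * (u - v) by ring, abs_mul, Nat.abs_cast]

lemma pseudoLipschitz_ramp (d t : ℝ) (k : ℕ) :
    PseudoLipschitz (fun u => ramp (d + k * (u - t))) k where
  nonneg := Nat.cast_nonneg k
  continuous := continuous_ramp.comp (by fun_prop)
  bound u v := by
    refine (abs_ramp_affine_sub_le d t k u v).trans ?_
    gcongr
    refine le_mul_of_one_le_right (abs_nonneg _) ?_
    linarith [abs_nonneg u, abs_nonneg v]

/-- Away from `t` the ramps eventually equal the indicator, and `Y` avoids `t` almost surely. The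
case `d = 0` lies below the indicator and `d = 1` above it, so both brackets share one limit. -/
lemma tendsto_integral_ramp {Ω : Type*} [MeasurableSpace Ω] {μ : Measure Ω} [IsProbabilityMeasure μ]
    {Y : Ω → ℝ} (hY : AEMeasurable Y μ) {t : ℝ} (ht : μ {ω | Y ω = t} = 0) (d : ℝ) :
    Tendsto (fun k : ℕ => ∫ ω, ramp (d + k * (Y ω - t)) ∂μ) atTop
      (𝓝 (μ.real {ω | t ≤ Y ω})) := by
  have hset : NullMeasurableSet {ω | t ≤ Y ω} μ := nullMeasurableSet_le aemeasurable_const hY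
  have h1 : μ.real {ω | t ≤ Y ω} = ∫ ω, Set.indicator {ω | t ≤ Y ω} (fun _ => (1 : ℝ)) ω ∂μ := by
    rw [integral_indicator₀ hset]
    simp
  rw [h1]
  refine tendsto_integral_of_dominated_convergence (fun _ => 1) (fun k => ?_)
    (integrable_const 1) (fun k => Eventually.of_forall fun ω => ?_) ?_
  · exact (continuous_ramp.measurable.comp_aemeasurable
      (((hY.sub_const t).const_mul _).const_add d)).aestronglyMeasurable
  · rw [Real.norm_eq_abs, abs_of_nonneg (ramp_nonneg _)]
    exact ramp_le_one _
  · have hne : ∀ᵐ ω ∂μ, Y ω ≠ t := by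
      rw [ae_iff]
      simpa using ht
    filter_upwards [hne] with ω hω
    rcases lt_or_gt_of_ne hω with h | h
    · rw [Set.indicator_of_notMem (by simpa using h)]
      refine tendsto_const_nhds.congr' ?_
      have hlim : Tendsto (fun k : ℕ => (k : ℝ) * (t - Y ω)) atTop atTop :=
        tendsto_natCast_atTop_atTop.atTop_mul_const (sub_pos.mpr h)
      filter_upwards [hlim.eventually_ge_atTop d] with k hk
      rw [ramp_of_nonpos]
      linarith
    · rw [Set.indicator_of_mem (by simpa using h.le)]
      refine tendsto_const_nhds.congr' ?_
      have hlim : Tendsto (fun k : ℕ => (k : ℝ) * (Y ω - t)) atTop atTop :=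
        tendsto_natCast_atTop_atTop.atTop_mul_const (sub_pos.mpr h)
      filter_upwards [hlim.eventually_ge_atTop (1 - d)] with k hk
      rw [ramp_of_one_le]
      linarith

/-- The mass of a point is the jump of the distribution function there. -/
lemma measure_eq_zero_of_continuousAt_cdf {Ω : Type*} [MeasurableSpace Ω] {μ : Measure Ω}
    [IsProbabilityMeasure μ] {Y : Ω → ℝ} (hY : AEMeasurable Y μ) {t : ℝ}
    (h : ContinuousAt (cdf (μ.map Y)) t) : μ {ω | Y ω = t} = 0 := by
  have : IsProbabilityMeasure (μ.map Y) := Measure.isProbabilityMeasure_map hY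
  have h1 : (μ.map Y) {t} = 0 := by
    rw [← measure_cdf (μ.map Y), StieltjesFunction.measure_singleton,
      h.continuousWithinAt.leftLim_eq]
    simp
  rwa [Measure.map_apply_of_aemeasurable hY (measurableSet_singleton t)] at h1

end Ramp

/-! ### Empirical means -/

section EmpMean

open BfsState

variable {n : ℕ}

lemma empMean_one_add_neg_one (s : Fin n → ℤˣ) (φ : Fin n → ℝ) :
    empMean s 1 φ + empMean s (-1) φ = 1 / (n : ℝ) * ∑ i, φ i := by
  rw [empMean, empMean, ← mul_add, ← Finset.sum_add_distrib]
  congr 1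
  refine Finset.sum_congr rfl fun i _ => ?_
  rcases Int.units_eq_one_or (s i) with h | h <;> simp [h]

lemma empMean_mono (s : Fin n → ℤˣ) (τ : ℤˣ) {φ ψ : Fin n → ℝ} (h : ∀ i, φ i ≤ ψ i) :
    empMean s τ φ ≤ empMean s τ ψ := by
  rw [empMean, empMean]
  gcongr with i
  split_ifs
  exacts [h i, le_rfl]

lemma abs_empMean_sub_le (hn : 0 < n) (s : Fin n → ℤˣ) (τ : ℤˣ) {h : ℝ → ℝ} {K : ℝ} (hK : 0 ≤ K)
    (hh : ∀ u v, |h u - h v| ≤ K * |u - v|) (φ ψ : Fin n → ℝ) {δ : ℝ} (hδ : 0 < δ) :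
    |empMean s τ (fun i => h (φ i)) - empMean s τ (fun i => h (ψ i))|
      ≤ K * (1 / (4 * δ) * (1 / (n : ℝ) * ∑ i, (φ i - ψ i) ^ 2) + δ) := by
  have hn' : (0 : ℝ) < n := by exact_mod_cast hn
  rw [empMean, empMean, ← mul_sub, ← Finset.sum_sub_distrib, abs_mul,
    abs_of_pos (by positivity : (0 : ℝ) < 1 / n)]
  have h1 : |∑ i, ((if s i = τ then h (φ i) else 0) - if s i = τ then h (ψ i) else 0)|
      ≤ ∑ i, K * (1 / (4 * δ) * (φ i - ψ i) ^ 2 + δ) := by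
    refine (Finset.abs_sum_le_sum_abs _ _).trans (Finset.sum_le_sum fun i _ => ?_)
    have h2 := mul_le_mul_of_nonneg_left (abs_le_sq_div_add hδ (φ i - ψ i)) hK
    split_ifs
    · exact (hh _ _).trans h2
    · rw [sub_self, abs_zero]; positivity
  calc _ ≤ 1 / (n : ℝ) * ∑ i, K * (1 / (4 * δ) * (φ i - ψ i) ^ 2 + δ) := by gcongr
    _ = _ := by
      rw [← Finset.mul_sum, Finset.sum_add_distrib, ← Finset.mul_sum, Finset.sum_const,
        Finset.card_univ, Fintype.card_fin, nsmul_eq_mul]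
      field_simp

lemma empMean_ite (s : Fin n → ℤˣ) (τ : ℤˣ) (Q : Fin n → Prop) [DecidablePred Q] :
    empMean s τ (fun i => if Q i then 1 else 0)
      = 1 / (n : ℝ) * (Set.ncard {i : Fin n | s i = τ ∧ Q i} : ℝ) := by
  rw [empMean]
  congr 1
  have : {i : Fin n | s i = τ ∧ Q i} = ((Finset.univ.filter fun i => s i = τ ∧ Q i :
      Finset (Fin n)) : Set (Fin n)) := by
    ext i; simp
  rw [this, Set.ncard_coe_finset, Finset.card_filter]
  push_cast
  refine Finset.sum_congr rfl fun i _ => ?_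
  by_cases h1 : s i = τ <;> by_cases h2 : Q i <;> simp [h1, h2]

/-- The estimate is twice an indicator minus one; the last bracket is the normalized imbalance of
the spins, which tends to zero. -/
lemma spinOverlap_thresholdSpin (s : Fin n → ℤˣ) (x : EuclideanSpace ℝ (Fin n)) (θ : ℝ) :
    spinOverlap s (thresholdSpin x θ)
      = 2 * empMean s 1 (fun i => if θ ≤ x i then 1 else 0)
        - 2 * empMean s (-1) (fun i => if θ ≤ x i then 1 else 0)
        - (empMean s 1 (fun _ => 1) - empMean s (-1) (fun _ => 1)) := by
  simp only [spinOverlap, empMean, Finset.mul_sum, ← Finset.sum_sub_distrib]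
  refine Finset.sum_congr rfl fun i _ => ?_
  rw [thresholdSpin]
  rcases Int.units_eq_one_or (s i) with h | h <;> by_cases h' : θ ≤ x i <;>
    simp [h, h'] <;> ring

end EmpMean

/-! ### Limits of threshold counts -/

section Threshold

open BfsState

variable {a b c : ℝ} {Ω : ℕ → Type*} [∀ n, MeasurableSpace (Ω n)] {P : ∀ n, Measure (Ω n)}
  {σ : ∀ n, Ω n → Fin n → ℤˣ} {G : ∀ n, Ω n → SimpleGraph (Fin n)} {ℓ : ℕ → ℕ}
  {Ω' : Type*} [MeasurableSpace Ω'] {μ : Measure Ω'} [IsProbabilityMeasure μ]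
  {Vp Vm : ℕ → Ω' → ℕ}

lemma pseudoLipschitz_sq : PseudoLipschitz (fun x => x ^ 2) 1 where
  nonneg := zero_le_one
  continuous := by fun_prop
  bound x y := by
    rw [one_mul, show x ^ 2 - y ^ 2 = (x - y) * (x + y) by ring, abs_mul]
    gcongr
    linarith [abs_add_le x y]

lemma pseudoLipschitz_one : PseudoLipschitz (fun _ => 1) 0 where
  nonneg := le_rfl
  continuous := continuous_const
  bound x y := by simp

lemma tendstoInProb_mean_sq (ha : 0 ≤ a) (hb : 0 ≤ b)
    (hαβ : (a + b) / 2 < ((a - b) / 2) ^ 2) (hc : 0 < c)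
    (hcα : c * Real.log ((a + b) / 2) < 1 / 2)
    (hℓ : Tendsto (fun n : ℕ => (ℓ n : ℝ) / Real.log n) atTop (𝓝 c))
    (hG : ∀ᶠ n in atTop, IsStochasticBlockModel a b (P n) (σ n) (G n))
    (hV : IsPoissonTreeProcess a b μ Vp Vm) :
    TendstoInProb P (fun n ω => 1 / (n : ℝ) *
        ∑ i, ((((a - b) / 2) ^ ℓ n)⁻¹ * sphereSpin (σ n ω) (G n ω) (ℓ n) i) ^ 2)
      (∫ ω, treeDeltaLimit ((a - b) / 2) Vp Vm ω ^ 2 ∂μ) := by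
  have h := (tendstoInProb_empMean ha hb hαβ hc hcα hℓ hG hV pseudoLipschitz_sq 1).add
    (tendstoInProb_empMean ha hb hαβ hc hcα hℓ hG hV pseudoLipschitz_sq (-1))
  simp only [empMean_one_add_neg_one] at h
  convert h using 1
  simp only [Units.val_one, Int.cast_one, one_mul, Units.val_neg, Int.cast_neg, neg_mul, neg_sq]
  ring

/-- An indicator is not an admissible test function, so it is bracketed by ramps of a fixed slope
`k`. On these the law of large numbers applies, and replacing `√(n m) x` by the rescaled sphere sums
costs a vanishing mean square plus an arbitrarily small constant. -/
lemma tendstoInProb_threshold (ha : 0 ≤ a) (hb : 0 ≤ b)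
    (hαβ : (a + b) / 2 < ((a - b) / 2) ^ 2) (hc : 0 < c)
    (hcα : c * Real.log ((a + b) / 2) < 1 / 2)
    (hℓ : Tendsto (fun n : ℕ => (ℓ n : ℝ) / Real.log n) atTop (𝓝 c))
    (hG : ∀ᶠ n in atTop, IsStochasticBlockModel a b (P n) (σ n) (G n))
    (hV : IsPoissonTreeProcess a b μ Vp Vm) {m : ℝ}
    (hm : m = ∫ ω, treeDeltaLimit ((a - b) / 2) Vp Vm ω ^ 2 ∂μ)
    (x : ∀ n, Ω n → EuclideanSpace ℝ (Fin n))
    (hx : TendstoInProb P (fun n ω =>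
      ‖x n ω - normalizedSphereSpin ((a - b) / 2) (σ n ω) (G n ω) (ℓ n)‖) 0)
    (τ : ℤˣ) {t : ℝ}
    (ht : μ {ω | ((τ : ℤ) : ℝ) * treeDeltaLimit ((a - b) / 2) Vp Vm ω = t} = 0) :
    TendstoInProb P (fun n ω => empMean (σ n ω) τ fun i =>
        if t / Real.sqrt (n * m) ≤ x n ω i then 1 else 0)
      (1 / 2 * μ.real {ω | t ≤ ((τ : ℤ) : ℝ) * treeDeltaLimit ((a - b) / 2) Vp Vm ω}) := by
  obtain ⟨-, hΔ, -, -, hpos⟩ := hV.treeDelta_limit ha hb hαβ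
  have hβ2 := sq_pos_of_lt_sq ha hb hαβ
  have hsq := tendstoInProb_mean_sq ha hb hαβ hc hcα hℓ hG hV
  have hLLN : ∀ (d : ℝ) (k : ℕ), _ := fun d k =>
    tendstoInProb_empMean ha hb hαβ hc hcα hℓ hG hV (pseudoLipschitz_ramp d t k) τ
  rw [← hm] at hpos hsq
  set β := (a - b) / 2 with hβ
  have hβ0 : β ≠ 0 := fun h0 => by simp [h0] at hβ2
  set Y : Ω' → ℝ := fun ω => ((τ : ℤ) : ℝ) * treeDeltaLimit β Vp Vm ω with hY
  have hYm : AEMeasurable Y μ := hΔ.1.aemeasurable.const_mul _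
  let W : ∀ n, Ω n → Fin n → ℝ := fun n ω i => Real.sqrt (n * m) * x n ω i
  let X : ∀ n, Ω n → Fin n → ℝ := fun n ω i => (β ^ ℓ n)⁻¹ * sphereSpin (σ n ω) (G n ω) (ℓ n) i
  let R : ∀ n, Ω n → ℝ := fun n ω =>
    2 * m * ‖x n ω - normalizedSphereSpin β (σ n ω) (G n ω) (ℓ n)‖ ^ 2
      + 2 * |1 / (n : ℝ) * ∑ i, X n ω i ^ 2 - m|
  have hR : TendstoInProb P R 0 := by
    have h1 := (hx.comp (g := fun y => 2 * m * y ^ 2) (by fun_prop)).add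
      (hsq.comp (g := fun y => 2 * |y - m|) (by fun_prop))
    simpa [R, X] using h1
  refine TendstoInProb.of_squeeze fun ε hε => ?_
  obtain ⟨k, hk0, hk1⟩ := (((tendsto_integral_ramp hYm ht 0).eventually
    (Metric.ball_mem_nhds _ hε)).and ((tendsto_integral_ramp hYm ht 1).eventually
    (Metric.ball_mem_nhds _ hε))).exists
  rw [Real.dist_eq, abs_lt] at hk0 hk1
  -- This keeps the residual error `k δ` below `ε / 2` whatever the slope; the other `ε / 2` is half
  -- of the ramp error, because of the prefactor `1 / 2`.
  set δ := ε / (2 * (k + 1)) with hδ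
  have hδ0 : 0 < δ := by positivity
  have hkδ : k * δ ≤ ε / 2 := by
    rw [hδ, mul_div_assoc', div_le_div_iff₀ (by positivity) (by norm_num)]
    nlinarith
  have hE : TendstoInProb P (fun n ω => (k : ℝ) * (1 / (4 * δ) * R n ω + δ)) (k * δ) := by
    have := hR.comp (g := fun y => (k : ℝ) * (1 / (4 * δ) * y + δ)) (by fun_prop)
    simpa using this
  refine ⟨_, _, _, _, (hLLN 0 k).sub hE, (hLLN 1 k).add hE, by linarith, by linarith, ?_⟩
  filter_upwards [eventually_gt_atTop 0] with n hn ω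
  have hn' : (0 : ℝ) < n := by exact_mod_cast hn
  have hroot : 0 < Real.sqrt (n * m) := Real.sqrt_pos.mpr (by positivity)
  have hdist : ∀ d : ℝ, |empMean (σ n ω) τ (fun i => ramp (d + k * (W n ω i - t)))
      - empMean (σ n ω) τ (fun i => ramp (d + k * (X n ω i - t)))|
      ≤ k * (1 / (4 * δ) * R n ω + δ) := by
    intro d
    refine (abs_empMean_sub_le hn (σ n ω) τ (Nat.cast_nonneg k) (abs_ramp_affine_sub_le d t k)
      (W n ω) (X n ω) hδ0).trans ?_
    gcongr
    exact mean_sq_scaled_sub_le hβ0 hn hpos.le _ _ _ _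
  have hiff : ∀ i, t / Real.sqrt (n * m) ≤ x n ω i ↔ t ≤ W n ω i := fun i => by
    rw [div_le_iff₀ hroot, mul_comm]
  simp only [hiff]
  have hlow : empMean (σ n ω) τ (fun i => ramp (0 + k * (W n ω i - t)))
      ≤ empMean (σ n ω) τ (fun i => if t ≤ W n ω i then 1 else 0) := by
    refine empMean_mono _ _ fun i => ?_
    split_ifs with h
    · exact ramp_le_one _
    · rw [ramp_of_nonpos]
      have := mul_nonneg (Nat.cast_nonneg (α := ℝ) k) (sub_nonneg.mpr (not_le.mp h).le)
      linarith
  have hupp : empMean (σ n ω) τ (fun i => if t ≤ W n ω i then 1 else 0)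
      ≤ empMean (σ n ω) τ (fun i => ramp (1 + k * (W n ω i - t))) := by
    refine empMean_mono _ _ fun i => ?_
    split_ifs with h
    · rw [ramp_of_one_le]
      have := mul_nonneg (Nat.cast_nonneg (α := ℝ) k) (sub_nonneg.mpr h)
      linarith
    · exact ramp_nonneg _
  have h0 := abs_le.mp (hdist 0)
  have h1 := abs_le.mp (hdist 1)
  constructor
  · refine le_trans ?_ hlow
    linarith [h0.1]
  · refine hupp.trans ?_
    linarith [h1.2]

end Threshold

end

/-! ### Assembly of the claims. -/

theorem mainTheorem6
    (a b α β c : ℝ) (ha : 0 ≤ a) (hb : 0 ≤ b)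
    (hα : α = (a + b) / 2) (hβ : β = (a - b) / 2) (hαβ : α < β ^ 2)
    (ℓ : ℕ → ℕ) (hc : 0 < c) (hcα : c * Real.log α < 1 / 2)
    (hℓ : Tendsto (fun n : ℕ => (ℓ n : ℝ) / Real.log n) atTop (𝓝 c))
    -- the random graphs
    {Ω : ℕ → Type*} [∀ n, MeasurableSpace (Ω n)]
    (P : ∀ n, Measure (Ω n)) [∀ n, IsProbabilityMeasure (P n)]
    (σ : ∀ n, Ω n → Fin n → ℤˣ) (G : ∀ n, Ω n → SimpleGraph (Fin n))
    (hG : ∀ᶠ n in atTop, IsStochasticBlockModel a b (P n) (σ n) (G n))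
    -- the tree process
    {Ω' : Type*} [MeasurableSpace Ω'] (μ : Measure Ω') [IsProbabilityMeasure μ]
    (Vp Vm : ℕ → Ω' → ℕ) (hV : IsPoissonTreeProcess a b μ Vp Vm)
    (Δinf : Ω' → ℝ) (hΔinf : Δinf = treeDeltaLimit β Vp Vm)
    (m₂ : ℝ) (hm₂ : m₂ = ∫ ω, Δinf ω ^ 2 ∂μ) :
    -- the martingale converges almost surely to a square-integrable limit
    ((∀ᵐ ω ∂μ, Tendsto (fun t => treeDelta β Vp Vm t ω) atTop (𝓝 (Δinf ω))) ∧
      MemLp Δinf 2 μ) ∧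
    -- second moments
    TendstoInProb P
      (fun n ω => (1 / (n : ℝ)) *
        ∑ i, (β ^ (2 * ℓ n))⁻¹ * sphereSpin (σ n ω) (G n ω) (ℓ n) i ^ 2) m₂ ∧
    -- empirical threshold fractions
    (∀ τ : ℝ, ContinuousAt (cdf (μ.map Δinf)) τ →
      ContinuousAt (cdf (μ.map fun ω => -Δinf ω)) τ →
      ∀ s : ℤˣ,
        TendstoInProb P
          (fun n ω => (1 / (n : ℝ)) *
            (Set.ncard {i : Fin n | σ n ω i = s ∧
              τ / Real.sqrt (n * m₂) ≤
                normalizedSphereSpin β (σ n ω) (G n ω) (ℓ n) i} : ℝ))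
          (1 / 2 * μ.real {ω | τ ≤ ((s : ℤ) : ℝ) * Δinf ω})) ∧
    -- overlap of the thresholded vector
    (∀ x : ∀ n, Ω n → EuclideanSpace ℝ (Fin n),
      TendstoInProb P
        (fun n ω => ‖x n ω - normalizedSphereSpin β (σ n ω) (G n ω) (ℓ n)‖) 0 →
      ∀ t : ℝ, μ {ω | Δinf ω = t} = 0 → μ {ω | -Δinf ω = t} = 0 →
        TendstoInProb P
          (fun n ω => spinOverlap (σ n ω) (thresholdSpin (x n ω) (t / Real.sqrt (n * m₂))))
          (μ.real {ω | t ≤ Δinf ω} - μ.real {ω | t ≤ -Δinf ω})) := by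
  subst hα hβ hΔinf
  have hb0 := sq_pos_of_lt_sq ha hb hαβ
  have hβ0 : (a - b) / 2 ≠ 0 := fun h0 => by simp [h0] at hb0
  obtain ⟨hlim, hΔ, -, -, hpos⟩ := hV.treeDelta_limit ha hb hαβ
  have hΔm : AEMeasurable (treeDeltaLimit ((a - b) / 2) Vp Vm) μ := hΔ.1.aemeasurable
  have hatom : ∀ (t : ℝ), μ {ω | treeDeltaLimit ((a - b) / 2) Vp Vm ω = t} = 0 →
      μ {ω | -treeDeltaLimit ((a - b) / 2) Vp Vm ω = t} = 0 → ∀ τ : ℤˣ,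
      μ {ω | ((τ : ℤ) : ℝ) * treeDeltaLimit ((a - b) / 2) Vp Vm ω = t} = 0 := by
    intro t h1 h2 τ
    rcases Int.units_eq_one_or τ with rfl | rfl
    · simpa using h1
    · simpa using h2
  refine ⟨⟨hlim, hΔ⟩, ?_, ?_, ?_⟩
  · rw [hm₂]
    refine (tendstoInProb_mean_sq ha hb hαβ hc hcα hℓ hG hV).congr (Eventually.of_forall
      fun n ω => ?_)
    congr 1
    refine Finset.sum_congr rfl fun i _ => ?_
    rw [mul_pow, inv_pow, ← pow_mul, mul_comm 2]
  · intro τ h1 h2 s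
    -- The fractions for `y` itself are the case `x = y` of the threshold limit.
    have h0 : TendstoInProb P (fun n ω =>
        ‖normalizedSphereSpin ((a - b) / 2) (σ n ω) (G n ω) (ℓ n)
          - normalizedSphereSpin ((a - b) / 2) (σ n ω) (G n ω) (ℓ n)‖) 0 := by
      intro ε hε
      simp [hε.not_ge]
    have h := tendstoInProb_threshold ha hb hαβ hc hcα hℓ hG hV hm₂ _ h0 s
      (hatom τ (measure_eq_zero_of_continuousAt_cdf hΔm h1)
        (measure_eq_zero_of_continuousAt_cdf hΔm.neg h2) s)
    simpa only [empMean_ite] using h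
  · intro x hx t h1 h2
    -- The constant test function shows that each spin class has asymptotic density `1 / 2`, so the
    -- imbalance term in the overlap disappears.
    have hone : ∀ τ : ℤˣ, TendstoInProb P
        (fun n ω => BfsState.empMean (σ n ω) τ fun _ => 1) (1 / 2) := fun τ => by
      simpa using tendstoInProb_empMean ha hb hαβ hc hcα hℓ hG hV pseudoLipschitz_one τ
    have hcnt := fun τ : ℤˣ => (tendstoInProb_threshold ha hb hαβ hc hcα hℓ hG hV hm₂ x hx τ
      (hatom t h1 h2 τ)).const_mul 2
    have h := ((hcnt 1).sub (hcnt (-1))).sub ((hone 1).sub (hone (-1)))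
    simp only [spinOverlap_thresholdSpin]
    simpa using h
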